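/- Let $f$ be a probability density on $\mathbb R$ with mean zero and finite variance. For $x\in\mathbb R$ let $P_x$ be the law of the random walk $(S_n)_{n\ge0}$ with $S_0=x$ and independent steps of density $f$, and write $p(x,y)=f(y-x)$ for its transition densities. Let $(H_k)_{k\ge0}$ and $(D_k)_{k\ge0}$ be the strictly ascending and strictly descending ladder height processes of the walk ($H_0=D_0=S_0$, and $H_{k}$, resp. $D_k$, is the value of $S$ at its first time strictly above $H_{k-1}$, resp. strictly below $D_{k-1}$). Put $\mu_H=E_0[H_1-H_0]$, $m(dy)=\mu_H^{-1}P_0(H_1-H_0>y)\mathbb 1_{y>0}\,dy$, and let $h(x)=\sum_{k\ge0}P_x(D_k\ge0)$ be the renewal function. For $x\ge0$ let $P_x^{\uparrow0}$ be the law of the walk started from $x$ and conditioned to stay nonnegative, i.e. the probability law on sequences $(S_n)_{n\ge0}$ such that for every $n$ and every measurable $F\ge0$, $$P_x^{\uparrow0}\big(F(S_0,\dots,S_n)\big)=\frac1{h(x)}\,P_x\Big(F(S_0,\dots,S_n)\,h(S_n)\,;\ \inf_{k\le n}S_k\ge0\Big).$$ For a two-sided real sequence $\omega=(\omega_n)_{n\in\mathbb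 Z}$ and $x\in\mathbb R$ let $T_x=\inf\{n\in\mathbb Z:\omega_n>x\}$ and $\Theta_x(\omega)=(\omega_{n+T_x}-x)_{n\in\mathbb Z}$. A probability law on $\mathbb R^{\mathbb Z}$, under which almost surely $\omega_n\to-\infty$ as $n\to-\infty$ and $\limsup_{n\to+\infty}\omega_n=+\infty$, is called spatially stationary if it is invariant under $\Theta_x$ for every $x\in\mathbb R$. The law $\mathbf P^1$ of the spatially stationary random walk is the spatially stationary law of $(S_n)_{n\in\mathbb Z}$ under which $(S_n)_{n\ge0}$ is the walk above with initial law $m$. Then the laws $P_x^{\uparrow 0}$, $x\ge 0$, exist and depend measurably on $x$; the law $\mathbf P^1$ exists and is unique; the measure $$\nu(dx\,dy)=\frac1{\mu_H}\,p(0,x+y)\,\mathbb 1_{x\ge0,\,y\ge0}\,h(x)\,dx\,dy$$ is a probability measure; and a measure on $\mathbb R^{\mathbb Z}$ is equal to $\mathbf P^1$ if and only if, under it, * $(-S_{-1},S_0)$ has law $\nu$; * conditionally on $-S_{-1}=x$ and $S_0=y$, the processes $(-S_{-n-1})_{n\ge0}$ and $(S_n)_{n\ge0}$ are independent, with laws $P_x^{\uparrow0}$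 and $P_y$ respectively. -/

import Mathlib

open MeasureTheory ProbabilityTheory Filter Topology
open scoped ENNReal

namespace SpatialWalk

noncomputable section

/-- The law on `ℝ` with density `f`, which is the law of the steps of the walk. -/
def stepLaw (f : ℝ → ℝ) : Measure ℝ :=
  volume.withDensity fun u => ENNReal.ofReal (f u)

/-- The transition densities `p(x, y)` of the walk with step density `f`. -/
def transitionDensity (f : ℝ → ℝ) (x y : ℝ) : ℝ := f (y - x)

/-- The path `x, x + ξ₀, x + ξ₀ + ξ₁, …` of the walk with starting point `x` and steps `ξ`. -/
def path (x : ℝ) (ξ : ℕ → ℝ) : ℕ → ℝ := fun n => x + ∑ i ∈ Finset.range n, ξ i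

theorem measurable_path : Measurable fun p : ℝ × (ℕ → ℝ) => path p.1 p.2 := by
  unfold path
  fun_prop

/-- The kernel `x ↦ P_x`, where `P_x` is the law of the walk `(S_n)_{n ≥ 0}` with `S_0 = x` and
independent steps of density `f`. -/
def walk (f : ℝ → ℝ) [IsProbabilityMeasure (stepLaw f)] : Kernel ℝ (ℕ → ℝ) where
  toFun x := (Measure.infinitePi fun _ : ℕ => stepLaw f).map (path x)
  measurable' := by
    refine Measure.measurable_of_measurable_coe _ fun s hs => ?_
    have h : ∀ x : ℝ, Measurable (path x) := fun x =>
      measurable_path.comp measurable_prodMk_left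
    simp_rw [Measure.map_apply (h _) hs]
    exact measurable_measure_prodMk_left (measurable_path hs)

instance isMarkovKernel_walk (f : ℝ → ℝ) [IsProbabilityMeasure (stepLaw f)] :
    IsMarkovKernel (walk f) where
  isProbabilityMeasure x := by
    have h : Measurable (path x) := measurable_path.comp measurable_prodMk_left
    exact Measure.isProbabilityMeasure_map h.aemeasurable

/-- The strictly ascending ladder times `n_k` of a path: `n_0 = 0` and `n_{k+1}` is the first
`n > n_k` with `s n > s n_k`; the value is `⊤` if there is none (or if `n_k = ⊤`). -/
def ascLadderTime (s : ℕ → ℝ) : ℕ → ℕ∞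
  | 0 => 0
  | k + 1 => sInf {t : ℕ∞ | ∃ m n : ℕ,
      ascLadderTime s k = m ∧ t = n ∧ m < n ∧ s m < s n}

/-- The strictly descending ladder times of a path. -/
def descLadderTime (s : ℕ → ℝ) : ℕ → ℕ∞ := ascLadderTime fun n => -s n

/-- The first increment `H_1 - H_0` of the strictly ascending ladder height process
(`0` on the event that there is no ladder time, which is null for a centred walk). -/
def ladderStep (s : ℕ → ℝ) : ℝ := s (ascLadderTime s 1).toNat - s 0

section

variable (f : ℝ → ℝ) [IsProbabilityMeasure (stepLaw f)]

/-- `μ_H`, the expectation of `H_1 - H_0`, a nonnegative random variable. -/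
def ladderDrift : ℝ≥0∞ := ∫⁻ s, ENNReal.ofReal (ladderStep s) ∂(walk f 0)

/-- The renewal function `h(x) = ∑_k P_x(D_k ≥ 0)`, `D` being the strictly descending ladder
height process. -/
def renewal (x : ℝ) : ℝ≥0∞ :=
  ∑' k : ℕ, walk f x {s | ∃ n : ℕ, descLadderTime s k = n ∧ 0 ≤ s n}

/-- `ν(dx dy) = μ_H⁻¹ p(0, x + y) 1_{x ≥ 0, y ≥ 0} h(x) dx dy`. -/
def jointLaw : Measure (ℝ × ℝ) :=
  volume.withDensity <| Set.indicator {q : ℝ × ℝ | 0 ≤ q.1 ∧ 0 ≤ q.2} fun q =>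
    (ladderDrift f)⁻¹ * ENNReal.ofReal (transitionDensity f 0 (q.1 + q.2)) * renewal f q.1

/-- The stationary law of the overshoot, `m(dy) = μ_H⁻¹ P_0(H_1 - H_0 > y) dy` on `y > 0`. -/
def overshootLaw : Measure ℝ :=
  (volume.restrict (Set.Ioi 0)).withDensity fun y =>
    (ladderDrift f)⁻¹ * walk f 0 {s | y < ladderStep s}

/-- `μ` is the law `P_x^{↑0}` of the walk started from `x ≥ 0` and conditioned to stay
nonnegative: for each `n` and each functional `F` of the first `n` steps,
`μ(F(S)) = h(x)⁻¹ P_x(F(S) h(S_n), inf_{k ≤ n} S_k ≥ 0)`. -/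
structure IsConditionedWalk (x : ℝ) (μ : Measure (ℕ → ℝ)) : Prop where
  isProbabilityMeasure : IsProbabilityMeasure μ
  lintegral_eq : ∀ (n : ℕ) (F : (Fin (n + 1) → ℝ) → ℝ≥0∞), Measurable F →
    ∫⁻ s, F (fun i => s i) ∂μ =
      (renewal f x)⁻¹ * ∫⁻ s, Set.indicator {s : ℕ → ℝ | ∀ k ≤ n, 0 ≤ s k}
        (fun s => F (fun i => s i) * renewal f (s n)) s ∂(walk f x)

end

/-- `T_x = inf {n ∈ ℤ | ω_n > x}`. -/
def hittingTime (x : ℝ) (ω : ℤ → ℝ) : ℤ := sInf {n : ℤ | x < ω n}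

/-- The spatial translation `Θ_x ω = (ω_{n + T_x} - x)_n`. -/
def spatialShift (x : ℝ) (ω : ℤ → ℝ) : ℤ → ℝ := fun n => ω (n + hittingTime x ω) - x

/-- `P` is a spatially stationary probability on two-sided real sequences. The two limit
conditions make all the hitting times `T_x` finite almost surely. -/
structure IsSpatiallyStationary (P : Measure (ℤ → ℝ)) : Prop where
  isProbabilityMeasure : IsProbabilityMeasure P
  tendsto_atBot : ∀ᵐ ω ∂P, Tendsto ω atBot atBot
  limsup_eq_top : ∀ᵐ ω ∂P, limsup (fun n : ℤ => (ω n : EReal)) atTop = ⊤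
  map_spatialShift : ∀ x : ℝ, P.map (spatialShift x) = P

/-- The part `(S_n)_{n ≥ 0}` of a two-sided sequence. -/
def future (ω : ℤ → ℝ) : ℕ → ℝ := fun n => ω n

/-- The part `(-S_{-n-1})_{n ≥ 0}` of a two-sided sequence. -/
def past (ω : ℤ → ℝ) : ℕ → ℝ := fun n => -ω (-(n : ℤ) - 1)

section

variable (f : ℝ → ℝ) [IsProbabilityMeasure (stepLaw f)]

/-- `P` is the law of the spatially stationary random walk: it is spatially stationary, and
under `P` the sequence `(S_n)_{n ≥ 0}` is the walk with initial law `m`. -/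
structure IsSpatiallyStationaryWalk (P : Measure (ℤ → ℝ)) : Prop where
  isSpatiallyStationary : IsSpatiallyStationary P
  map_future : P.map future = (overshootLaw f).bind (walk f)

/-- Under `P`, the pair `(-S_{-1}, S_0)` has law `ν` and, conditionally on `-S_{-1} = x` and
`S_0 = y`, the sequences `(-S_{-n-1})_{n ≥ 0}` and `(S_n)_{n ≥ 0}` are independent with laws
`κ x` and `P_y`. -/
structure HasDisintegration (κ : Kernel ℝ (ℕ → ℝ)) (P : Measure (ℤ → ℝ)) : Prop where
  map_pair : P.map (fun ω => (-ω (-1), ω 0)) = jointLaw f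
  map_pair_past_future :
    P.map (fun ω => ((-ω (-1), ω 0), (past ω, future ω))) =
      (jointLaw f).compProd
        ((κ.comap Prod.fst measurable_fst).prod ((walk f).comap Prod.snd measurable_snd))

end

end

end SpatialWalk

open SpatialWalk

/-! Write `h` for `renewal f`. Two reversals carry the proof.

Reversing finitely many steps gives the duality `h(x) = ∑_n P_0(S_1, …, S_n < 0, S_n ≥ -x)`
(`renewal_eq_tsum_neg`), so `h` counts visits to `[-x, 0]` before the walk enters `[0, ∞)` at a
positive time. The central limit theorem forces this entrance almost surely, and therefore `h` is
harmonic for the walk killed below `0` (`lintegral_renewal_add`). Splitting at the jump which enters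
gives `P_0(H_1 - H_0 > y) = ∫ f(z + y) h(z) dz` (`walk_lt_ladderStep`): `m` is the second marginal
of `ν`, and `ν` has mass one as soon as `0 < μ_H < ∞`. Finiteness follows from the finite variance
and the linear growth of `h`, itself a consequence of subadditivity (`renewal_le_add`). The
conditioned walk is the `h`-transform of the killed walk.

Started from Lebesgue measure, the walk reversed in time and sign is the same walk
(`lintegral_lintegral_walk_reverse`). Build `Q` from `ν` and the two kernels. The weight `h(x)` of
`ν` cancels the `1 / h(x)` of the `h`-transform, and reversing the past shows that the sequence seen
from time `-(N + 1)` on is the walk started from `μ_H⁻¹ h(-z) dz`, restricted to a first passage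
above `0` at time `N + 1` (`lintegral_window`). Splitting a first passage above `x ≥ 0` at the first
passage above `0`, and reversing again, expresses the sequence seen from `T_x` by the same formula,
with `h(u)` replaced by the expectation of `h(S_n - x)` for the killed walk started from `u`
(`sum_lintegral_firstAt`, `lintegral_upAt_eq_killed`). This expectation increases to `h(u)`, because
`h(v) - h(x) ≤ h(v - x) ≤ h(v)`, `h` is invariant and the survival probability tends to `0`. The
limit yields both the passage above `x` and the invariance under `Θ_x`. For negative levels, `Θ_x`
inverts `Θ_{-x}`.

Uniqueness does not use the walk. For a high level `x`, with probability close to one the `L` steps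
before `T_x` all lie in the future, so a spatially stationary law is determined by the law of its
future (`IsSpatiallyStationary.eq_of_map_future`). The equivalence holds because each of the two
properties characterises `Q`. -/

namespace SpatialWalk

/-! ### One-sided sequences and i.i.d. products. -/

/-- Prepend a term to a sequence. -/
def cons {α : Type*} (a : α) (s : ℕ → α) : ℕ → α
  | 0 => a
  | n + 1 => s n

@[simp] theorem cons_zero {α : Type*} (a : α) (s : ℕ → α) : cons a s 0 = a := rfl

@[simp] theorem cons_succ {α : Type*} (a : α) (s : ℕ → α) (n : ℕ) : cons a s (n + 1) = s n := rfl

theorem measurable_cons {α : Type*} [MeasurableSpace α] :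
    Measurable fun p : α × (ℕ → α) => cons p.1 p.2 := by
  refine measurable_pi_iff.2 fun n => ?_
  cases n with
  | zero => exact measurable_fst
  | succ n => exact (measurable_pi_apply n).comp measurable_snd

/-- The sequence after time `n`. -/
def shift {α : Type*} (n : ℕ) (s : ℕ → α) : ℕ → α := fun k => s (n + k)

/-- The sequence stopped at time `n`. -/
def stopAt {α : Type*} (n : ℕ) (s : ℕ → α) : ℕ → α := fun k => s (min k n)

theorem measurable_shift {α : Type*} [MeasurableSpace α] (n : ℕ) :
    Measurable (shift n : (ℕ → α) → ℕ → α) :=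
  measurable_pi_iff.2 fun _ => measurable_pi_apply _

theorem measurable_stopAt {α : Type*} [MeasurableSpace α] (n : ℕ) :
    Measurable (stopAt n : (ℕ → α) → ℕ → α) :=
  measurable_pi_iff.2 fun _ => measurable_pi_apply _

theorem stopAt_succ_cons {α : Type*} (n : ℕ) (a : α) (s : ℕ → α) :
    stopAt (n + 1) (cons a s) = cons a (stopAt n s) := by
  funext k
  cases k with
  | zero => simp [stopAt]
  | succ k => simp [stopAt, Nat.succ_min_succ]

theorem shift_succ_cons {α : Type*} (n : ℕ) (a : α) (s : ℕ → α) :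
    shift (n + 1) (cons a s) = shift n s := by
  funext k
  simp [shift, Nat.add_right_comm n 1 k]

theorem infinitePi_map_cons {α : Type*} [MeasurableSpace α] (μ : Measure α)
    [IsProbabilityMeasure μ] :
    (μ.prod (Measure.infinitePi fun _ : ℕ => μ)).map (fun p => cons p.1 p.2) =
      Measure.infinitePi fun _ : ℕ => μ := by
  classical
  refine Measure.eq_infinitePi _ fun s t ht => ?_
  rw [Measure.map_apply measurable_cons (.pi s.countable_toSet fun i _ => ht i)]
  have h : (fun p : α × (ℕ → α) => cons p.1 p.2) ⁻¹' (Set.pi s t) =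
      (if 0 ∈ s then t 0 else Set.univ) ×ˢ
        (Set.pi (s.preimage Nat.succ (Nat.succ_injective.injOn)) fun i => t (i + 1)) := by
    ext p
    simp only [Set.mem_preimage, Set.mem_pi, Set.mem_prod, Finset.mem_coe, Finset.mem_preimage]
    constructor
    · intro h
      refine ⟨?_, fun i hi => h _ hi⟩
      split_ifs with h0
      · exact h 0 h0
      · trivial
    · rintro ⟨h0, h1⟩ i hi
      cases i with
      | zero => simpa [hi] using h0
      | succ i => exact h1 i hi
  rw [h, Measure.prod_prod, Measure.infinitePi_pi (fun _ : ℕ => μ) (fun i _ => ht _)]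
  have h1 : ∏ i ∈ s.preimage Nat.succ (Nat.succ_injective.injOn), μ (t (i + 1)) =
      ∏ i ∈ s.erase 0, μ (t i) := by
    refine Finset.prod_bij (fun i _ => i + 1) ?_ ?_ ?_ ?_
    · intro i hi; simpa using hi
    · intro i _ j _ h; simpa using h
    · intro j hj
      obtain ⟨h0, hj⟩ := Finset.mem_erase.1 hj
      obtain ⟨i, rfl⟩ := Nat.exists_eq_succ_of_ne_zero h0
      exact ⟨i, by simpa using hj, rfl⟩
    · intro i _; rfl
  rw [h1]
  split_ifs with h0
  · rw [Finset.mul_prod_erase s (fun i => μ (t i)) h0]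
  · simp [Finset.erase_eq_of_notMem h0]

theorem lintegral_infinitePi_cons {α : Type*} [MeasurableSpace α] (μ : Measure α)
    [IsProbabilityMeasure μ] {G : (ℕ → α) → ℝ≥0∞} (hG : Measurable G) :
    ∫⁻ ξ, G ξ ∂(Measure.infinitePi fun _ : ℕ => μ) =
      ∫⁻ u, ∫⁻ ξ, G (cons u ξ) ∂(Measure.infinitePi fun _ : ℕ => μ) ∂μ := by
  conv_lhs => rw [← infinitePi_map_cons μ, lintegral_map hG measurable_cons]
  exact lintegral_prod _ (hG.comp measurable_cons).aemeasurable

theorem infinitePi_map_perm {α : Type*} [MeasurableSpace α] (μ : Measure α)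
    [IsProbabilityMeasure μ] (e : Equiv.Perm ℕ) :
    (Measure.infinitePi fun _ : ℕ => μ).map (fun ξ i => ξ (e i)) =
      Measure.infinitePi fun _ : ℕ => μ := by
  have h := Measure.infinitePi_map_piCongrLeft (X := fun _ : ℕ => α) (fun _ : ℕ => μ) e.symm
  convert h using 2
  ext ξ i
  have h1 := Equiv.piCongrLeft_apply_apply (fun _ : ℕ => α) e.symm ξ (e i)
  rw [Equiv.symm_apply_apply] at h1
  exact h1.symm

/-! ### Markov property and time reversal of the walk. -/

section

variable (f : ℝ → ℝ) [IsProbabilityMeasure (stepLaw f)]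

theorem measurable_path_right (x : ℝ) : Measurable (path x) :=
  measurable_path.comp measurable_prodMk_left

theorem lintegral_walk {G : (ℕ → ℝ) → ℝ≥0∞} (hG : Measurable G) (x : ℝ) :
    ∫⁻ s, G s ∂(walk f x) =
      ∫⁻ ξ, G (path x ξ) ∂(Measure.infinitePi fun _ : ℕ => stepLaw f) :=
  lintegral_map hG (measurable_path_right x)

theorem path_cons (x u : ℝ) (ξ : ℕ → ℝ) : path x (cons u ξ) = cons x (path (x + u) ξ) := by
  funext n
  cases n with
  | zero => simp [path]
  | succ n => simp [path, Finset.sum_range_succ']; ring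

theorem walk_ae_zero (x : ℝ) : ∀ᵐ s ∂(walk f x), s 0 = x := by
  have h : Measurable (path x) := measurable_path_right x
  refine (ae_map_iff h.aemeasurable ?_).2 (ae_of_all _ fun ξ => by simp [path])
  exact measurableSet_eq_fun (measurable_pi_apply 0) measurable_const

theorem lintegral_walk_cons {G : (ℕ → ℝ) → ℝ≥0∞} (hG : Measurable G) (x : ℝ) :
    ∫⁻ s, G s ∂(walk f x) = ∫⁻ u, ∫⁻ s, G (cons x s) ∂(walk f (x + u)) ∂(stepLaw f) := by
  rw [lintegral_walk f hG, 
    lintegral_infinitePi_cons _ (G := fun ξ => G (path x ξ)) (hG.comp (measurable_path_right x))]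
  refine lintegral_congr fun u => ?_
  rw [lintegral_walk f (G := fun s => G (cons x s))
    (hG.comp (measurable_cons.comp measurable_prodMk_left))]
  simp_rw [path_cons]

theorem lintegral_walk_add {G : (ℕ → ℝ) → ℝ≥0∞} (hG : Measurable G) (x c : ℝ) :
    ∫⁻ s, G s ∂(walk f (x + c)) = ∫⁻ s, G (fun n => s n + c) ∂(walk f x) := by
  rw [lintegral_walk f hG, lintegral_walk f (G := fun s => G (fun n => s n + c))
    (hG.comp (by fun_prop))]
  refine lintegral_congr fun ξ => ?_
  congr 1
  funext n
  simp only [path]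
  ring

theorem measurable_lintegral_walk {β : Type*} [MeasurableSpace β] {Φ : β → (ℕ → ℝ) → ℝ≥0∞}
    (hΦ : Measurable (Function.uncurry Φ)) {g : β → ℝ} (hg : Measurable g) :
    Measurable fun b => ∫⁻ t, Φ b t ∂(walk f (g b)) :=
  Measurable.lintegral_kernel_prod_right (κ := (walk f).comap g hg) hΦ

/-- The stopped path is frozen while the future is restarted from `s n`. The induction splits off
the first step and absorbs it into `Φ`. -/
theorem lintegral_stopAt_shift {Φ : (ℕ → ℝ) → (ℕ → ℝ) → ℝ≥0∞}
    (hΦ : Measurable (Function.uncurry Φ)) (n : ℕ) (x : ℝ) :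
    ∫⁻ s, Φ (stopAt n s) (shift n s) ∂(walk f x) =
      ∫⁻ s, ∫⁻ t, Φ (stopAt n s) t ∂(walk f (s n)) ∂(walk f x) := by
  induction n generalizing x Φ with
  | zero =>
    have h0 : ∀ s : ℕ → ℝ, shift 0 s = s := fun s => by funext k; simp [shift]
    have h1 : ∀ s : ℕ → ℝ, stopAt 0 s = fun _ => s 0 := fun s => by funext k; simp [stopAt]
    have h2 : ∀ᵐ s ∂(walk f x), Φ (stopAt 0 s) (shift 0 s) = Φ (fun _ => x) s := by
      filter_upwards [walk_ae_zero f x] with s hs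
      rw [h0, h1, hs]
    have h3 : ∀ᵐ s ∂(walk f x), ∫⁻ t, Φ (stopAt 0 s) t ∂(walk f (s 0)) =
        ∫⁻ t, Φ (fun _ => x) t ∂(walk f x) := by
      filter_upwards [walk_ae_zero f x] with s hs
      rw [h1, hs]
    rw [lintegral_congr_ae h2, lintegral_congr_ae h3]
    simp
  | succ n ih =>
    rw [lintegral_walk_cons f (G := fun s => Φ (stopAt (n + 1) s) (shift (n + 1) s)),
      lintegral_walk_cons f (G := fun s => ∫⁻ t, Φ (stopAt (n + 1) s) t ∂(walk f (s (n + 1))))]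
    · refine lintegral_congr fun u => ?_
      simp only [stopAt_succ_cons, shift_succ_cons, cons_succ]
      refine ih (Φ := fun s t => Φ (cons x s) t) ?_ (x + u)
      exact hΦ.comp (((measurable_cons.comp (measurable_const.prodMk measurable_fst))).prodMk
        measurable_snd)
    · refine measurable_lintegral_walk f (Φ := fun s t => Φ (stopAt (n + 1) s) t) ?_
        (measurable_pi_apply _)
      exact hΦ.comp (((measurable_stopAt _).comp measurable_fst).prodMk measurable_snd)
    · exact hΦ.comp ((measurable_stopAt _).prodMk (measurable_shift _))

/-- The Markov property at time `n`. -/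
theorem lintegral_markov {Φ : (ℕ → ℝ) → (ℕ → ℝ) → ℝ≥0∞}
    (hΦ : Measurable (Function.uncurry Φ)) (n : ℕ)
    (hΦ' : ∀ s t, Φ (stopAt n s) t = Φ s t) (x : ℝ) :
    ∫⁻ s, Φ s (shift n s) ∂(walk f x) =
      ∫⁻ s, ∫⁻ t, Φ s t ∂(walk f (s n)) ∂(walk f x) := by
  have h := lintegral_stopAt_shift f hΦ n x
  simpa only [hΦ'] using h

/-- The permutation of the indices which reverses `0, …, n - 1`. -/
def revPerm (n : ℕ) : Equiv.Perm ℕ where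
  toFun i := if i < n then n - 1 - i else i
  invFun i := if i < n then n - 1 - i else i
  left_inv i := by dsimp only; split_ifs <;> omega
  right_inv i := by dsimp only; split_ifs <;> omega

theorem path_revPerm (x : ℝ) (n : ℕ) (ξ : ℕ → ℝ) {k : ℕ} (hk : k ≤ n) :
    path x (fun i => ξ (revPerm n i)) k = x + path x ξ n - path x ξ (n - k) := by
  induction k with
  | zero => simp [path]
  | succ k ih =>
    have h1 : path x (fun i => ξ (revPerm n i)) (k + 1) =
        path x (fun i => ξ (revPerm n i)) k + ξ (n - 1 - k) := by
      simp only [path, Finset.sum_range_succ, revPerm, Equiv.coe_fn_mk]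
      rw [if_pos (by omega)]
      ring
    have h2 : path x ξ (n - k) = path x ξ (n - (k + 1)) + ξ (n - 1 - k) := by
      obtain ⟨m, rfl⟩ : ∃ m, n = m + (k + 1) := ⟨n - (k + 1), by omega⟩
      have e1 : m + (k + 1) - k = m + 1 := by omega
      have e2 : m + (k + 1) - (k + 1) = m := by omega
      have e3 : m + (k + 1) - 1 - k = m := by omega
      rw [e1, e2, e3]
      simp only [path, Finset.sum_range_succ]
      ring
    rw [h1, ih (by omega), h2]
    ring

/-- Time reversal of the walk started from `x` and stopped at time `n`. -/
theorem lintegral_walk_reverse {G : (ℕ → ℝ) → ℝ≥0∞} (hG : Measurable G) (n : ℕ) (x : ℝ) :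
    ∫⁻ s, G (stopAt n s) ∂(walk f x) = ∫⁻ s, G (fun k => x + s n - s (n - k)) ∂(walk f x) := by
  have m1 : Measurable fun s : ℕ → ℝ => fun k : ℕ => x + s n - s (n - k) := by fun_prop
  rw [lintegral_walk f (G := fun s => G (stopAt n s)) (hG.comp (measurable_stopAt n)),
    lintegral_walk f (G := fun s => G (fun k => x + s n - s (n - k))) (hG.comp m1)]
  have m2 : Measurable fun (ξ : ℕ → ℝ) (i : ℕ) => ξ (revPerm n i) := by fun_prop
  conv_lhs => rw [← infinitePi_map_perm (stepLaw f) (revPerm n)]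
  rw [lintegral_map (f := fun ξ => G (stopAt n (path x ξ)))
    (hG.comp ((measurable_stopAt n).comp (measurable_path_right x))) m2]
  refine lintegral_congr fun ξ => ?_
  congr 1
  funext k
  simp only [stopAt]
  rw [path_revPerm x n ξ (min_le_right k n)]
  congr 2
  omega

/-- Under the invariant Lebesgue measure, the walk reversed in space and time is the same walk. -/
theorem lintegral_lintegral_walk_reverse {G : (ℕ → ℝ) → ℝ≥0∞} (hG : Measurable G) (n : ℕ) :
    ∫⁻ x, ∫⁻ s, G (stopAt n s) ∂(walk f x) = ∫⁻ z, ∫⁻ s, G (fun k => -s (n - k)) ∂(walk f z) := by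
  have h1 : ∀ x, ∫⁻ s, G (stopAt n s) ∂(walk f x) =
      ∫⁻ s, G (fun k => x + s n - s (n - k)) ∂(walk f 0) := by
    intro x
    rw [lintegral_walk_reverse f hG]
    have := lintegral_walk_add f (G := fun s => G (fun k => x + s n - s (n - k)))
      (hG.comp (by fun_prop)) 0 x
    rw [zero_add] at this
    rw [this]
    refine lintegral_congr fun s => ?_
    congr 1
    funext k
    ring
  have h2 : ∀ z, ∫⁻ s, G (fun k => -s (n - k)) ∂(walk f z) =
      ∫⁻ s, G (fun k => -z - s (n - k)) ∂(walk f 0) := by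
    intro z
    have := lintegral_walk_add f (G := fun s => G (fun k => -s (n - k)))
      (hG.comp (by fun_prop)) 0 z
    rw [zero_add] at this
    rw [this]
    refine lintegral_congr fun s => ?_
    congr 1
    funext k
    ring
  simp_rw [h1, h2]
  have m1 : Measurable fun p : ℝ × (ℕ → ℝ) => G fun k => p.1 + p.2 n - p.2 (n - k) :=
    hG.comp (by fun_prop)
  have m2 : Measurable fun p : ℝ × (ℕ → ℝ) => G fun k => -p.1 - p.2 (n - k) :=
    hG.comp (by fun_prop)
  rw [lintegral_lintegral_swap
    (f := fun (x : ℝ) (s : ℕ → ℝ) => G fun k => x + s n - s (n - k)) m1.aemeasurable,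
    lintegral_lintegral_swap
    (f := fun (z : ℝ) (s : ℕ → ℝ) => G fun k => -z - s (n - k)) m2.aemeasurable]
  refine lintegral_congr fun s => ?_
  -- For fixed increments, `z = -(x + s n)` is minus the final position, a reflection and
  -- translation of `x`, which preserves Lebesgue measure.
  rw [← lintegral_sub_left_eq_self (fun x => G fun k => x + s n - s (n - k)) (-s n)]
  refine lintegral_congr fun z => ?_
  congr 1
  funext k
  ring

end

theorem indicator_one_congr {α β : Type*} {A : Set α} {B : Set β} {a : α} {b : β}
    (h : a ∈ A ↔ b ∈ B) : A.indicator (1 : α → ℝ≥0∞) a = B.indicator 1 b := by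
  by_cases hb : b ∈ B
  · rw [Set.indicator_of_mem hb, Set.indicator_of_mem (h.2 hb)]
    rfl
  · rw [Set.indicator_of_notMem hb, Set.indicator_of_notMem (mt h.1 hb)]

/-! ### Escape from the half-lines `[0, ∞)` and `(-∞, 0)`. -/

theorem stepLaw_singleton (f : ℝ → ℝ) (a : ℝ) : stepLaw f {a} = 0 :=
  withDensity_absolutelyContinuous _ _ (measure_singleton a)

theorem stepLaw_ae_ne (f : ℝ → ℝ) (a : ℝ) : ∀ᵐ u ∂(stepLaw f), u ≠ a := by
  rw [ae_iff]
  simpa using stepLaw_singleton f a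

section

variable (f : ℝ → ℝ) [IsProbabilityMeasure (stepLaw f)]

theorem walk_apply {A : Set (ℕ → ℝ)} (hA : MeasurableSet A) (x : ℝ) :
    walk f x A = (Measure.infinitePi fun _ : ℕ => stepLaw f) (path x ⁻¹' A) :=
  Measure.map_apply (measurable_path_right x) hA

variable {f}

/-- Central limit theorem and the open-set part of the portmanteau theorem. The limit is not
degenerate because a law with a density is not a point mass. -/
theorem exists_tendsto_walk (hf_var : MemLp (fun u : ℝ => u) 2 (stepLaw f))
    (hf_mean : ∫ u, u ∂(stepLaw f) = 0) :
    ∃ v : NNReal, v ≠ 0 ∧ ∀ G : Set ℝ, IsOpen G → gaussianReal 0 v G ≤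
      liminf (fun n : ℕ => walk f 0 {s | (√(n : ℝ))⁻¹ * s n ∈ G}) atTop := by
  have hv : Var[fun u : ℝ => u; stepLaw f] ≠ 0 := by
    intro h
    have h1 := ae_eq_integral_of_variance_eq_zero hf_var h
    rw [hf_mean] at h1
    obtain ⟨u, hu, hu'⟩ := (h1.and (stepLaw_ae_ne f 0)).exists
    exact hu' hu
  have hpos : 0 < Var[fun u : ℝ => u; stepLaw f] :=
    lt_of_le_of_ne (variance_nonneg _ _) hv.symm
  set P := Measure.infinitePi fun _ : ℕ => stepLaw f with hP
  have hmap : ∀ i : ℕ, P.map (fun ξ : ℕ → ℝ => ξ i) = stepLaw f := fun i =>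
    (measurePreserving_eval_infinitePi (fun _ : ℕ => stepLaw f) i).map_eq
  have hid : ∀ i : ℕ, IdentDistrib (fun ξ : ℕ → ℝ => ξ i) (fun u : ℝ => u) P (stepLaw f) :=
    fun i => ⟨(measurable_pi_apply i).aemeasurable, measurable_id.aemeasurable, by
      rw [hmap]; exact Measure.map_id.symm⟩
  have hind : iIndepFun (fun (i : ℕ) (ξ : ℕ → ℝ) => ξ i) P :=
    iIndepFun_infinitePi (P := fun _ : ℕ => stepLaw f) (X := fun _ u => u)
      (fun _ => measurable_id)
  have hvar : Var[fun ξ : ℕ → ℝ => ξ 0; P] = Var[fun u : ℝ => u; stepLaw f] :=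
    (hid 0).variance_eq
  have hmean : ∫ ξ : ℕ → ℝ, ξ 0 ∂P = 0 := by rw [(hid 0).integral_eq, hf_mean]
  refine ⟨Var[fun ξ : ℕ → ℝ => ξ 0; P].toNNReal, ?_, ?_⟩
  · rw [hvar]
    exact (Real.toNNReal_pos.2 hpos).ne'
  · have h := tendstoInDistribution_inv_sqrt_mul_sum_sub (P := P)
      (P' := gaussianReal 0 Var[fun ξ : ℕ → ℝ => ξ 0; P].toNNReal)
      (X := fun (i : ℕ) (ξ : ℕ → ℝ) => ξ i) (Y := id)
      ⟨measurable_id.aemeasurable, Measure.map_id⟩ ((hid 0).memLp_iff.2 hf_var) hind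
      (fun i => (hid i).trans (hid 0).symm)
    intro G hG
    have h1 := ProbabilityMeasure.le_liminf_measure_open_of_tendsto h.tendsto hG
    simp only [ProbabilityMeasure.coe_mk, Measure.map_id] at h1
    refine h1.trans (le_of_eq ?_)
    congr 1
    funext n
    have m1 : Measurable fun s : ℕ → ℝ => (√(n : ℝ))⁻¹ * s n := by fun_prop
    rw [Measure.map_apply_of_aemeasurable (h.forall_aemeasurable n) hG.measurableSet]
    have := walk_apply f (A := {s | (√(n : ℝ))⁻¹ * s n ∈ G}) (m1 hG.measurableSet) 0
    rw [this]
    congr 1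
    ext ξ
    simp [path, hmean]

/-- Diffusive rescaling makes the starting point negligible, so `r` is uniform in `u` although the
time `n` is not. -/
theorem exists_walk_le {C : Set ℝ} (hC : MeasurableSet C) {G : Set ℝ} (hG : IsOpen G)
    (hG' : G.Nonempty) (hCG : ∀ u : ℝ, ∀ᶠ n : ℕ in atTop, ∀ y, (√(n : ℝ))⁻¹ * y ∈ G → u + y ∉ C)
    (hf_var : MemLp (fun u : ℝ => u) 2 (stepLaw f))
    (hf_mean : ∫ u, u ∂(stepLaw f) = 0) :
    ∃ r < (1 : ℝ≥0∞), ∀ u : ℝ, ∃ n : ℕ, walk f u {s | s n ∈ C} ≤ r := by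
  obtain ⟨v, hv, h⟩ := exists_tendsto_walk hf_var hf_mean
  have hpos : 0 < gaussianReal 0 v G := by
    refine pos_iff_ne_zero.2 fun h0 => ?_
    exact (hG.measure_pos volume hG').ne' (gaussianReal_absolutelyContinuous' 0 hv h0)
  obtain ⟨δ, hδ, hδ'⟩ := exists_between (hpos.trans_le (h G hG))
  refine ⟨1 - δ, ENNReal.sub_lt_self ENNReal.one_ne_top one_ne_zero hδ.ne', fun u => ?_⟩
  obtain ⟨n, hn, hn'⟩ := ((eventually_lt_of_lt_liminf hδ').and (hCG u)).exists
  refine ⟨n, ?_⟩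
  have m1 : Measurable fun s : ℕ → ℝ => (√(n : ℝ))⁻¹ * s n := by fun_prop
  have h1 : walk f u {s | s n ∈ C} = walk f 0 {s | s n + u ∈ C} := by
    have mC : MeasurableSet {s : ℕ → ℝ | s n ∈ C} := (measurable_pi_apply n) hC
    have mC' : MeasurableSet {s : ℕ → ℝ | s n + u ∈ C} :=
      (show Measurable fun s : ℕ → ℝ => s n + u by fun_prop) hC
    rw [walk_apply f mC, walk_apply f mC']
    congr 1
    ext ξ
    simp [path, add_comm]
  rw [h1]
  have h2 : walk f 0 {s | s n + u ∈ C} ≤ walk f 0 {s | (√(n : ℝ))⁻¹ * s n ∈ G}ᶜ := by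
    refine measure_mono fun s hs hs' => hn' (s n) hs' ?_
    rw [add_comm]
    exact hs
  refine h2.trans ?_
  rw [prob_compl_eq_one_sub (s := {s : ℕ → ℝ | (√(n : ℝ))⁻¹ * s n ∈ G}) (m1 hG.measurableSet)]
  exact tsub_le_tsub_left hn.le _

/-- Let `q` be the supremum over `u` of the probability of staying in `C`. The Markov property at
the time `n` attached to `u` gives `q ≤ r * q` with `q ≤ 1`, hence `q = 0`. -/
theorem walk_forall_mem_eq_zero {C : Set ℝ} (hC : MeasurableSet C) {r : ℝ≥0∞} (hr : r < 1)
    (h : ∀ u : ℝ, ∃ n : ℕ, walk f u {s | s n ∈ C} ≤ r) (u : ℝ) :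
    walk f u {s | ∀ n, s n ∈ C} = 0 := by
  have mS : ∀ n : ℕ, MeasurableSet {s : ℕ → ℝ | s n ∈ C} := fun n => measurable_pi_apply n hC
  have mA : MeasurableSet {s : ℕ → ℝ | ∀ n, s n ∈ C} := by
    rw [Set.ofPred_forall]
    exact MeasurableSet.iInter mS
  set q := ⨆ u, walk f u {s | ∀ n, s n ∈ C} with hq
  have hq1 : q ≤ 1 := iSup_le fun u => prob_le_one
  have hle : ∀ u, walk f u {s | ∀ n, s n ∈ C} ≤ r * q := by
    intro u
    obtain ⟨n, hn⟩ := h u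
    have h1 : walk f u {s | ∀ n, s n ∈ C} ≤
        ∫⁻ s, {s : ℕ → ℝ | s n ∈ C}.indicator 1 s *
          {s : ℕ → ℝ | ∀ n, s n ∈ C}.indicator 1 (shift n s) ∂(walk f u) := by
      rw [← lintegral_indicator_one mA]
      refine lintegral_mono fun s => ?_
      by_cases hs : s ∈ {s : ℕ → ℝ | ∀ n, s n ∈ C}
      · have h2 : s ∈ {s : ℕ → ℝ | s n ∈ C} := hs n
        have h3 : shift n s ∈ {s : ℕ → ℝ | ∀ n, s n ∈ C} := fun k => hs _
        simp only [Set.indicator_of_mem hs, Set.indicator_of_mem h2, Set.indicator_of_mem h3]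
        simp
      · simp only [Set.indicator_of_notMem hs]
        exact zero_le
    refine h1.trans ?_
    rw [lintegral_markov f (Φ := fun s t => {s : ℕ → ℝ | s n ∈ C}.indicator 1 s *
          {s : ℕ → ℝ | ∀ n, s n ∈ C}.indicator 1 t)]
    · calc ∫⁻ s, ∫⁻ t, {s : ℕ → ℝ | s n ∈ C}.indicator 1 s *
            {s : ℕ → ℝ | ∀ n, s n ∈ C}.indicator 1 t ∂(walk f (s n)) ∂(walk f u)
          ≤ ∫⁻ s, {s : ℕ → ℝ | s n ∈ C}.indicator 1 s * q ∂(walk f u) := by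
            refine lintegral_mono fun s => ?_
            rw [lintegral_const_mul _ (measurable_one.indicator mA), lintegral_indicator_one mA]
            gcongr
            exact le_iSup (fun u => walk f u {s | ∀ n, s n ∈ C}) (s n)
        _ = walk f u {s | s n ∈ C} * q := by
            rw [lintegral_mul_const _ (measurable_one.indicator (mS n)),
              lintegral_indicator_one (mS n)]
        _ ≤ r * q := by gcongr
    · exact ((measurable_one.indicator (mS n)).comp measurable_fst).mul
        ((measurable_one.indicator mA).comp measurable_snd)
    · intro s t
      congr 1
      exact indicator_one_congr (by simp [stopAt])
  have hq0 : q = 0 := by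
    by_contra hne
    have h1 : q ≤ r * q := iSup_le hle
    have h2 : r * q < 1 * q :=
      ENNReal.mul_lt_mul_left hne (ne_top_of_le_ne_top ENNReal.one_ne_top hq1) hr
    rw [one_mul] at h2
    exact absurd h1 (not_le.2 h2)
  exact le_antisymm ((hle u).trans (by simp [hq0])) zero_le

/-- A centred walk does not stay nonnegative forever. -/
theorem walk_forall_nonneg (hf_var : MemLp (fun u : ℝ => u) 2 (stepLaw f))
    (hf_mean : ∫ u, u ∂(stepLaw f) = 0) (u : ℝ) : walk f u {s | ∀ n, 0 ≤ s n} = 0 := by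
  have hC : ∀ u : ℝ, ∀ᶠ n : ℕ in atTop, ∀ y,
      (√(n : ℝ))⁻¹ * y ∈ Set.Iio (-1) → u + y ∉ Set.Ici 0 := by
    intro u
    have h1 : Tendsto (fun n : ℕ => √(n : ℝ)) atTop atTop :=
      Real.tendsto_sqrt_atTop.comp tendsto_natCast_atTop_atTop
    filter_upwards [h1.eventually_ge_atTop (|u| + 1)] with n hn y hy
    have hp : 0 < √(n : ℝ) := by linarith [abs_nonneg u]
    simp only [Set.mem_Iio] at hy
    rw [inv_mul_lt_iff₀ hp] at hy
    simp only [Set.mem_Ici, not_le]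
    linarith [le_abs_self u]
  obtain ⟨r, hr, h⟩ := exists_walk_le (f := f) measurableSet_Ici
    isOpen_Iio ⟨-2, by norm_num⟩ hC hf_var hf_mean
  exact walk_forall_mem_eq_zero measurableSet_Ici hr h u

/-- A centred walk does not stay negative forever. -/
theorem walk_forall_neg (hf_var : MemLp (fun u : ℝ => u) 2 (stepLaw f))
    (hf_mean : ∫ u, u ∂(stepLaw f) = 0) (u : ℝ) : walk f u {s | ∀ n, s n < 0} = 0 := by
  have hC : ∀ u : ℝ, ∀ᶠ n : ℕ in atTop, ∀ y,
      (√(n : ℝ))⁻¹ * y ∈ Set.Ioi 1 → u + y ∉ Set.Iio 0 := by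
    intro u
    have h1 : Tendsto (fun n : ℕ => √(n : ℝ)) atTop atTop :=
      Real.tendsto_sqrt_atTop.comp tendsto_natCast_atTop_atTop
    filter_upwards [h1.eventually_ge_atTop (|u| + 1)] with n hn y hy
    have hp : 0 < √(n : ℝ) := by linarith [abs_nonneg u]
    simp only [Set.mem_Ioi] at hy
    rw [lt_inv_mul_iff₀ hp] at hy
    simp only [Set.mem_Iio, not_lt]
    linarith [neg_abs_le u]
  obtain ⟨r, hr, h⟩ := exists_walk_le (f := f) measurableSet_Iio
    isOpen_Ioi ⟨2, by norm_num⟩ hC hf_var hf_mean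
  exact walk_forall_mem_eq_zero measurableSet_Iio hr h u

end

/-! ### Ladder times as times of strict records. -/

theorem ascLadderTime_succ_eq_coe {s : ℕ → ℝ} {k n : ℕ} :
    ascLadderTime s (k + 1) = n ↔ ∃ m < n, ascLadderTime s k = m ∧ s m < s n ∧
      ∀ j, m < j → j < n → s j ≤ s m := by
  have hdef : ascLadderTime s (k + 1) = sInf {t : ℕ∞ | ∃ m n : ℕ,
      ascLadderTime s k = m ∧ t = n ∧ m < n ∧ s m < s n} := rfl
  rw [hdef]
  constructor
  · intro h
    have hne : {t : ℕ∞ | ∃ m n : ℕ,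
        ascLadderTime s k = m ∧ t = n ∧ m < n ∧ s m < s n}.Nonempty := by
      by_contra hemp
      rw [Set.not_nonempty_iff_eq_empty.1 hemp, sInf_empty] at h
      exact ENat.natCast_ne_top n h.symm
    have hmem := csInf_mem hne
    rw [h] at hmem
    obtain ⟨m, n', hm, hn, hmn, hs⟩ := hmem
    obtain rfl : n = n' := by exact_mod_cast hn
    refine ⟨m, hmn, hm, hs, fun j hj hjn => ?_⟩
    by_contra hlt
    have := sInf_le (show (j : ℕ∞) ∈ {t : ℕ∞ | ∃ m n : ℕ,
        ascLadderTime s k = m ∧ t = n ∧ m < n ∧ s m < s n} from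
      ⟨m, j, hm, rfl, hj, not_le.1 hlt⟩)
    rw [h] at this
    have : n ≤ j := by exact_mod_cast this
    omega
  · rintro ⟨m, hmn, hm, hs, hj⟩
    refine le_antisymm (sInf_le ⟨m, n, hm, rfl, hmn, hs⟩) (le_sInf ?_)
    rintro t ⟨m', n', hm', rfl, hmn', hs'⟩
    obtain rfl : m = m' := by
      rw [hm] at hm'
      exact_mod_cast hm'
    by_contra hlt
    have hlt : n' < n := by exact_mod_cast not_le.1 hlt
    exact absurd hs' (not_lt.2 (hj n' hmn' hlt))

/-- With the converse `exists_ascLadderTime_eq`, this replaces the recursive ladder times by strict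
records, which behave well under reversal. -/
theorem lt_of_ascLadderTime_eq {s : ℕ → ℝ} {k n : ℕ} (h : ascLadderTime s k = n) :
    ∀ j < n, s j < s n := by
  induction k generalizing n with
  | zero =>
    have : (0 : ℕ∞) = n := h
    obtain rfl : 0 = n := by exact_mod_cast this
    intro j hj
    omega
  | succ k ih =>
    obtain ⟨m, hmn, hm, hs, hle⟩ := ascLadderTime_succ_eq_coe.1 h
    intro j hj
    rcases lt_trichotomy j m with hjm | rfl | hjm
    · exact (ih hm j hjm).trans hs
    · exact hs
    · exact (hle j hjm hj).trans_lt hs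

theorem exists_ascLadderTime_eq {s : ℕ → ℝ} {n : ℕ} (h : ∀ j < n, s j < s n) :
    ∃ k, ascLadderTime s k = n := by
  induction n using Nat.strong_induction_on with
  | _ n ih =>
    rcases Nat.eq_zero_or_pos n with rfl | hn
    · exact ⟨0, rfl⟩
    obtain ⟨m, hm, hmax⟩ := Finset.exists_max_image (Finset.range n) s ⟨0, by simpa using hn⟩
    -- The earliest maximiser before `n` is itself a strict record, and nothing between it and `n`
    -- exceeds it, so `n` is the next ladder time.
    have hex : ∃ m, m < n ∧ ∀ j < n, s j ≤ s m :=
      ⟨m, by simpa using hm, fun j hj => hmax j (by simpa using hj)⟩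
    classical
    obtain ⟨h1, h2⟩ := Nat.find_spec hex
    set i := Nat.find hex with hi
    obtain ⟨k, hk⟩ := ih i h1 fun j hj => by
      by_contra hle
      refine Nat.find_min hex hj ⟨hj.trans h1, fun l hl => (h2 l hl).trans (not_lt.1 hle)⟩
    exact ⟨k + 1, ascLadderTime_succ_eq_coe.2 ⟨i, h1, hk, h i h1, fun j _ hj => h2 j hj⟩⟩

theorem exists_ascLadderTime_lt {s : ℕ → ℝ} {k k' n : ℕ} (hk : k < k')
    (h : ascLadderTime s k' = n) : ∃ m < n, ascLadderTime s k = m := by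
  induction k' generalizing n with
  | zero => omega
  | succ k' ih =>
    obtain ⟨m, hmn, hm, -⟩ := ascLadderTime_succ_eq_coe.1 h
    rcases Nat.lt_succ_iff_lt_or_eq.1 hk with hlt | rfl
    · obtain ⟨m', hm', h'⟩ := ih hlt hm
      exact ⟨m', hm'.trans hmn, h'⟩
    · exact ⟨m, hmn, hm⟩

theorem ascLadderTime_injective {s : ℕ → ℝ} {k k' n : ℕ} (h : ascLadderTime s k = n)
    (h' : ascLadderTime s k' = n) : k = k' := by
  rcases lt_trichotomy k k' with hk | hk | hk
  · obtain ⟨m, hm, e⟩ := exists_ascLadderTime_lt hk h'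
    have : (m : ℕ∞) = n := e.symm.trans h
    have : m = n := by exact_mod_cast this
    omega
  · exact hk
  · obtain ⟨m, hm, e⟩ := exists_ascLadderTime_lt hk h
    have : (m : ℕ∞) = n := e.symm.trans h'
    have : m = n := by exact_mod_cast this
    omega

theorem measurableSet_ascLadderTime_eq (k n : ℕ) :
    MeasurableSet {s : ℕ → ℝ | ascLadderTime s k = n} := by
  induction k generalizing n with
  | zero => exact MeasurableSet.const ((0 : ℕ∞) = n)
  | succ k ih =>
    have h : {s : ℕ → ℝ | ascLadderTime s (k + 1) = n} = ⋃ m, ⋃ _ : m < n,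
        {s | ascLadderTime s k = m} ∩ ({s | s m < s n} ∩
          ⋂ j, ⋂ _ : m < j, ⋂ _ : j < n, {s | s j ≤ s m}) := by
      ext s
      simp only [Set.mem_ofPred_eq, ascLadderTime_succ_eq_coe, Set.mem_iUnion, Set.mem_inter_iff,
        Set.mem_iInter, exists_prop]
    rw [h]
    refine MeasurableSet.iUnion fun m => MeasurableSet.iUnion fun _ => (ih m).inter
      ((measurableSet_lt (measurable_pi_apply m) (measurable_pi_apply n)).inter ?_)
    exact MeasurableSet.iInter fun j => MeasurableSet.iInter fun _ => MeasurableSet.iInter fun _ =>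
      measurableSet_le (measurable_pi_apply j) (measurable_pi_apply m)

theorem measurableSet_descLadderTime_eq (k n : ℕ) :
    MeasurableSet {s : ℕ → ℝ | descLadderTime s k = n} :=
  (show Measurable fun s : ℕ → ℝ => fun n => -s n by fun_prop)
    (measurableSet_ascLadderTime_eq k n)

/-- The paths which are negative at the times `1, …, n`. -/
def negUpTo (n : ℕ) : Set (ℕ → ℝ) := {s | ∀ j, 1 ≤ j → j ≤ n → s j < 0}

theorem measurableSet_negUpTo (n : ℕ) : MeasurableSet (negUpTo n) := by
  simp only [negUpTo, Set.ofPred_forall]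
  exact MeasurableSet.iInter fun j => MeasurableSet.iInter fun _ => MeasurableSet.iInter fun _ =>
    measurableSet_lt (measurable_pi_apply _) measurable_const

theorem measurableSet_descRecord (n : ℕ) :
    MeasurableSet {s : ℕ → ℝ | ∀ j < n, s n < s j} := by
  simp only [Set.ofPred_forall]
  exact MeasurableSet.iInter fun j => MeasurableSet.iInter fun _ =>
    measurableSet_lt (measurable_pi_apply _) (measurable_pi_apply _)

theorem measurableSet_le_apply (a : ℝ) (n : ℕ) : MeasurableSet {s : ℕ → ℝ | a ≤ s n} :=
  measurableSet_le measurable_const (measurable_pi_apply _)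

/-- The condition `0 ≤ y` excludes the default value `0` of `ladderStep` on paths without ascent.
The ascent time is positive, hence written `n + 1`. -/
theorem lt_ladderStep_iff {s : ℕ → ℝ} {y : ℝ} (hy : 0 ≤ y) :
    y < ladderStep s ↔ ∃ n, (∀ j ≤ n, s j ≤ s 0) ∧ y < s (n + 1) - s 0 := by
  constructor
  · intro h
    rcases hL : ascLadderTime s 1 with _ | n
    · have : ladderStep s = 0 := by
        have h1 : (ascLadderTime s 1).toNat = 0 := by rw [hL]; rfl
        simp [ladderStep, h1]
      linarith
    · have hn : ladderStep s = s n - s 0 := by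
        have h1 : (ascLadderTime s 1).toNat = n := by rw [hL]; rfl
        simp [ladderStep, h1]
      obtain ⟨m, hmn, hm, hs, hle⟩ := (ascLadderTime_succ_eq_coe (k := 0)).1 hL
      have : (0 : ℕ∞) = m := hm
      obtain rfl : 0 = m := by exact_mod_cast this
      obtain ⟨n, rfl⟩ := Nat.exists_eq_succ_of_ne_zero hmn.ne'
      refine ⟨n, fun j hj => ?_, by rwa [hn] at h⟩
      rcases Nat.eq_zero_or_pos j with rfl | hj'
      · exact le_rfl
      · exact hle j hj' (by omega)
  · rintro ⟨n, hle, h⟩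
    have hL : ascLadderTime s 1 = (n + 1 : ℕ) :=
      (ascLadderTime_succ_eq_coe (k := 0)).2 ⟨0, by omega, rfl, by linarith,
        fun j _ hj => hle j (by omega)⟩
    rw [ladderStep, hL]
    exact h

theorem ladderStep_nonneg (s : ℕ → ℝ) : 0 ≤ ladderStep s := by
  rcases hL : ascLadderTime s 1 with _ | n
  · have h1 : (ascLadderTime s 1).toNat = 0 := by rw [hL]; rfl
    simp [ladderStep, h1]
  · have h1 : (ascLadderTime s 1).toNat = n := by rw [hL]; rfl
    obtain ⟨m, hmn, hm, hs, hle⟩ := (ascLadderTime_succ_eq_coe (k := 0)).1 hL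
    have : (0 : ℕ∞) = m := hm
    obtain rfl : 0 = m := by exact_mod_cast this
    simp only [ladderStep, h1]
    linarith

/-- The paths whose first strict ascent above their starting point is at time `n + 1` and exceeds
`y`. -/
def ascentAt (y : ℝ) (n : ℕ) : Set (ℕ → ℝ) :=
  {s | (∀ j ≤ n, s j ≤ s 0) ∧ y < s (n + 1) - s 0}

theorem measurableSet_ascentAt (y : ℝ) (n : ℕ) : MeasurableSet (ascentAt y n) := by
  rw [ascentAt, Set.ofPred_and]
  refine MeasurableSet.inter ?_ (measurableSet_lt measurable_const (by fun_prop))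
  simp only [Set.ofPred_forall]
  exact MeasurableSet.iInter fun j => MeasurableSet.iInter fun _ =>
    measurableSet_le (measurable_pi_apply _) (measurable_pi_apply _)

theorem setOf_lt_ladderStep {y : ℝ} (hy : 0 ≤ y) :
    {s | y < ladderStep s} = ⋃ n, ascentAt y n := by
  ext s
  simp only [Set.mem_ofPred_eq, lt_ladderStep_iff hy, Set.mem_iUnion, ascentAt]

theorem measurable_ladderStep : Measurable ladderStep := by
  refine measurable_of_Ioi fun y => ?_
  rcases le_or_gt 0 y with hy | hy
  · have h : ladderStep ⁻¹' Set.Ioi y = ⋃ n, ascentAt y n := setOf_lt_ladderStep hy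
    rw [h]
    exact MeasurableSet.iUnion fun n => measurableSet_ascentAt y n
  · have h : ladderStep ⁻¹' Set.Ioi y = Set.univ :=
      Set.eq_univ_of_forall fun s => hy.trans_le (ladderStep_nonneg s)
    rw [h]
    exact MeasurableSet.univ

/-! ### The renewal function: records, duality and overshoot. -/

section

variable (f : ℝ → ℝ) [IsProbabilityMeasure (stepLaw f)]

/-- The renewal function counts the strict descending records above `0`. -/
theorem renewal_eq_tsum_record (x : ℝ) :
    renewal f x = ∑' n : ℕ, walk f x ({s | 0 ≤ s n} ∩ {s | ∀ j < n, s n < s j}) := by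
  have h1 : ∀ k : ℕ, walk f x {s | ∃ n : ℕ, descLadderTime s k = n ∧ 0 ≤ s n} =
      ∑' n : ℕ, walk f x ({s | descLadderTime s k = n} ∩ {s | 0 ≤ s n}) := by
    intro k
    rw [← measure_iUnion]
    · congr 1
      ext s
      simp
    · intro n n' hn
      refine Set.disjoint_left.2 fun s hs hs' => hn ?_
      have : (n : ℕ∞) = n' := hs.1.symm.trans hs'.1
      exact_mod_cast this
    · exact fun n => (measurableSet_descLadderTime_eq k n).inter (measurableSet_le_apply 0 n)
  rw [renewal]
  simp_rw [h1]
  -- With the time outside, the sum over the index collapses: a record time has exactly one ladder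
  -- index.
  rw [ENNReal.tsum_comm]
  refine tsum_congr fun n => ?_
  rw [← measure_iUnion]
  · congr 1
    ext s
    simp only [Set.mem_iUnion, Set.mem_inter_iff, Set.mem_ofPred_eq]
    constructor
    · rintro ⟨k, hk, h0⟩
      exact ⟨h0, fun j hj => by simpa using lt_of_ascLadderTime_eq hk j hj⟩
    · rintro ⟨h0, h⟩
      obtain ⟨k, hk⟩ := exists_ascLadderTime_eq (s := fun n => -s n) (n := n)
        (fun j hj => by simpa using h j hj)
      exact ⟨k, hk, h0⟩
  · intro k k' hk
    exact Set.disjoint_left.2 fun s hs hs' => hk (ascLadderTime_injective hs.1 hs'.1)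
  · exact fun k => (measurableSet_descLadderTime_eq k n).inter (measurableSet_le_apply 0 n)

/-- The renewal function in terms of the walk before its first ascending ladder time. -/
theorem renewal_eq_tsum_neg (x : ℝ) :
    renewal f x = ∑' n : ℕ, walk f 0 (negUpTo n ∩ {s | -x ≤ s n}) := by
  rw [renewal_eq_tsum_record]
  refine tsum_congr fun n => ?_
  have mA := (measurableSet_le_apply 0 n).inter (measurableSet_descRecord n)
  have mB := (measurableSet_negUpTo n).inter (measurableSet_le_apply (-x) n)
  rw [← lintegral_indicator_one mA, ← lintegral_indicator_one mB]
  have h1 := lintegral_walk_add f (measurable_one.indicator mA) 0 x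
  rw [zero_add] at h1
  -- Duality: the reversed path `s n - s (n - k)` is negative for `1 ≤ k ≤ n` exactly when `n` is a
  -- strict descending record.
  have h2 := lintegral_walk_reverse f (measurable_one.indicator mB) n 0
  have h3 : ∀ s : ℕ → ℝ, (negUpTo n ∩ {s | -x ≤ s n}).indicator (1 : (ℕ → ℝ) → ℝ≥0∞)
      (stopAt n s) = (negUpTo n ∩ {s | -x ≤ s n}).indicator 1 s := by
    intro s
    refine indicator_one_congr ?_
    simp only [negUpTo, Set.mem_inter_iff, Set.mem_ofPred_eq, stopAt, min_self]
    refine and_congr_left fun _ => forall_congr' fun j => forall_congr' fun _ =>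
      forall_congr' fun hj => ?_
    rw [min_eq_left hj]
  simp_rw [h3] at h2
  rw [h1, h2]
  refine lintegral_congr_ae ?_
  filter_upwards [walk_ae_zero f 0] with s hs
  refine indicator_one_congr ?_
  simp only [negUpTo, Set.mem_inter_iff, Set.mem_ofPred_eq, Nat.sub_self, hs]
  rw [and_comm]
  refine and_congr ⟨fun h j hj hjn => ?_, fun h j hj => ?_⟩ ?_
  · have := h (n - j) (by omega)
    linarith
  · have := h (n - j) (by omega) (by omega)
    rw [Nat.sub_sub_self hj.le] at this
    linarith
  · constructor <;> intro h <;> linarith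

theorem lintegral_walk_one {g : ℝ → ℝ≥0∞} (hg : Measurable g) (x : ℝ) :
    ∫⁻ s, g (s 1) ∂(walk f x) = ∫⁻ u, g (x + u) ∂(stepLaw f) := by
  rw [lintegral_walk_cons f (G := fun s => g (s 1)) (hg.comp (measurable_pi_apply 1))]
  refine lintegral_congr fun u => ?_
  have : ∀ᵐ s ∂(walk f (x + u)), g (cons x s 1) = g (x + u) := by
    filter_upwards [walk_ae_zero f (x + u)] with s hs
    rw [← hs]
    rfl
  rw [lintegral_congr_ae this]
  simp

/-- The Markov property at time `n`, for one step. -/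
theorem lintegral_markov_step {Φ : (ℕ → ℝ) → ℝ → ℝ≥0∞} (hΦ : Measurable (Function.uncurry Φ))
    (n : ℕ) (hΦ' : ∀ s t, Φ (stopAt n s) t = Φ s t) (x : ℝ) :
    ∫⁻ s, Φ s (s (n + 1)) ∂(walk f x) =
      ∫⁻ s, ∫⁻ u, Φ s (s n + u) ∂(stepLaw f) ∂(walk f x) := by
  have h := lintegral_markov f (Φ := fun s t => Φ s (t 1))
    (hΦ.comp (measurable_fst.prodMk ((measurable_pi_apply 1).comp measurable_snd))) n
    (fun s t => hΦ' s (t 1)) x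
  refine Eq.trans h (lintegral_congr fun s => ?_)
  exact lintegral_walk_one f (hΦ.comp (measurable_const.prodMk measurable_id)) (s n)

theorem walk_ae_ne (x a : ℝ) (n : ℕ) : ∀ᵐ s ∂(walk f x), s (n + 1) ≠ a := by
  rw [ae_iff]
  have mA : MeasurableSet {b : ℝ | ¬b ≠ a} := by simp
  have h := lintegral_markov_step f (Φ := fun _ t => {b : ℝ | ¬b ≠ a}.indicator 1 t)
    ((measurable_one.indicator mA).comp measurable_snd) n (fun _ _ => rfl) x
  have mB : MeasurableSet {s : ℕ → ℝ | ¬s (n + 1) ≠ a} :=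
    (measurable_pi_apply (n + 1) : Measurable fun s : ℕ → ℝ => s (n + 1)) mA
  rw [← lintegral_indicator_one mB]
  refine Eq.trans (lintegral_congr fun s => indicator_one_congr Iff.rfl) (h.trans ?_)
  rw [lintegral_eq_zero_of_ae_eq_zero]
  refine ae_of_all _ fun s => ?_
  refine lintegral_eq_zero_of_ae_eq_zero ?_
  filter_upwards [stepLaw_ae_ne f (a - s n)] with u hu
  refine Set.indicator_of_notMem ?_ _
  simp only [Set.mem_ofPred_eq, not_not]
  intro h
  exact hu (by linarith)

/-- The weak inequalities before the ascent can be made strict: the step law has no atoms, so the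
walk almost surely never returns to its starting point. -/
theorem walk_lt_ladderStep_eq_tsum {y : ℝ} (hy : 0 ≤ y) :
    walk f 0 {s | y < ladderStep s} =
      ∑' n : ℕ, walk f 0 (negUpTo n ∩ {s | y < s (n + 1)}) := by
  rw [setOf_lt_ladderStep hy, measure_iUnion]
  · refine tsum_congr fun n => measure_congr ?_
    have h : ∀ᵐ s ∂(walk f 0), ∀ n : ℕ, s (n + 1) ≠ 0 :=
      ae_all_iff.2 fun n => walk_ae_ne f 0 0 n
    filter_upwards [h, walk_ae_zero f 0] with s hs h0
    refine propext (and_congr ⟨fun h j hj hjn => ?_, fun h j hj => ?_⟩ ?_)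
    · obtain ⟨j, rfl⟩ := Nat.exists_eq_succ_of_ne_zero (by omega : j ≠ 0)
      exact lt_of_le_of_ne (h0 ▸ h _ hjn) (hs j)
    · rcases Nat.eq_zero_or_pos j with rfl | hj'
      · exact le_rfl
      · rw [h0]
        exact (h j hj' hj).le
    · rw [h0, sub_zero]
      exact Iff.rfl
  · intro n m hnm
    refine Set.disjoint_left.2 fun s hs hs' => ?_
    rcases lt_or_gt_of_ne hnm with h | h
    · have h1 := hs'.1 (n + 1) h
      have h2 := hs.2
      linarith
    · have h1 := hs.1 (m + 1) h
      have h2 := hs'.2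
      linarith
  · exact fun n => measurableSet_ascentAt y n

end

theorem indicator_one_le_one {α : Type*} (A : Set α) (a : α) :
    A.indicator (1 : α → ℝ≥0∞) a ≤ 1 :=
  Set.indicator_le_self' (fun _ _ => zero_le) a

theorem indicator_one_le {α β : Type*} {A : Set α} {B : Set β} {a : α} {b : β}
    (h : a ∈ A → b ∈ B) : A.indicator (1 : α → ℝ≥0∞) a ≤ B.indicator 1 b := by
  by_cases ha : a ∈ A
  · rw [Set.indicator_of_mem ha, Set.indicator_of_mem (h ha)]
    exact le_rfl
  · rw [Set.indicator_of_notMem ha]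
    exact zero_le

theorem mem_negUpTo_stopAt {n : ℕ} {s : ℕ → ℝ} : stopAt n s ∈ negUpTo n ↔ s ∈ negUpTo n := by
  simp only [negUpTo, Set.mem_ofPred_eq, stopAt]
  refine forall_congr' fun j => forall_congr' fun _ => forall_congr' fun hj => ?_
  rw [min_eq_left hj]

/-! ### Harmonicity and subadditivity of the renewal function. -/

section

variable (f : ℝ → ℝ) [IsProbabilityMeasure (stepLaw f)]

theorem renewal_mono : Monotone (renewal f) := by
  intro x y hxy
  rw [renewal_eq_tsum_neg, renewal_eq_tsum_neg]
  refine ENNReal.tsum_le_tsum fun n => measure_mono (Set.inter_subset_inter_right _ fun s hs => ?_)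
  simp only [Set.mem_ofPred_eq] at hs ⊢
  linarith

theorem measurable_renewal : Measurable (renewal f) := (renewal_mono f).measurable

theorem renewal_of_neg {x : ℝ} (hx : x < 0) : renewal f x = 0 := by
  rw [renewal_eq_tsum_record, ENNReal.tsum_eq_zero]
  intro n
  refine measure_mono_null (t := {s | ¬s 0 = x}) (fun s hs h0 => ?_) (ae_iff.1 (walk_ae_zero f x))
  have h1 : (0 : ℝ) ≤ s n := hs.1
  rcases Nat.eq_zero_or_pos n with rfl | hn
  · linarith
  · have h2 : s n < s 0 := hs.2 0 hn
    linarith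

theorem walk_negUpTo_zero {x : ℝ} (hx : 0 ≤ x) : walk f 0 (negUpTo 0 ∩ {s | -x ≤ s 0}) = 1 := by
  rw [prob_compl_eq_zero_iff ((measurableSet_negUpTo 0).inter (measurableSet_le_apply _ _)) |>.symm]
  refine measure_mono_null (t := {s | ¬s 0 = 0}) (fun s hs h0 => hs ⟨?_, ?_⟩)
    (ae_iff.1 (walk_ae_zero f 0))
  · intro j hj hj'
    omega
  · simp only [Set.mem_ofPred_eq, h0]
    linarith

theorem one_le_renewal {x : ℝ} (hx : 0 ≤ x) : 1 ≤ renewal f x := by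
  rw [renewal_eq_tsum_neg, ← walk_negUpTo_zero f hx]
  exact ENNReal.le_tsum 0

theorem walk_negUpTo_step {A : Set ℝ} (hA : MeasurableSet A) (n : ℕ) :
    walk f 0 (negUpTo n ∩ {s | s (n + 1) ∈ A}) =
      ∫⁻ s, (negUpTo n).indicator 1 s * stepLaw f {u | s n + u ∈ A} ∂(walk f 0) := by
  have m1 : MeasurableSet {s : ℕ → ℝ | s (n + 1) ∈ A} :=
    (measurable_pi_apply (n + 1) : Measurable fun s : ℕ → ℝ => s (n + 1)) hA
  rw [← lintegral_indicator_one ((measurableSet_negUpTo n).inter m1)]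
  have h := lintegral_markov_step f
    (Φ := fun s t => (negUpTo n).indicator 1 s * A.indicator 1 t)
    (((measurable_one.indicator (measurableSet_negUpTo n)).comp measurable_fst).mul
      ((measurable_one.indicator hA).comp measurable_snd)) n
    (fun s t => by rw [indicator_one_congr mem_negUpTo_stopAt]) 0
  refine Eq.trans (lintegral_congr fun s => ?_) (h.trans (lintegral_congr fun s => ?_))
  · by_cases h1 : s ∈ negUpTo n
    · rw [Set.indicator_of_mem h1, Pi.one_apply, one_mul]
      exact indicator_one_congr (by simp [h1])
    · rw [Set.indicator_of_notMem h1, Set.indicator_of_notMem (fun h => h1 h.1), zero_mul]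
  · have m2 : MeasurableSet {u | s n + u ∈ A} := (measurable_const_add (s n)) hA
    rw [lintegral_const_mul]
    · congr 1
      rw [← lintegral_indicator_one m2]
      exact lintegral_congr fun u => indicator_one_congr Iff.rfl
    · exact (measurable_one.indicator hA).comp (measurable_const_add _)

theorem measurableSet_exit (n : ℕ) : MeasurableSet (negUpTo n ∩ {s | 0 ≤ s (n + 1)}) :=
  (measurableSet_negUpTo n).inter (measurableSet_le_apply _ _)

theorem tsum_walk_exit :
    ∑' n, walk f 0 (negUpTo n ∩ {s | 0 ≤ s (n + 1)}) =
      walk f 0 (⋃ n, negUpTo n ∩ {s | 0 ≤ s (n + 1)}) := by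
  refine (measure_iUnion (fun n m hnm => ?_) (measurableSet_exit)).symm
  refine Set.disjoint_left.2 fun s hs hs' => ?_
  have h1 : 0 ≤ s (n + 1) := hs.2
  have h2 : 0 ≤ s (m + 1) := hs'.2
  rcases lt_or_gt_of_ne hnm with h | h
  · exact absurd (hs'.1 (n + 1) (by omega) h) (not_lt.2 h1)
  · exact absurd (hs.1 (m + 1) (by omega) h) (not_lt.2 h2)

-- Otherwise the walk would stay negative for ever from time `1` on, which `walk_forall_neg`
-- excludes whatever the first step.
variable {f} in
theorem tsum_walk_exit_eq_one (hf_var : MemLp (fun u : ℝ => u) 2 (stepLaw f))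
    (hf_mean : ∫ u, u ∂(stepLaw f) = 0) :
    ∑' n, walk f 0 (negUpTo n ∩ {s | 0 ≤ s (n + 1)}) = 1 := by
  rw [tsum_walk_exit, ← prob_compl_eq_zero_iff (MeasurableSet.iUnion measurableSet_exit)]
  have mA : MeasurableSet {s : ℕ → ℝ | ∀ n, s (n + 1) < 0} := by
    rw [Set.ofPred_forall]
    exact MeasurableSet.iInter fun n => measurableSet_lt (measurable_pi_apply _) measurable_const
  have hsub : (⋃ n, negUpTo n ∩ {s : ℕ → ℝ | 0 ≤ s (n + 1)})ᶜ ⊆ {s | ∀ n, s (n + 1) < 0} := by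
    intro s hs n
    induction n using Nat.strong_induction_on with
    | _ n ih =>
      by_contra hn
      refine hs (Set.mem_iUnion.2 ⟨n, fun j hj hjn => ?_, not_lt.1 hn⟩)
      obtain ⟨j, rfl⟩ := Nat.exists_eq_succ_of_ne_zero (by omega : j ≠ 0)
      exact ih j hjn
  refine measure_mono_null hsub ?_
  rw [← lintegral_indicator_one mA, lintegral_walk_cons f (measurable_one.indicator mA)]
  refine lintegral_eq_zero_of_ae_eq_zero (ae_of_all _ fun u => ?_)
  have mB : MeasurableSet {s : ℕ → ℝ | ∀ n, s n < 0} := by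
    rw [Set.ofPred_forall]
    exact MeasurableSet.iInter fun n => measurableSet_lt (measurable_pi_apply _) measurable_const
  refine Eq.trans ?_ (walk_forall_neg hf_var hf_mean (0 + u))
  rw [← lintegral_indicator_one mB]
  exact lintegral_congr fun s => indicator_one_congr Iff.rfl

variable {f} in
/-- The renewal function is harmonic for the walk killed when it becomes negative. -/
theorem lintegral_renewal_add (hf_var : MemLp (fun u : ℝ => u) 2 (stepLaw f))
    (hf_mean : ∫ u, u ∂(stepLaw f) = 0) {x : ℝ} (hx : 0 ≤ x) :
    ∫⁻ u, renewal f (x + u) ∂(stepLaw f) = renewal f x := by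
  have hm : Measurable fun p : ℝ × (ℕ → ℝ) => p := measurable_id
  -- The integrated step `u` is independent of the path, so it can serve as the step from time `n`
  -- to time `n + 1`.
  have h1 : ∀ n : ℕ, ∫⁻ u, walk f 0 (negUpTo n ∩ {s | -(x + u) ≤ s n}) ∂(stepLaw f) =
      walk f 0 (negUpTo n ∩ {s | -x ≤ s (n + 1)}) := by
    intro n
    have mS : MeasurableSet {p : ℝ × (ℕ → ℝ) | p.2 ∈ negUpTo n ∧ -(x + p.1) ≤ p.2 n} :=
      (measurable_snd (measurableSet_negUpTo n)).inter
        (measurableSet_le (f := fun p : ℝ × (ℕ → ℝ) => -(x + p.1)) (g := fun p => p.2 n)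
          (by fun_prop) (by fun_prop))
    have h2 : ∀ u, walk f 0 (negUpTo n ∩ {s | -(x + u) ≤ s n}) =
        ∫⁻ s, {p : ℝ × (ℕ → ℝ) | p.2 ∈ negUpTo n ∧ -(x + p.1) ≤ p.2 n}.indicator 1 (u, s)
          ∂(walk f 0) := by
      intro u
      rw [← lintegral_indicator_one ((measurableSet_negUpTo n).inter (measurableSet_le_apply _ _))]
      exact lintegral_congr fun s => indicator_one_congr Iff.rfl
    simp_rw [h2]
    rw [lintegral_lintegral_swap (f := fun (u : ℝ) (s : ℕ → ℝ) =>
      {p : ℝ × (ℕ → ℝ) | p.2 ∈ negUpTo n ∧ -(x + p.1) ≤ p.2 n}.indicator 1 (u, s))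
      (measurable_one.indicator mS).aemeasurable]
    have h3 := walk_negUpTo_step f (A := Set.Ici (-x)) measurableSet_Ici n
    refine Eq.trans (lintegral_congr fun s => ?_) h3.symm
    have m2 : MeasurableSet {u | s n + u ∈ Set.Ici (-x)} :=
      (measurable_const_add (s n)) measurableSet_Ici
    rw [← lintegral_indicator_one m2,
      ← lintegral_const_mul _ (measurable_one.indicator m2)]
    refine lintegral_congr fun u => ?_
    by_cases h1 : s ∈ negUpTo n
    · rw [Set.indicator_of_mem h1, Pi.one_apply, one_mul]
      refine indicator_one_congr ?_
      simp only [h1, Set.mem_ofPred_eq, Set.mem_Ici, true_and]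
      constructor <;> intro h <;> linarith
    · rw [Set.indicator_of_notMem h1, Set.indicator_of_notMem (fun h => h1 h.1), zero_mul]
  simp_rw [renewal_eq_tsum_neg]
  rw [lintegral_tsum]
  · simp_rw [h1]
    -- Split on the sign of `s (n + 1)`. The entrance probabilities sum to `1`, which is exactly the
    -- term `n = 0` missing from the series for `renewal f x`.
    have h2 : ∀ n : ℕ, walk f 0 (negUpTo n ∩ {s | -x ≤ s (n + 1)}) =
        walk f 0 (negUpTo (n + 1) ∩ {s | -x ≤ s (n + 1)}) +
          walk f 0 (negUpTo n ∩ {s | 0 ≤ s (n + 1)}) := by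
      intro n
      rw [← measure_union _ (measurableSet_exit n)]
      · congr 1
        ext s
        simp only [Set.mem_inter_iff, Set.mem_union, Set.mem_ofPred_eq, negUpTo]
        constructor
        · rintro ⟨h1, h2⟩
          rcases lt_or_ge (s (n + 1)) 0 with h | h
          · refine Or.inl ⟨fun j hj hjn => ?_, h2⟩
            rcases Nat.le_succ_iff.1 hjn with hjn | rfl
            · exact h1 j hj hjn
            · exact h
          · exact Or.inr ⟨h1, h⟩
        · rintro (⟨h1, h2⟩ | ⟨h1, h2⟩)
          · exact ⟨fun j hj hjn => h1 j hj (by omega), h2⟩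
          · exact ⟨h1, by linarith⟩
      · refine Set.disjoint_left.2 fun s hs hs' => ?_
        exact absurd (hs.1 (n + 1) (by omega) le_rfl) (not_lt.2 hs'.2)
    simp_rw [h2]
    rw [ENNReal.tsum_add, tsum_walk_exit_eq_one hf_var hf_mean, add_comm,
      tsum_eq_zero_add' (f := fun n => walk f 0 (negUpTo n ∩ {s | -x ≤ s n})) ENNReal.summable,
      walk_negUpTo_zero f hx]
  · intro n
    refine Measurable.aemeasurable (Monotone.measurable fun u v huv => ?_)
    refine measure_mono (Set.inter_subset_inter_right _ fun s hs => ?_)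
    simp only [Set.mem_ofPred_eq] at hs ⊢
    linarith

/-- The number of strict descending records above `0`. -/
noncomputable def recordCount (s : ℕ → ℝ) : ℝ≥0∞ :=
  ∑' n : ℕ, ({s : ℕ → ℝ | 0 ≤ s n} ∩ {s | ∀ j < n, s n < s j}).indicator 1 s

theorem measurable_recordCount : Measurable recordCount :=
  Measurable.tsum fun n =>
    measurable_one.indicator ((measurableSet_le_apply 0 n).inter (measurableSet_descRecord n))

theorem renewal_eq_lintegral (x : ℝ) : renewal f x = ∫⁻ s, recordCount s ∂(walk f x) := by
  have h : ∀ n, MeasurableSet ({s : ℕ → ℝ | 0 ≤ s n} ∩ {s | ∀ j < n, s n < s j}) := fun n =>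
    (measurableSet_le_apply 0 n).inter (measurableSet_descRecord n)
  rw [renewal_eq_tsum_record]
  unfold recordCount
  rw [lintegral_tsum fun n => (measurable_one.indicator (h n)).aemeasurable]
  exact tsum_congr fun n => (lintegral_indicator_one (h n)).symm

/-- The paths whose first passage below `x` is at time `m`. -/
def firstBelow (x : ℝ) (m : ℕ) : Set (ℕ → ℝ) := {s | (∀ j < m, x ≤ s j) ∧ s m < x}

theorem measurableSet_firstBelow (x : ℝ) (m : ℕ) : MeasurableSet (firstBelow x m) := by
  rw [firstBelow, Set.ofPred_and]
  refine MeasurableSet.inter ?_ (measurableSet_lt (measurable_pi_apply _) measurable_const)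
  simp only [Set.ofPred_forall]
  exact MeasurableSet.iInter fun j => MeasurableSet.iInter fun _ => measurableSet_le_apply _ _

/-- Records before the first passage below `x` are records of `s - x` above `0`; the later ones are
records of the path restarted at that passage. -/
theorem recordCount_le (x : ℝ) (s : ℕ → ℝ) :
    recordCount s ≤ recordCount (fun n => s n - x) +
      ∑' m, (firstBelow x m).indicator 1 s * recordCount (shift m s) := by
  by_cases hs : ∃ m, s m < x
  · obtain ⟨m, h1, h2⟩ : ∃ m, s m < x ∧ ∀ j < m, x ≤ s j := by
      classical
      exact ⟨Nat.find hs, Nat.find_spec hs, fun j hj => not_lt.1 (Nat.find_min hs hj)⟩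
    have h3 : recordCount (shift m s) ≤
        ∑' m, (firstBelow x m).indicator 1 s * recordCount (shift m s) := by
      refine le_trans (le_of_eq ?_) (ENNReal.le_tsum m)
      rw [Set.indicator_of_mem (show s ∈ firstBelow x m from ⟨h2, h1⟩), Pi.one_apply, one_mul]
    refine le_trans ?_ (add_le_add le_rfl h3)
    have h4 := Summable.sum_add_tsum_nat_add' (f := fun n : ℕ => ({s : ℕ → ℝ | 0 ≤ s n} ∩
      {s | ∀ j < n, s n < s j}).indicator (1 : (ℕ → ℝ) → ℝ≥0∞) s) (k := m) ENNReal.summable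
    refine le_trans (le_of_eq h4.symm) (add_le_add ?_ ?_)
    · refine le_trans (Finset.sum_le_sum fun n hn => ?_) (ENNReal.sum_le_tsum (Finset.range m))
      refine indicator_one_le fun h => ⟨?_, fun j hj => ?_⟩
      · exact sub_nonneg.2 (h2 n (by simpa using hn))
      · exact sub_lt_sub_right (h.2 j hj) x
    · refine ENNReal.tsum_le_tsum fun n => indicator_one_le fun h => ⟨?_, fun j hj => ?_⟩
      · have h4 : 0 ≤ s (n + m) := h.1
        rw [add_comm] at h4
        exact h4
      · have h4 : s (n + m) < s (m + j) := h.2 (m + j) (by omega)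
        rw [add_comm] at h4
        exact h4
  · refine le_trans (ENNReal.tsum_le_tsum fun n => indicator_one_le fun h => ?_) le_self_add
    exact ⟨sub_nonneg.2 (not_lt.1 fun h => hs ⟨n, h⟩), fun j hj => sub_lt_sub_right (h.2 j hj) x⟩

/-- The renewal function is subadditive. -/
theorem renewal_le_add (y x : ℝ) : renewal f y ≤ renewal f (y - x) + renewal f x := by
  have m1 : ∀ m, Measurable fun s : ℕ → ℝ =>
      (firstBelow x m).indicator (1 : (ℕ → ℝ) → ℝ≥0∞) s * recordCount (shift m s) := fun m =>
    (measurable_one.indicator (measurableSet_firstBelow x m)).mul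
      (measurable_recordCount.comp (measurable_shift m))
  have m2 : Measurable fun s : ℕ → ℝ => recordCount (fun n => s n - x) :=
    measurable_recordCount.comp (by fun_prop)
  have h1 : renewal f (y - x) = ∫⁻ s, recordCount (fun n => s n - x) ∂(walk f y) := by
    have := lintegral_walk_add f m2 (y - x) x
    rw [sub_add_cancel] at this
    rw [this, renewal_eq_lintegral]
    simp
  -- The restarted walk begins at `s m < x`, so by monotonicity it has at most `renewal f x` records
  -- on average.
  have h2 : ∀ m, ∫⁻ s, (firstBelow x m).indicator 1 s * recordCount (shift m s) ∂(walk f y) ≤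
      walk f y (firstBelow x m) * renewal f x := by
    intro m
    rw [lintegral_markov f (Φ := fun s t => (firstBelow x m).indicator 1 s * recordCount t)]
    · rw [← lintegral_indicator_one (measurableSet_firstBelow x m),
        ← lintegral_mul_const _ (measurable_one.indicator (measurableSet_firstBelow x m))]
      refine lintegral_mono fun s => ?_
      rw [lintegral_const_mul _ measurable_recordCount, ← renewal_eq_lintegral]
      by_cases hs : s ∈ firstBelow x m
      · gcongr
        exact renewal_mono f hs.2.le
      · simp [Set.indicator_of_notMem hs]
    · exact ((measurable_one.indicator (measurableSet_firstBelow x m)).comp measurable_fst).mul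
        (measurable_recordCount.comp measurable_snd)
    · intro s t
      congr 1
      refine indicator_one_congr ?_
      simp only [firstBelow, Set.mem_ofPred_eq, stopAt, min_self]
      refine and_congr_left fun _ => forall_congr' fun j => forall_congr' fun hj => ?_
      rw [min_eq_left hj.le]
  rw [renewal_eq_lintegral f y]
  calc ∫⁻ s, recordCount s ∂(walk f y)
      ≤ ∫⁻ s, recordCount (fun n => s n - x) +
        ∑' m, (firstBelow x m).indicator 1 s * recordCount (shift m s) ∂(walk f y) :=
        lintegral_mono fun s => recordCount_le x s
    _ = renewal f (y - x) +
        ∑' m, ∫⁻ s, (firstBelow x m).indicator 1 s * recordCount (shift m s) ∂(walk f y) := by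
        rw [lintegral_add_left m2, ← h1, lintegral_tsum fun m => (m1 m).aemeasurable]
    _ ≤ renewal f (y - x) + ∑' m, walk f y (firstBelow x m) * renewal f x := by
        gcongr with m
        exact h2 m
    _ ≤ renewal f (y - x) + renewal f x := by
        gcongr
        rw [ENNReal.tsum_mul_right, ← measure_iUnion _ (measurableSet_firstBelow x)]
        · exact mul_le_of_le_one_left zero_le prob_le_one
        · intro n m hnm
          refine Set.disjoint_left.2 fun s hs hs' => ?_
          rcases lt_or_gt_of_ne hnm with h | h
          · exact absurd hs.2 (not_lt.2 (hs'.1 n h))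
          · exact absurd hs'.2 (not_lt.2 (hs.1 m h))

end

/-! ### Linear growth, finiteness of `μ_H`, and the law `ν`. -/

theorem lintegral_stepLaw {f : ℝ → ℝ} (hf_meas : Measurable f) {g : ℝ → ℝ≥0∞}
    (hg : Measurable g) : ∫⁻ u, g u ∂(stepLaw f) = ∫⁻ u, ENNReal.ofReal (f u) * g u := by
  rw [stepLaw, lintegral_withDensity_eq_lintegral_mul _ (by fun_prop) hg]
  rfl

section

variable {f : ℝ → ℝ} [IsProbabilityMeasure (stepLaw f)]

/-- A centred law carried by `(-∞, 0]` is the point mass at `0`, which has no density. -/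
theorem exists_stepLaw_Ici_pos (hf_var : MemLp (fun u : ℝ => u) 2 (stepLaw f))
    (hf_mean : ∫ u, u ∂(stepLaw f) = 0) : ∃ ε > 0, stepLaw f (Set.Ici ε) ≠ 0 := by
  by_contra! h
  have h1 : ∀ᵐ u ∂(stepLaw f), ∀ n : ℕ, u < 1 / ((n : ℝ) + 1) := by
    refine ae_all_iff.2 fun n => ?_
    rw [ae_iff]
    simp only [not_lt]
    exact h (1 / ((n : ℝ) + 1)) (by positivity)
  have h2 : ∀ᵐ u ∂(stepLaw f), u ≤ 0 := by
    filter_upwards [h1] with u hu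
    by_contra hpos
    obtain ⟨n, hn⟩ := exists_nat_one_div_lt (not_le.1 hpos)
    exact absurd (hu n) (not_lt.2 hn.le)
  have hint : Integrable (fun u : ℝ => u) (stepLaw f) := hf_var.integrable (by norm_num)
  have h3 : ∫ u, -u ∂(stepLaw f) = 0 := by rw [integral_neg, hf_mean, neg_zero]
  have h4 := (integral_eq_zero_iff_of_nonneg_ae (μ := stepLaw f) (f := fun u => -u)
    (by filter_upwards [h2] with u hu; simpa using hu) hint.neg).1 h3
  obtain ⟨u, hu, hu'⟩ := (h4.and (stepLaw_ae_ne f 0)).exists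
  exact hu' (by simpa using hu)

theorem exists_renewal_ne_top (hf_var : MemLp (fun u : ℝ => u) 2 (stepLaw f))
    (hf_mean : ∫ u, u ∂(stepLaw f) = 0) : ∃ ε > 0, renewal f ε ≠ ⊤ := by
  obtain ⟨ε, hε, hδ⟩ := exists_stepLaw_Ici_pos hf_var hf_mean
  refine ⟨ε, hε, ?_⟩
  -- From a height at least `-ε`, a step of at least `ε` enters `[0, ∞)`. The entrances at different
  -- times are disjoint, so their probabilities sum to at most `1`.
  have h1 : renewal f ε * stepLaw f (Set.Ici ε) ≤ 1 := by
    rw [← tsum_walk_exit_eq_one hf_var hf_mean, renewal_eq_tsum_neg, ← ENNReal.tsum_mul_right]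
    refine ENNReal.tsum_le_tsum fun n => ?_
    have mA := (measurableSet_negUpTo n).inter (measurableSet_le_apply (-ε) n)
    refine le_trans ?_ (walk_negUpTo_step f (A := Set.Ici 0) measurableSet_Ici n).ge
    rw [← lintegral_indicator_one mA, ← lintegral_mul_const _ (measurable_one.indicator mA)]
    refine lintegral_mono fun s => ?_
    by_cases hs : s ∈ negUpTo n ∩ {s | -ε ≤ s n}
    · rw [Set.indicator_of_mem hs, Set.indicator_of_mem hs.1]
      gcongr
      intro u hu
      have h1 : -ε ≤ s n := hs.2
      have h2 : ε ≤ u := hu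
      simp only [Set.mem_Ici, Set.mem_ofPred_eq]
      linarith
    · rw [Set.indicator_of_notMem hs, zero_mul]
      exact zero_le
  intro htop
  rw [htop, ENNReal.top_mul hδ] at h1
  exact absurd h1 (by simp)

/-- The renewal function grows at most linearly. -/
theorem exists_renewal_le (hf_var : MemLp (fun u : ℝ => u) 2 (stepLaw f))
    (hf_mean : ∫ u, u ∂(stepLaw f) = 0) :
    ∃ C : ℝ, 0 ≤ C ∧ ∀ x : ℝ, renewal f x ≤ ENNReal.ofReal (C * (1 + |x|)) := by
  obtain ⟨ε, hε, hfin⟩ := exists_renewal_ne_top hf_var hf_mean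
  have h1 : ∀ k : ℕ, renewal f (k * ε) ≤ (k + 1 : ℕ) * renewal f ε := by
    intro k
    induction k with
    | zero => simpa using renewal_mono f hε.le
    | succ k ih =>
      refine (renewal_le_add f _ ε).trans ?_
      have h : ((k + 1 : ℕ) : ℝ) * ε - ε = k * ε := by push_cast; ring
      rw [h, Nat.cast_succ (k + 1), add_mul, one_mul]
      gcongr
  set D := (renewal f ε).toReal with hD
  have hD' : renewal f ε = ENNReal.ofReal D := (ENNReal.ofReal_toReal hfin).symm
  have hD0 : 0 ≤ D := ENNReal.toReal_nonneg
  -- For `k = ⌈|x| / ε⌉` subadditivity gives the bound `(k + 1) * D`, and `k + 1 ≤ |x| / ε + 2 ≤ (2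
  -- + 1 / ε) * (1 + |x|)`.
  refine ⟨D * (2 + 1 / ε), by positivity, fun x => ?_⟩
  set k := ⌈|x| / ε⌉₊ with hk
  have hx : x ≤ k * ε := by
    have := Nat.le_ceil (|x| / ε)
    rw [div_le_iff₀ hε] at this
    exact (le_abs_self x).trans this
  refine (renewal_mono f hx).trans ((h1 k).trans ?_)
  rw [hD', ← ENNReal.ofReal_natCast, ← ENNReal.ofReal_mul (by positivity)]
  refine ENNReal.ofReal_le_ofReal ?_
  have h2 : ((k + 1 : ℕ) : ℝ) ≤ |x| / ε + 2 := by
    have := Nat.ceil_lt_add_one (a := |x| / ε) (by positivity)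
    push_cast
    linarith
  have h3 : |x| / ε + 2 ≤ (2 + 1 / ε) * (1 + |x|) := by
    have : 0 ≤ |x| := abs_nonneg x
    have h4 : 0 ≤ 1 / ε := by positivity
    rw [div_eq_mul_one_div]
    nlinarith
  calc ((k + 1 : ℕ) : ℝ) * D ≤ ((2 + 1 / ε) * (1 + |x|)) * D := by gcongr; exact h2.trans h3
    _ = D * (2 + 1 / ε) * (1 + |x|) := by ring

theorem renewal_ne_top (hf_var : MemLp (fun u : ℝ => u) 2 (stepLaw f))
    (hf_mean : ∫ u, u ∂(stepLaw f) = 0) (x : ℝ) : renewal f x ≠ ⊤ := by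
  obtain ⟨C, -, h⟩ := exists_renewal_le hf_var hf_mean
  exact ne_top_of_le_ne_top ENNReal.ofReal_ne_top (h x)

/-- The law of the overshoot of the walk over its starting point. -/
theorem walk_lt_ladderStep (hf_meas : Measurable f) {y : ℝ} (hy : 0 ≤ y) :
    walk f 0 {s | y < ladderStep s} = ∫⁻ z, ENNReal.ofReal (f (z + y)) * renewal f z := by
  rw [walk_lt_ladderStep_eq_tsum f hy]
  simp_rw [renewal_eq_tsum_neg, ← ENNReal.tsum_mul_left]
  have mm : ∀ n : ℕ, Measurable fun z : ℝ => walk f 0 (negUpTo n ∩ {s | -z ≤ s n}) := by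
    intro n
    refine Monotone.measurable fun u v huv => ?_
    refine measure_mono (Set.inter_subset_inter_right _ fun s hs => ?_)
    simp only [Set.mem_ofPred_eq] at hs ⊢
    linarith
  rw [lintegral_tsum (f := fun n z => ENNReal.ofReal (f (z + y)) *
    walk f 0 (negUpTo n ∩ {s | -z ≤ s n})) fun n => ((by fun_prop : Measurable fun z : ℝ =>
    ENNReal.ofReal (f (z + y))).mul (mm n)).aemeasurable]
  refine tsum_congr fun n => ?_
  have mS : MeasurableSet {p : (ℕ → ℝ) × ℝ | p.1 ∈ negUpTo n ∧ -p.2 ≤ p.1 n} :=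
    (measurable_fst (measurableSet_negUpTo n)).inter
      (measurableSet_le (f := fun p : (ℕ → ℝ) × ℝ => -p.2) (g := fun p => p.1 n)
        (by fun_prop) (by fun_prop))
  have h2 : ∀ z, ENNReal.ofReal (f (z + y)) * walk f 0 (negUpTo n ∩ {s | -z ≤ s n}) =
      ∫⁻ s, ENNReal.ofReal (f (z + y)) * {p : (ℕ → ℝ) × ℝ | p.1 ∈ negUpTo n ∧
        -p.2 ≤ p.1 n}.indicator 1 (s, z) ∂(walk f 0) := by
    intro z
    rw [lintegral_const_mul _ (f := fun s : ℕ → ℝ => {p : (ℕ → ℝ) × ℝ | p.1 ∈ negUpTo n ∧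
        -p.2 ≤ p.1 n}.indicator 1 (s, z)) ((measurable_one.indicator mS).comp
        measurable_prodMk_right),
      ← lintegral_indicator_one ((measurableSet_negUpTo n).inter (measurableSet_le_apply _ _))]
    congr 1
  simp_rw [h2]
  rw [lintegral_lintegral_swap (f := fun (z : ℝ) (s : ℕ → ℝ) => ENNReal.ofReal (f (z + y)) *
    {p : (ℕ → ℝ) × ℝ | p.1 ∈ negUpTo n ∧ -p.2 ≤ p.1 n}.indicator 1 (s, z))
    ((by fun_prop : Measurable fun p : ℝ × (ℕ → ℝ) => ENNReal.ofReal (f (p.1 + y))).mul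
      ((measurable_one.indicator mS).comp measurable_swap)).aemeasurable]
  have h3 := walk_negUpTo_step f (A := Set.Ioi y) measurableSet_Ioi n
  refine Eq.trans h3 (lintegral_congr fun s => ?_)
  by_cases hs : s ∈ negUpTo n
  · rw [Set.indicator_of_mem hs, Pi.one_apply, one_mul]
    -- Without atoms the inequality may be weak. The substitution `u = z + y` then turns it into `-z
    -- ≤ s n`, the event counted by `renewal f z`, and no density for `s n` is needed.
    have h4 : stepLaw f {u | s n + u ∈ Set.Ioi y} = stepLaw f (Set.Ici (y - s n)) := by
      refine measure_congr ?_
      filter_upwards [stepLaw_ae_ne f (y - s n)] with u hu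
      refine propext ⟨fun h => ?_, fun h => ?_⟩
      · have h : y < s n + u := h
        show y - s n ≤ u
        linarith
      · have h : y - s n ≤ u := h
        have := lt_of_le_of_ne h hu.symm
        show y < s n + u
        linarith
    rw [h4, ← lintegral_indicator_one measurableSet_Ici,
      lintegral_stepLaw hf_meas (measurable_one.indicator measurableSet_Ici),
      ← lintegral_add_right_eq_self _ y]
    refine lintegral_congr fun z => ?_
    congr 1
    refine indicator_one_congr ?_
    simp only [Set.mem_Ici, Set.mem_ofPred_eq, hs, true_and]
    constructor <;> intro h <;> linarith
  · rw [Set.indicator_of_notMem hs, zero_mul]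
    refine (lintegral_eq_zero_of_ae_eq_zero (ae_of_all _ fun z => ?_)).symm
    simp [hs]

theorem ladderDrift_eq :
    ladderDrift f = ∫⁻ y in Set.Ioi 0, walk f 0 {s | y < ladderStep s} :=
  lintegral_eq_lintegral_meas_lt _ (ae_of_all _ ladderStep_nonneg)
    measurable_ladderStep.aemeasurable

/-- The right-hand side is the mass of `ν` before normalisation. -/
theorem ladderDrift_eq_lintegral (hf_meas : Measurable f) :
    ladderDrift f = ∫⁻ z, renewal f z * ∫⁻ y in Set.Ici 0, ENNReal.ofReal (f (z + y)) := by
  have mh := measurable_renewal f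
  rw [ladderDrift_eq, setLIntegral_congr Ioi_ae_eq_Ici]
  have h1 : ∫⁻ y in Set.Ici 0, walk f 0 {s | y < ladderStep s} =
      ∫⁻ y in Set.Ici 0, ∫⁻ z, ENNReal.ofReal (f (z + y)) * renewal f z :=
    setLIntegral_congr_fun measurableSet_Ici fun y hy => walk_lt_ladderStep hf_meas hy
  rw [h1, lintegral_lintegral_swap]
  · refine lintegral_congr fun z => ?_
    rw [lintegral_mul_const _ (by fun_prop), mul_comm]
  · exact Measurable.aemeasurable (by
      show Measurable fun p : ℝ × ℝ => ENNReal.ofReal (f (p.2 + p.1)) * renewal f p.2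
      fun_prop)

/-- The overshoot formula at `y = 0` and harmonicity at `0` give `P_0(H_1 - H_0 > 0) = ∫ f h = h(0)
≥ 1`. -/
theorem ladderDrift_ne_zero (hf_meas : Measurable f)
    (hf_var : MemLp (fun u : ℝ => u) 2 (stepLaw f))
    (hf_mean : ∫ u, u ∂(stepLaw f) = 0) : ladderDrift f ≠ 0 := by
  intro h
  have h1 := (lintegral_eq_zero_iff (measurable_ladderStep.ennreal_ofReal)).1 h
  have h2 : walk f 0 {s | 0 < ladderStep s} = 0 := by
    rw [measure_eq_zero_iff_ae_notMem]
    filter_upwards [h1] with s hs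
    simpa using hs
  have h3 := walk_lt_ladderStep hf_meas (f := f) le_rfl
  rw [h2] at h3
  simp only [add_zero] at h3
  rw [← lintegral_stepLaw hf_meas (measurable_renewal f)] at h3
  have h4 := lintegral_renewal_add hf_var hf_mean le_rfl
  simp only [zero_add] at h4
  have h5 := one_le_renewal f le_rfl
  rw [← h4, ← h3] at h5
  exact absurd h5 (by simp)

/-- By Fubini, `μ_H` is the mean of `∫_0^ξ h` over a step `ξ`. Linear growth of `h` bounds it by a
multiple of the mean of `|ξ| + ξ²`. -/
theorem ladderDrift_ne_top (hf_meas : Measurable f)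
    (hf_var : MemLp (fun u : ℝ => u) 2 (stepLaw f))
    (hf_mean : ∫ u, u ∂(stepLaw f) = 0) : ladderDrift f ≠ ⊤ := by
  obtain ⟨C, hC, hle⟩ := exists_renewal_le hf_var hf_mean
  have mh := measurable_renewal f
  have h1 : ∀ z : ℝ, renewal f z * ∫⁻ y in Set.Ici 0, ENNReal.ofReal (f (z + y)) =
      ∫⁻ w, (Set.Icc 0 w).indicator (renewal f) z ∂(stepLaw f) := by
    intro z
    have m1 : Measurable fun w : ℝ => (Set.Icc 0 w).indicator (renewal f) z := by
      have : (fun w : ℝ => (Set.Icc 0 w).indicator (renewal f) z) =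
          (Set.Ici z).indicator fun _ => (Set.Ici 0).indicator (renewal f) z := by
        funext w
        by_cases h0 : 0 ≤ z <;> by_cases hw : z ≤ w <;> simp [Set.indicator, h0, hw]
      rw [this]
      exact measurable_const.indicator measurableSet_Ici
    rw [lintegral_stepLaw hf_meas m1, ← lintegral_indicator measurableSet_Ici,
      ← lintegral_const_mul _ ((by fun_prop : Measurable fun y : ℝ =>
        ENNReal.ofReal (f (z + y))).indicator measurableSet_Ici),
      ← lintegral_add_left_eq_self (fun w => ENNReal.ofReal (f w) * _) z]
    refine lintegral_congr fun y => ?_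
    by_cases hz : 0 ≤ z
    · by_cases hy : 0 ≤ y <;> simp [Set.indicator, hz, hy, mul_comm]
    · rw [renewal_of_neg f (not_le.1 hz)]
      simp [hz]
  rw [ladderDrift_eq_lintegral hf_meas]
  simp_rw [h1]
  rw [lintegral_lintegral_swap]
  · have h2 : ∀ w : ℝ, ∫⁻ z, (Set.Icc 0 w).indicator (renewal f) z ≤
        ENNReal.ofReal (C * (|w| + w ^ 2)) := by
      intro w
      rw [lintegral_indicator measurableSet_Icc]
      calc ∫⁻ z in Set.Icc 0 w, renewal f z
          ≤ ∫⁻ _ in Set.Icc 0 w, ENNReal.ofReal (C * (1 + |w|)) := by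
            refine setLIntegral_mono measurable_const fun z hz => (hle z).trans ?_
            refine ENNReal.ofReal_le_ofReal ?_
            have := abs_le_abs_of_nonneg hz.1 hz.2
            gcongr
        _ = ENNReal.ofReal (C * (1 + |w|)) * ENNReal.ofReal w := by
            rw [setLIntegral_const, Real.volume_Icc, sub_zero]
        _ ≤ ENNReal.ofReal (C * (1 + |w|)) * ENNReal.ofReal |w| := by
            gcongr
            exact le_abs_self w
        _ = ENNReal.ofReal (C * (|w| + w ^ 2)) := by
            rw [← ENNReal.ofReal_mul (by positivity), ← sq_abs w]
            congr 1
            ring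
    refine ne_top_of_le_ne_top ?_ (lintegral_mono h2)
    have hint : Integrable (fun w : ℝ => C * (|w| + w ^ 2)) (stepLaw f) :=
      (((hf_var.integrable (by norm_num)).abs).add hf_var.integrable_sq).const_mul C
    exact hint.lintegral_lt_top.ne
  · refine Measurable.aemeasurable ?_
    have : (Function.uncurry fun z w : ℝ => (Set.Icc 0 w).indicator (renewal f) z) =
        ({p : ℝ × ℝ | 0 ≤ p.1} ∩ {p | p.1 ≤ p.2}).indicator fun p => renewal f p.1 := by
      funext p
      simp [Function.uncurry, Set.indicator]
    rw [this]
    exact (mh.comp measurable_fst).indicator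
      ((measurableSet_le measurable_const measurable_fst).inter
        (measurableSet_le measurable_fst measurable_snd))

/-- The constraint on the first coordinate disappears because `renewal f` vanishes on the negative
half-line. -/
theorem lintegral_jointLaw (hf_meas : Measurable f) {G : ℝ × ℝ → ℝ≥0∞} (hG : Measurable G) :
    ∫⁻ q, G q ∂(jointLaw f) = (ladderDrift f)⁻¹ * ∫⁻ x, renewal f x *
      ∫⁻ y, (Set.Ici 0).indicator 1 y * (ENNReal.ofReal (f (x + y)) * G (x, y)) := by
  have mh := measurable_renewal f
  have mI : Measurable ((Set.Ici (0 : ℝ)).indicator (1 : ℝ → ℝ≥0∞)) :=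
    measurable_one.indicator measurableSet_Ici
  have mS : MeasurableSet {q : ℝ × ℝ | 0 ≤ q.1 ∧ 0 ≤ q.2} :=
    (measurableSet_le measurable_const measurable_fst).inter
      (measurableSet_le measurable_const measurable_snd)
  have md : Measurable fun q : ℝ × ℝ => (ladderDrift f)⁻¹ *
      ENNReal.ofReal (transitionDensity f 0 (q.1 + q.2)) * renewal f q.1 := by
    unfold transitionDensity
    fun_prop
  rw [jointLaw, lintegral_withDensity_eq_lintegral_mul _ (md.indicator mS) hG]
  have h1 : ∀ q : ℝ × ℝ, ({q : ℝ × ℝ | 0 ≤ q.1 ∧ 0 ≤ q.2}.indicator (fun q =>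
      (ladderDrift f)⁻¹ * ENNReal.ofReal (transitionDensity f 0 (q.1 + q.2)) * renewal f q.1) *
      G) q = (ladderDrift f)⁻¹ * (renewal f q.1 * ((Set.Ici 0).indicator 1 q.2 *
        (ENNReal.ofReal (f (q.1 + q.2)) * G q))) := by
    intro q
    rw [Pi.mul_apply]
    rcases lt_or_ge q.1 0 with h | h
    · rw [renewal_of_neg f h, Set.indicator_of_notMem (fun h' => absurd h'.1 (not_le.2 h))]
      simp
    · by_cases h2 : 0 ≤ q.2
      · rw [Set.indicator_of_mem (show q ∈ {q : ℝ × ℝ | 0 ≤ q.1 ∧ 0 ≤ q.2} from ⟨h, h2⟩),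
          Set.indicator_of_mem (show q.2 ∈ Set.Ici 0 from h2)]
        simp only [transitionDensity, sub_zero, Pi.one_apply, one_mul]
        ring
      · rw [Set.indicator_of_notMem (fun h' => h2 h'.2),
          Set.indicator_of_notMem (show q.2 ∉ Set.Ici 0 from h2)]
        simp
  simp_rw [h1]
  have m2 : Measurable fun q : ℝ × ℝ => (Set.Ici 0).indicator 1 q.2 *
      (ENNReal.ofReal (f (q.1 + q.2)) * G q) := by fun_prop
  have m3 : Measurable fun q : ℝ × ℝ => renewal f q.1 * ((Set.Ici 0).indicator 1 q.2 *
      (ENNReal.ofReal (f (q.1 + q.2)) * G q)) := (mh.comp measurable_fst).mul m2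
  rw [lintegral_const_mul _ m3, Measure.volume_eq_prod, lintegral_prod _ m3.aemeasurable]
  congr 1
  refine lintegral_congr fun x => ?_
  exact lintegral_const_mul (renewal f x) (f := fun y => (Set.Ici 0).indicator 1 y *
    (ENNReal.ofReal (f (x + y)) * G (x, y))) (m2.comp measurable_prodMk_left)

theorem isProbabilityMeasure_jointLaw (hf_meas : Measurable f)
    (hf_var : MemLp (fun u : ℝ => u) 2 (stepLaw f))
    (hf_mean : ∫ u, u ∂(stepLaw f) = 0) : IsProbabilityMeasure (jointLaw f) := by
  refine ⟨?_⟩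
  rw [← lintegral_one, lintegral_jointLaw hf_meas measurable_const]
  refine Eq.trans ?_ (ENNReal.inv_mul_cancel (ladderDrift_ne_zero hf_meas hf_var hf_mean)
    (ladderDrift_ne_top hf_meas hf_var hf_mean))
  congr 1
  rw [ladderDrift_eq_lintegral hf_meas]
  refine lintegral_congr fun x => ?_
  congr 1
  rw [← lintegral_indicator measurableSet_Ici]
  refine lintegral_congr fun y => ?_
  by_cases hy : 0 ≤ y <;> simp [hy]

/-- Integrating the first coordinate out of `ν` leaves the overshoot formula `walk_lt_ladderStep`,
that is the density of `m`. -/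
theorem lintegral_overshootLaw (hf_meas : Measurable f) {g : ℝ → ℝ≥0∞} (hg : Measurable g) :
    ∫⁻ q, g q.2 ∂(jointLaw f) = ∫⁻ y, g y ∂(overshootLaw f) := by
  have mh := measurable_renewal f
  have mI : Measurable ((Set.Ici (0 : ℝ)).indicator (1 : ℝ → ℝ≥0∞)) :=
    measurable_one.indicator measurableSet_Ici
  have mw : Measurable fun y : ℝ => walk f 0 {s | y < ladderStep s} :=
    Antitone.measurable fun y y' hy => measure_mono fun s hs => hy.trans_lt hs
  rw [lintegral_jointLaw hf_meas (G := fun q => g q.2) (hg.comp measurable_snd), overshootLaw,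
    lintegral_withDensity_eq_lintegral_mul _ (by fun_prop) hg,
    setLIntegral_congr Ioi_ae_eq_Ici]
  simp only [Pi.mul_apply, mul_assoc]
  rw [lintegral_const_mul _ (by fun_prop)]
  congr 1
  have h1 : ∫⁻ y in Set.Ici 0, walk f 0 {s | y < ladderStep s} * g y =
      ∫⁻ y in Set.Ici 0, ∫⁻ z, renewal f z * (ENNReal.ofReal (f (z + y)) * g y) := by
    refine setLIntegral_congr_fun measurableSet_Ici fun y hy => ?_
    simp only [walk_lt_ladderStep hf_meas (f := f) hy]
    rw [← lintegral_mul_const _ (by fun_prop)]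
    refine lintegral_congr fun z => ?_
    ring
  rw [h1, lintegral_lintegral_swap]
  · refine lintegral_congr fun x => ?_
    rw [lintegral_const_mul _ (by fun_prop), ← lintegral_indicator measurableSet_Ici]
    congr 1
    refine lintegral_congr fun y => ?_
    by_cases hy : 0 ≤ y <;> simp [hy]
  · refine Measurable.aemeasurable ?_
    show Measurable fun p : ℝ × ℝ => renewal f p.2 * (ENNReal.ofReal (f (p.2 + p.1)) * g p.1)
    fun_prop

end

/-! ### The walk killed below `0`. -/

/-- The paths which are nonnegative up to time `n`. -/
def nonnegUpTo (n : ℕ) : Set (ℕ → ℝ) := {s | ∀ k ≤ n, 0 ≤ s k}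

theorem measurableSet_nonnegUpTo (n : ℕ) : MeasurableSet (nonnegUpTo n) := by
  simp only [nonnegUpTo, Set.ofPred_forall]
  exact MeasurableSet.iInter fun j => MeasurableSet.iInter fun _ => measurableSet_le_apply 0 j

theorem mem_nonnegUpTo_stopAt {n : ℕ} {s : ℕ → ℝ} :
    stopAt n s ∈ nonnegUpTo n ↔ s ∈ nonnegUpTo n := by
  simp only [nonnegUpTo, Set.mem_ofPred_eq, stopAt]
  refine forall_congr' fun j => forall_congr' fun hj => ?_
  rw [min_eq_left hj]

theorem mem_nonnegUpTo_succ {n : ℕ} {s : ℕ → ℝ} :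
    s ∈ nonnegUpTo (n + 1) ↔ s ∈ nonnegUpTo n ∧ 0 ≤ s (n + 1) := by
  constructor
  · exact fun h => ⟨fun k hk => h k (by omega), h _ le_rfl⟩
  · rintro ⟨h, h'⟩ k hk
    rcases Nat.le_succ_iff.1 hk with hk | rfl
    · exact h k hk
    · exact h'

section

variable (f : ℝ → ℝ) [IsProbabilityMeasure (stepLaw f)]

/-- The expectation of `g(S_n)` for the walk killed when it becomes negative. -/
noncomputable def killed (g : ℝ → ℝ≥0∞) (n : ℕ) (u : ℝ) : ℝ≥0∞ :=
  ∫⁻ s, (nonnegUpTo n).indicator 1 s * g (s n) ∂(walk f u)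

theorem killed_zero (g : ℝ → ℝ≥0∞) {u : ℝ} (hu : 0 ≤ u) : killed f g 0 u = g u := by
  have h : ∀ᵐ s ∂(walk f u), (nonnegUpTo 0).indicator 1 s * g (s 0) = g u := by
    filter_upwards [walk_ae_zero f u] with s hs
    have : s ∈ nonnegUpTo 0 := fun k hk => by
      obtain rfl : k = 0 := by omega
      rw [hs]
      exact hu
    rw [Set.indicator_of_mem this, hs, Pi.one_apply, one_mul]
  rw [killed, lintegral_congr_ae h]
  simp

/-- As `g` vanishes on negative numbers, survival at time `n + 1` need not be imposed separately. -/
theorem killed_succ {g : ℝ → ℝ≥0∞} (hg : Measurable g) (hg0 : ∀ x < 0, g x = 0) (n : ℕ)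
    (u : ℝ) : killed f g (n + 1) u =
      ∫⁻ s, (nonnegUpTo n).indicator 1 s * ∫⁻ v, g (s n + v) ∂(stepLaw f) ∂(walk f u) := by
  have h := lintegral_markov_step f
    (Φ := fun s t => (nonnegUpTo n).indicator 1 s * g t)
    (((measurable_one.indicator (measurableSet_nonnegUpTo n)).comp measurable_fst).mul
      (hg.comp measurable_snd)) n
    (fun s t => by rw [indicator_one_congr mem_nonnegUpTo_stopAt]) u
  refine Eq.trans (lintegral_congr fun s => ?_) (h.trans (lintegral_congr fun s => ?_))
  · rcases lt_or_ge (s (n + 1)) 0 with hs | hs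
    · rw [hg0 _ hs, mul_zero, mul_zero]
    · congr 1
      exact indicator_one_congr (by simp [mem_nonnegUpTo_succ, hs])
  · exact lintegral_const_mul _ (hg.comp (measurable_const_add _))

variable {f}

theorem killed_renewal (hf_var : MemLp (fun u : ℝ => u) 2 (stepLaw f))
    (hf_mean : ∫ u, u ∂(stepLaw f) = 0) (n : ℕ) {u : ℝ} (hu : 0 ≤ u) :
    killed f (renewal f) n u = renewal f u := by
  induction n with
  | zero => exact killed_zero f _ hu
  | succ n ih =>
    rw [killed_succ f (measurable_renewal f) (fun x hx => renewal_of_neg f hx), ← ih, killed]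
    refine lintegral_congr fun s => ?_
    by_cases hs : s ∈ nonnegUpTo n
    · rw [lintegral_renewal_add hf_var hf_mean (hs n le_rfl)]
    · simp [Set.indicator_of_notMem hs]

/-- The function `h(· - x)` is subharmonic for the killed walk: it is zero below `x` and satisfies
the mean value identity from `x` on. -/
theorem killed_renewal_sub_mono (hf_var : MemLp (fun u : ℝ => u) 2 (stepLaw f))
    (hf_mean : ∫ u, u ∂(stepLaw f) = 0) {x : ℝ} (hx : 0 ≤ x) (u : ℝ) :
    Monotone fun n => killed f (fun v => renewal f (v - x)) n u := by
  refine monotone_nat_of_le_succ fun n => ?_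
  rw [killed_succ f (g := fun v => renewal f (v - x))
    ((measurable_renewal f).comp (measurable_sub_const x))
    (fun v hv => renewal_of_neg f (by linarith))]
  refine lintegral_mono fun s => ?_
  gcongr
  show renewal f (s n - x) ≤ _
  rcases lt_or_ge (s n) x with h | h
  · rw [renewal_of_neg f (by linarith)]
    exact zero_le
  · rw [← lintegral_renewal_add hf_var hf_mean (x := s n - x) (by linarith)]
    refine le_of_eq (lintegral_congr fun v => ?_)
    congr 1
    ring

theorem tendsto_walk_nonnegUpTo (hf_var : MemLp (fun u : ℝ => u) 2 (stepLaw f))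
    (hf_mean : ∫ u, u ∂(stepLaw f) = 0) (u : ℝ) :
    Tendsto (fun n => walk f u (nonnegUpTo n)) atTop (𝓝 0) := by
  have h := tendsto_measure_iInter_atTop (μ := walk f u) (s := nonnegUpTo)
    (fun n => (measurableSet_nonnegUpTo n).nullMeasurableSet)
    (fun n m hnm s hs k hk => hs k (hk.trans hnm)) ⟨0, measure_ne_top _ _⟩
  have h0 : walk f u (⋂ n, nonnegUpTo n) = 0 := by
    have hsub : ⋂ n, nonnegUpTo n ⊆ {s | ∀ n, 0 ≤ s n} := fun s hs n =>
      Set.mem_iInter.1 hs n n le_rfl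
    exact measure_mono_null hsub (walk_forall_nonneg hf_var hf_mean u)
  rwa [h0] at h

/-- Far away, the renewal function is not changed by a translation. -/
theorem tendsto_killed_renewal_sub (hf_var : MemLp (fun u : ℝ => u) 2 (stepLaw f))
    (hf_mean : ∫ u, u ∂(stepLaw f) = 0) {x : ℝ} (hx : 0 ≤ x) {u : ℝ} (hu : 0 ≤ u) :
    Tendsto (fun n => killed f (fun v => renewal f (v - x)) n u) atTop (𝓝 (renewal f u)) := by
  have mh := measurable_renewal f
  have mI : ∀ n, Measurable ((nonnegUpTo n).indicator (1 : (ℕ → ℝ) → ℝ≥0∞)) := fun n =>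
    measurable_one.indicator (measurableSet_nonnegUpTo n)
  -- Subadditivity integrated over the surviving paths: the loss is at most `h(x)` times the
  -- survival probability.
  have h1 : ∀ n, renewal f u ≤ killed f (fun v => renewal f (v - x)) n u +
      renewal f x * walk f u (nonnegUpTo n) := by
    intro n
    rw [← killed_renewal hf_var hf_mean n hu, ← lintegral_indicator_one
      (measurableSet_nonnegUpTo n), ← lintegral_const_mul _ (mI n), killed, killed,
      ← lintegral_add_right _ ((mI n).const_mul _)]
    refine lintegral_mono fun s => ?_
    rw [mul_comm (renewal f x), ← mul_add]
    gcongr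
    exact renewal_le_add f _ _
  have h2 : ∀ n, killed f (fun v => renewal f (v - x)) n u ≤ renewal f u := by
    intro n
    rw [← killed_renewal hf_var hf_mean n hu]
    refine lintegral_mono fun s => ?_
    gcongr
    exact renewal_mono f (by linarith)
  have h3 : Tendsto (fun n => renewal f u - renewal f x * walk f u (nonnegUpTo n)) atTop
      (𝓝 (renewal f u)) := by
    have h4 := ENNReal.Tendsto.const_mul (tendsto_walk_nonnegUpTo hf_var hf_mean u)
      (Or.inr (renewal_ne_top hf_var hf_mean x))
    have h5 := ENNReal.Tendsto.sub (tendsto_const_nhds (x := renewal f u)) h4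
      (Or.inl (renewal_ne_top hf_var hf_mean u))
    simpa using h5
  exact tendsto_of_tendsto_of_tendsto_of_le_of_le h3 tendsto_const_nhds
    (fun n => tsub_le_iff_right.2 (h1 n)) h2

end

/-! ### The conditioned walk as an `h`-transform. -/

/-- A homogeneous Markov chain with given transition kernel. -/
theorem exists_markov_chain (k : Kernel ℝ ℝ) [IsMarkovKernel k] :
    ∃ κ : Kernel ℝ (ℕ → ℝ), IsMarkovKernel κ ∧ (∀ x, ∀ᵐ s ∂(κ x), s 0 = x) ∧
      ∀ (G : (ℕ → ℝ) → ℝ≥0∞), Measurable G → ∀ x,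
        ∫⁻ s, G s ∂(κ x) = ∫⁻ y, ∫⁻ s, G (cons x s) ∂(κ y) ∂(k x) := by
  -- One transition is `φ x U` with `U` uniform. The chain is then a measurable function of its
  -- start and of i.i.d. uniforms, so its law depends measurably on the start.
  obtain ⟨φ, hφ, hk⟩ := k.exists_measurable_map_eq_unitInterval
  let chain : ℝ → (ℕ → unitInterval) → ℕ → ℝ := fun x ξ n =>
    Nat.rec x (fun n y => φ y (ξ n)) n
  have chain_zero : ∀ x ξ, chain x ξ 0 = x := fun _ _ => rfl
  have chain_succ : ∀ x ξ n, chain x ξ (n + 1) = φ (chain x ξ n) (ξ n) := fun _ _ _ => rfl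
  have mchain : Measurable fun p : ℝ × (ℕ → unitInterval) => chain p.1 p.2 := by
    refine measurable_pi_iff.2 fun n => ?_
    induction n with
    | zero => exact measurable_fst
    | succ n ih => exact hφ.comp (ih.prodMk ((measurable_pi_apply n).comp measurable_snd))
  have mchain' : ∀ x, Measurable (chain x) := fun x => mchain.comp measurable_prodMk_left
  have chain_cons : ∀ x u ξ, chain x (cons u ξ) = cons x (chain (φ x u) ξ) := by
    intro x u ξ
    funext n
    cases n with
    | zero => rfl
    | succ n =>
      rw [cons_succ]
      induction n with
      | zero => rfl
      | succ n ih => rw [chain_succ x (cons u ξ) (n + 1), ih, chain_succ, cons_succ]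
  set P := Measure.infinitePi fun _ : ℕ => (volume : Measure unitInterval) with hP
  let κ : Kernel ℝ (ℕ → ℝ) :=
    { toFun := fun x => P.map (chain x)
      measurable' := by
        refine Measure.measurable_of_measurable_coe _ fun s hs => ?_
        simp_rw [Measure.map_apply (mchain' _) hs]
        exact measurable_measure_prodMk_left (mchain hs) }
  have hκ : ∀ (G : (ℕ → ℝ) → ℝ≥0∞), Measurable G → ∀ x,
      ∫⁻ s, G s ∂(κ x) = ∫⁻ ξ, G (chain x ξ) ∂P := fun G hG x => lintegral_map hG (mchain' x)
  have hM : IsMarkovKernel κ :=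
    ⟨fun x => Measure.isProbabilityMeasure_map (mchain' x).aemeasurable⟩
  refine ⟨κ, hM, fun x => ?_,
    fun G hG x => ?_⟩
  · refine (ae_map_iff (mchain' x).aemeasurable ?_).2 (ae_of_all _ fun ξ => chain_zero x ξ)
    exact measurableSet_eq_fun (measurable_pi_apply 0) measurable_const
  · have mG : Measurable fun s => G (cons x s) :=
      hG.comp (measurable_cons.comp measurable_prodMk_left)
    rw [hκ G hG, lintegral_infinitePi_cons _ (G := fun ξ => G (chain x ξ)) (hG.comp (mchain' x)),
      ← hk x, lintegral_map _ (show Measurable (φ x) from hφ.comp measurable_prodMk_left)]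
    · refine lintegral_congr fun u => ?_
      rw [hκ _ mG]
      simp_rw [chain_cons]
      rfl
    · exact Measurable.lintegral_kernel_prod_right (κ := κ) (f := fun _ s => G (cons x s))
        (mG.comp measurable_snd)

section

variable (f : ℝ → ℝ) [IsProbabilityMeasure (stepLaw f)]

variable {f}

/-- The transition kernel of the walk conditioned to stay nonnegative. -/
theorem exists_conditionedKernel (hf_var : MemLp (fun u : ℝ => u) 2 (stepLaw f))
    (hf_mean : ∫ u, u ∂(stepLaw f) = 0) :
    ∃ k : Kernel ℝ ℝ, IsMarkovKernel k ∧ ∀ x, 0 ≤ x → ∀ G : ℝ → ℝ≥0∞, Measurable G →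
      ∫⁻ y, G y ∂(k x) =
        ∫⁻ u, (renewal f x)⁻¹ * (renewal f (x + u) * G (x + u)) ∂(stepLaw f) := by
  have mh := measurable_renewal f
  have h1 : ∀ x : ℝ, Measurable fun u => (renewal f x)⁻¹ * renewal f (x + u) := by
    intro x
    fun_prop
  let T : ℝ → Measure ℝ := fun x =>
    ((stepLaw f).withDensity fun u => (renewal f x)⁻¹ * renewal f (x + u)).map fun u => x + u
  have hT : ∀ x, ∀ G : ℝ → ℝ≥0∞, Measurable G → ∫⁻ y, G y ∂(T x) =
      ∫⁻ u, (renewal f x)⁻¹ * (renewal f (x + u) * G (x + u)) ∂(stepLaw f) := by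
    intro x G hG
    rw [lintegral_map hG (measurable_const_add x),
      lintegral_withDensity_eq_lintegral_mul _ (h1 x)
        (show Measurable fun u => G (x + u) from hG.comp (measurable_const_add x))]
    simp [mul_assoc]
  have mT : Measurable T := by
    refine Measure.measurable_of_measurable_coe _ fun s hs => ?_
    have h2 : ∀ x, T x s = ∫⁻ u, (renewal f x)⁻¹ * (renewal f (x + u) *
        s.indicator 1 (x + u)) ∂(stepLaw f) := by
      intro x
      rw [← hT x _ (measurable_one.indicator hs), lintegral_indicator_one hs]
    simp_rw [h2]
    refine Measurable.lintegral_prod_right' (f := fun p : ℝ × ℝ => (renewal f p.1)⁻¹ *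
      (renewal f (p.1 + p.2) * s.indicator 1 (p.1 + p.2))) ?_
    have : Measurable (s.indicator (1 : ℝ → ℝ≥0∞)) := measurable_one.indicator hs
    fun_prop
  classical
  -- On `[0, ∞)` harmonicity makes `T x` a probability. Elsewhere an arbitrary point mass keeps the
  -- kernel Markov.
  refine ⟨⟨fun x => if x ∈ Set.Ici 0 then T x else Measure.dirac 0,
    Measurable.ite measurableSet_Ici mT measurable_const⟩, ⟨fun x => ?_⟩, fun x hx G hG => ?_⟩
  · show IsProbabilityMeasure (if x ∈ Set.Ici 0 then T x else Measure.dirac 0)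
    split_ifs with hx
    · refine ⟨?_⟩
      have h0 : renewal f x ≠ 0 := (zero_lt_one.trans_le (one_le_renewal f hx)).ne'
      rw [← lintegral_one, hT x _ measurable_const]
      simp only [mul_one]
      rw [lintegral_const_mul _ (by fun_prop), lintegral_renewal_add hf_var hf_mean hx,
        ENNReal.inv_mul_cancel h0 (renewal_ne_top hf_var hf_mean x)]
    · infer_instance
  · show ∫⁻ y, G y ∂(if x ∈ Set.Ici 0 then T x else Measure.dirac 0) = _
    rw [if_pos (show x ∈ Set.Ici 0 from hx), hT x G hG]

/-- Existence of the walk conditioned to stay nonnegative. -/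
theorem exists_conditionedWalk (hf_var : MemLp (fun u : ℝ => u) 2 (stepLaw f))
    (hf_mean : ∫ u, u ∂(stepLaw f) = 0) :
    ∃ κ : Kernel ℝ (ℕ → ℝ), IsMarkovKernel κ ∧ (∀ x, ∀ᵐ s ∂(κ x), s 0 = x) ∧
      ∀ x, 0 ≤ x → IsConditionedWalk f x (κ x) := by
  have mh := measurable_renewal f
  obtain ⟨k, hk, hkint⟩ := exists_conditionedKernel hf_var hf_mean
  obtain ⟨κ, hκ, hκ0, hκint⟩ := exists_markov_chain k
  refine ⟨κ, hκ, hκ0, fun x hx => ⟨inferInstance, fun n F hF => ?_⟩⟩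
  have hinv : ∀ y : ℝ, 0 ≤ y → (renewal f y)⁻¹ * renewal f y = 1 := fun y hy =>
    ENNReal.inv_mul_cancel (zero_lt_one.trans_le (one_le_renewal f hy)).ne'
      (renewal_ne_top hf_var hf_mean y)
  induction n generalizing x with
  | zero =>
    have e1 : ∀ᵐ s ∂(κ x), F (fun i => s i) = F fun _ => x := by
      filter_upwards [hκ0 x] with s hs
      congr 1
      funext i
      rw [Fin.val_eq_zero i, hs]
    have e2 : ∀ᵐ s ∂(walk f x), Set.indicator {s : ℕ → ℝ | ∀ k ≤ 0, 0 ≤ s k}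
        (fun s => F (fun i => s i) * renewal f (s 0)) s = F (fun _ => x) * renewal f x := by
      filter_upwards [walk_ae_zero f x] with s hs
      rw [Set.indicator_of_mem]
      · rw [hs]
        congr 2
        funext i
        rw [Fin.val_eq_zero i, hs]
      · intro k hk
        obtain rfl : k = 0 := by omega
        rw [hs]
        exact hx
    rw [lintegral_congr_ae e1, lintegral_congr_ae e2]
    simp only [lintegral_const, measure_univ, mul_one]
    rw [mul_comm (F _), ← mul_assoc, hinv x hx, one_mul]
  | succ n ih =>
    have mF : Measurable fun s : ℕ → ℝ => F (fun i => s i) := hF.comp (by fun_prop)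
    have mR : Measurable (Set.indicator {s : ℕ → ℝ | ∀ k ≤ n + 1, 0 ≤ s k}
        (fun s => F (fun i => s i) * renewal f (s (n + 1)))) :=
      (mF.mul (mh.comp (measurable_pi_apply _))).indicator (measurableSet_nonnegUpTo (n + 1))
    have mcons : Measurable fun v : Fin (n + 1) → ℝ => (Fin.cons x v : Fin (n + 2) → ℝ) := by
      refine measurable_pi_iff.2 fun i => ?_
      refine Fin.cases ?_ (fun i => ?_) i
      · simp only [Fin.cons_zero]
        exact measurable_const
      · simp only [Fin.cons_succ]
        exact measurable_pi_apply i
    have ec : ∀ s : ℕ → ℝ, (fun i : Fin (n + 2) => cons x s i) =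
        (Fin.cons x (fun i : Fin (n + 1) => s i) : Fin (n + 2) → ℝ) := by
      intro s
      funext i
      refine Fin.cases rfl (fun i => ?_) i
      simp
    have mK : Measurable fun y : ℝ => ∫⁻ s, F (fun i => cons x s i) ∂(κ y) :=
      Measurable.lintegral_kernel_prod_right (κ := κ) (f := fun _ s => F (fun i => cons x s i))
        ((mF.comp (measurable_cons.comp measurable_prodMk_left)).comp measurable_snd)
    rw [hκint _ mF x, hkint x hx _ mK, lintegral_walk_cons f mR,
      lintegral_const_mul _ (f := fun u => renewal f (x + u) *
        ∫⁻ s, F (fun i => cons x s i) ∂(κ (x + u))) ((mh.comp (measurable_const_add x)).mul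
        (mK.comp (measurable_const_add x)))]
    congr 1
    refine lintegral_congr fun u => ?_
    rcases lt_or_ge (x + u) 0 with hu | hu
    · rw [renewal_of_neg f hu, zero_mul]
      refine (lintegral_eq_zero_of_ae_eq_zero ?_).symm
      filter_upwards [walk_ae_zero f (x + u)] with s hs
      refine Set.indicator_of_notMem (fun h => ?_) _
      have : 0 ≤ s 0 := h 1 (by omega)
      linarith
    -- The weight `h(x + u)` of the transition kernel cancels the inverse in the induction
    -- hypothesis, leaving `h` at the final time only.
    · have h1 := ih (x + u) hu (fun v => F (Fin.cons x v)) (hF.comp mcons)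
      simp_rw [ec]
      rw [h1, ← mul_assoc, mul_comm (renewal f _), hinv _ hu, one_mul]
      refine lintegral_congr fun s => ?_
      by_cases hs : ∀ k ≤ n, 0 ≤ s k
      · rw [Set.indicator_of_mem (show s ∈ {s : ℕ → ℝ | ∀ k ≤ n, 0 ≤ s k} from hs),
          Set.indicator_of_mem, ec, cons_succ]
        intro k hk
        cases k with
        | zero => exact hx
        | succ k => exact hs k (by omega)
      · rw [Set.indicator_of_notMem (show s ∉ {s : ℕ → ℝ | ∀ k ≤ n, 0 ≤ s k} from hs),
          Set.indicator_of_notMem]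
        exact fun h => hs fun k hk => h (k + 1) (by omega)

theorem IsConditionedWalk.lintegral_stopAt {x : ℝ} {μ : Measure (ℕ → ℝ)}
    (h : IsConditionedWalk f x μ) (n : ℕ) {G : (ℕ → ℝ) → ℝ≥0∞} (hG : Measurable G) :
    ∫⁻ s, G (stopAt n s) ∂μ = (renewal f x)⁻¹ *
      ∫⁻ s, (nonnegUpTo n).indicator 1 s * (G (stopAt n s) * renewal f (s n)) ∂(walk f x) := by
  have hlt : ∀ k, min k n < n + 1 := fun k => by omega
  have h1 := h.lintegral_eq n (fun v => G fun k => v ⟨min k n, hlt k⟩) (hG.comp (by fun_prop))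
  refine h1.trans ?_
  congr 1
  refine lintegral_congr fun s => ?_
  by_cases hs : s ∈ nonnegUpTo n
  · rw [Set.indicator_of_mem (show s ∈ {s : ℕ → ℝ | ∀ k ≤ n, 0 ≤ s k} from hs),
      Set.indicator_of_mem hs, Pi.one_apply, one_mul]
    rfl
  · rw [Set.indicator_of_notMem (show s ∉ {s : ℕ → ℝ | ∀ k ≤ n, 0 ≤ s k} from hs),
      Set.indicator_of_notMem hs, zero_mul]

end

/-! ### Two-sided laws with prescribed past and future. -/

/-- The two-sided sequence with given past and future. -/
def glue (p q : ℕ → ℝ) : ℤ → ℝ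
  | Int.ofNat n => q n
  | Int.negSucc n => -p n

theorem measurable_glue : Measurable fun r : (ℕ → ℝ) × (ℕ → ℝ) => glue r.1 r.2 := by
  refine measurable_pi_iff.2 fun n => ?_
  cases n with
  | ofNat n => exact (measurable_pi_apply n).comp measurable_snd
  | negSucc n => exact ((measurable_pi_apply n).comp measurable_fst).neg

theorem past_glue (p q : ℕ → ℝ) : past (glue p q) = p := by
  funext n
  have : -(n : ℤ) - 1 = Int.negSucc n := by rw [Int.negSucc_eq]; ring
  simp [past, this, glue]

theorem future_glue (p q : ℕ → ℝ) : future (glue p q) = q := rfl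

theorem glue_past_future (ω : ℤ → ℝ) : glue (past ω) (future ω) = ω := by
  funext n
  cases n with
  | ofNat n => rfl
  | negSucc n =>
    have : -(n : ℤ) - 1 = Int.negSucc n := by rw [Int.negSucc_eq]; ring
    simp [past, this, glue]

theorem measurable_past : Measurable past := by
  unfold past
  fun_prop

theorem measurable_future : Measurable future := by
  unfold future
  fun_prop

section

variable {f : ℝ → ℝ} [IsProbabilityMeasure (stepLaw f)]

theorem HasDisintegration.lintegral_past_future {κ : Kernel ℝ (ℕ → ℝ)} [IsMarkovKernel κ]
    [SFinite (jointLaw f)] {P : Measure (ℤ → ℝ)} (hP : HasDisintegration f κ P)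
    {G : (ℕ → ℝ) → (ℕ → ℝ) → ℝ≥0∞} (hG : Measurable (Function.uncurry G)) :
    ∫⁻ ω, G (past ω) (future ω) ∂P =
      ∫⁻ q, ∫⁻ s, ∫⁻ t, G s t ∂(walk f q.2) ∂(κ q.1) ∂(jointLaw f) := by
  have m1 : Measurable fun ω : ℤ → ℝ => ((-ω (-1), ω 0), (past ω, future ω)) :=
    (by fun_prop : Measurable fun ω : ℤ → ℝ => (-ω (-1), ω 0)).prodMk
      (measurable_past.prodMk measurable_future)
  have m2 : Measurable fun r : (ℝ × ℝ) × ((ℕ → ℝ) × (ℕ → ℝ)) => G r.2.1 r.2.2 :=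
    hG.comp measurable_snd
  have h := lintegral_map (μ := P) m2 m1
  rw [hP.map_pair_past_future, Measure.lintegral_compProd m2] at h
  rw [← h]
  refine lintegral_congr fun q => ?_
  rw [Kernel.prod_apply]
  exact lintegral_prod _ hG.aemeasurable

/-- The joint law of past and future is prescribed, and `glue` recovers the sequence from them. -/
theorem HasDisintegration.eq_of {κ : Kernel ℝ (ℕ → ℝ)} {P P' : Measure (ℤ → ℝ)}
    (hP : HasDisintegration f κ P) (hP' : HasDisintegration f κ P') : P = P' := by
  have m1 : Measurable fun ω : ℤ → ℝ => ((-ω (-1), ω 0), (past ω, future ω)) :=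
    (by fun_prop : Measurable fun ω : ℤ → ℝ => (-ω (-1), ω 0)).prodMk
      (measurable_past.prodMk measurable_future)
  have m2 : Measurable fun r : (ℝ × ℝ) × ((ℕ → ℝ) × (ℕ → ℝ)) => glue r.2.1 r.2.2 :=
    measurable_glue.comp measurable_snd
  have h : ∀ P : Measure (ℤ → ℝ), (P.map fun ω : ℤ → ℝ =>
      ((-ω (-1), ω 0), (past ω, future ω))).map (fun r => glue r.2.1 r.2.2) = P := by
    intro P
    rw [Measure.map_map m2 m1]
    refine Eq.trans ?_ Measure.map_id
    congr 1
    funext ω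
    exact glue_past_future ω
  rw [← h P, ← h P', hP.map_pair_past_future, hP'.map_pair_past_future]

theorem exists_hasDisintegration [IsProbabilityMeasure (jointLaw f)] (κ : Kernel ℝ (ℕ → ℝ))
    [IsMarkovKernel κ] (hκ : ∀ x, ∀ᵐ s ∂(κ x), s 0 = x) :
    ∃ P : Measure (ℤ → ℝ), IsProbabilityMeasure P ∧ HasDisintegration f κ P := by
  have m1 : Measurable fun ω : ℤ → ℝ => ((-ω (-1), ω 0), (past ω, future ω)) :=
    (by fun_prop : Measurable fun ω : ℤ → ℝ => (-ω (-1), ω 0)).prodMk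
      (measurable_past.prodMk measurable_future)
  have m2 : Measurable fun r : (ℝ × ℝ) × ((ℕ → ℝ) × (ℕ → ℝ)) => glue r.2.1 r.2.2 :=
    measurable_glue.comp measurable_snd
  set K := (κ.comap Prod.fst measurable_fst : Kernel (ℝ × ℝ) (ℕ → ℝ)).prod
    ((walk f).comap Prod.snd measurable_snd) with hK
  set M := (jointLaw f).compProd K with hM
  have hmain : (M.map fun r => glue r.2.1 r.2.2).map
      (fun ω => ((-ω (-1), ω 0), (past ω, future ω))) = M := by
    rw [Measure.map_map m1 m2]
    refine Eq.trans (Measure.map_congr ?_) Measure.map_id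
    have hmeas : MeasurableSet {r : (ℝ × ℝ) × ((ℕ → ℝ) × (ℕ → ℝ)) |
        r.2.1 0 = r.1.1 ∧ r.2.2 0 = r.1.2} :=
      (measurableSet_eq_fun (by fun_prop) (by fun_prop)).inter
        (measurableSet_eq_fun (by fun_prop) (by fun_prop))
    -- The past and the future start at the two coordinates of the pair, so reading the pair back
    -- from the glued sequence returns it almost surely.
    have hae : ∀ᵐ r ∂M, r.2.1 0 = r.1.1 ∧ r.2.2 0 = r.1.2 := by
      rw [hM, Measure.ae_compProd_iff hmeas]
      refine ae_of_all _ fun q => ?_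
      rw [hK, Kernel.prod_apply]
      have h1 : ∀ᵐ s ∂((κ q.1).prod (walk f q.2)), s.1 0 = q.1 :=
        Measure.quasiMeasurePreserving_fst.ae (hκ q.1)
      have h2 : ∀ᵐ s ∂((κ q.1).prod (walk f q.2)), s.2 0 = q.2 :=
        Measure.quasiMeasurePreserving_snd.ae (walk_ae_zero f q.2)
      exact h1.and h2
    filter_upwards [hae] with r hr
    simp only [Function.comp_apply, past_glue, future_glue, id]
    refine Prod.ext (Prod.ext ?_ ?_) rfl
    · show -(-r.2.1 0) = r.1.1
      rw [neg_neg, hr.1]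
    · exact hr.2
  refine ⟨M.map fun r => glue r.2.1 r.2.2, Measure.isProbabilityMeasure_map m2.aemeasurable,
    ?_, hmain⟩
  have h := congrArg (Measure.map Prod.fst) hmain
  rw [Measure.map_map measurable_fst m1] at h
  refine h.trans ?_
  rw [hM]
  exact Measure.fst_compProd _ _

/-! ### Windows of the two-sided sequence. -/

/-- The window of a two-sided sequence which starts at time `-L`. -/
def window (L : ℕ) (ω : ℤ → ℝ) : ℕ → ℝ := fun n => ω ((n : ℤ) - L)

theorem measurable_window (L : ℕ) : Measurable (window L) := by
  unfold window
  fun_prop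

/-- The paths whose first passage above `x` is at time `N + 1`. -/
def upAt (N : ℕ) (x : ℝ) : Set (ℕ → ℝ) := {s | (∀ i ≤ N, s i ≤ x) ∧ x < s (N + 1)}

theorem measurableSet_le_upTo (N : ℕ) (x : ℝ) : MeasurableSet {s : ℕ → ℝ | ∀ i ≤ N, s i ≤ x} := by
  simp only [Set.ofPred_forall]
  exact MeasurableSet.iInter fun j => MeasurableSet.iInter fun _ =>
    measurableSet_le (measurable_pi_apply j) measurable_const

theorem measurableSet_upAt (N : ℕ) (x : ℝ) : MeasurableSet (upAt N x) := by
  rw [upAt, Set.ofPred_and]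
  exact (measurableSet_le_upTo N x).inter
    (measurableSet_lt measurable_const (measurable_pi_apply _))

/-- The path which follows `s` up to time `N`, and then `t`. -/
def splice (N : ℕ) (s t : ℕ → ℝ) : ℕ → ℝ := fun n => if n ≤ N then s n else t (n - (N + 1))

theorem measurable_splice (N : ℕ) :
    Measurable fun r : (ℕ → ℝ) × (ℕ → ℝ) => splice N r.1 r.2 := by
  refine measurable_pi_iff.2 fun n => ?_
  by_cases h : n ≤ N
  · simp only [splice, if_pos h]
    exact (measurable_pi_apply n).comp measurable_fst
  · simp only [splice, if_neg h]
    exact (measurable_pi_apply _).comp measurable_snd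

theorem window_eq_splice (N : ℕ) (ω : ℤ → ℝ) :
    window (N + 1) ω = splice N (fun k => -past ω (N - k)) (future ω) := by
  funext n
  by_cases h : n ≤ N
  · simp only [window, splice, if_pos h, past, neg_neg]
    congr 1
    omega
  · simp only [window, splice, if_neg h, future]
    congr 1
    omega

theorem splice_shift (N : ℕ) (s : ℕ → ℝ) : splice N s (shift (N + 1) s) = s := by
  funext n
  by_cases h : n ≤ N
  · simp [splice, h]
  · simp only [splice, if_neg h, shift]
    congr 1
    omega

theorem splice_stopAt (N : ℕ) (s t : ℕ → ℝ) : splice N (stopAt N s) t = splice N s t := by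
  funext n
  by_cases h : n ≤ N
  · simp [splice, h, stopAt]
  · simp [splice, h]

/-- The Markov property at time `N`, with the step from time `N` to time `N + 1` made explicit. -/
theorem lintegral_splice (hf_meas : Measurable f) {G : (ℕ → ℝ) → ℝ≥0∞} (hG : Measurable G)
    {φ : (ℕ → ℝ) → ℝ≥0∞} (hφ : Measurable φ) {g : ℝ → ℝ≥0∞} (hg : Measurable g) (N : ℕ)
    (hφ' : ∀ s, φ (stopAt N s) = φ s) (z : ℝ) :
    ∫⁻ s, φ s * (g (s (N + 1)) * G s) ∂(walk f z) =
      ∫⁻ s, φ s * (∫⁻ y, ENNReal.ofReal (f (y - s N)) *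
        (g y * ∫⁻ t, G (splice N s t) ∂(walk f y))) ∂(walk f z) := by
  have m1 : ∀ s, Measurable fun y : ℝ => ∫⁻ t, G (splice N s t) ∂(walk f y) := fun s =>
    measurable_lintegral_walk f (Φ := fun _ t => G (splice N s t))
      (hG.comp ((measurable_splice N).comp (measurable_const.prodMk measurable_snd)))
      measurable_id
  have m2 : Measurable (Function.uncurry fun s t : ℕ → ℝ =>
      φ s * (g (t 1) * G (splice N s (shift 1 t)))) := by
    refine (hφ.comp measurable_fst).mul ((hg.comp ((measurable_pi_apply 1).comp
      measurable_snd)).mul (hG.comp ((measurable_splice N).comp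
        (measurable_fst.prodMk ((measurable_shift 1).comp measurable_snd)))))
  have h1 := lintegral_markov f m2 N (fun s t => by simp only [hφ', splice_stopAt]) z
  have h2 : ∀ s : ℕ → ℝ, φ s * (g (shift N s 1) * G (splice N s (shift 1 (shift N s)))) =
      φ s * (g (s (N + 1)) * G s) := by
    intro s
    have : shift 1 (shift N s) = shift (N + 1) s := by
      funext k
      simp only [shift]
      congr 1
      omega
    rw [this, splice_shift]
    rfl
  simp_rw [h2] at h1
  rw [h1]
  refine lintegral_congr fun s => ?_
  have m3 : Measurable fun t : ℕ → ℝ => g (t 1) * G (splice N s (shift 1 t)) :=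
    (hg.comp (measurable_pi_apply 1)).mul (hG.comp
      ((measurable_splice N).comp (measurable_const.prodMk (measurable_shift 1))))
  rw [lintegral_const_mul _ m3]
  congr 1
  have m4 : Measurable fun t : ℕ → ℝ => G (splice N s t) :=
    hG.comp ((measurable_splice N).comp (measurable_const.prodMk measurable_id))
  rw [lintegral_walk_cons f m3]
  have h3 : ∀ u, ∫⁻ t, g (cons (s N) t 1) * G (splice N s (shift 1 (cons (s N) t)))
      ∂(walk f (s N + u)) = g (s N + u) * ∫⁻ t, G (splice N s t) ∂(walk f (s N + u)) := by
    intro u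
    rw [← lintegral_const_mul _ m4]
    refine lintegral_congr_ae ?_
    filter_upwards [walk_ae_zero f (s N + u)] with t ht
    have h4 : shift 1 (cons (s N) t) = t := by
      funext k
      simp [shift, add_comm 1 k]
    have h5 : cons (s N) t 1 = t 0 := rfl
    rw [h4, h5, ht]
  simp_rw [h3]
  rw [lintegral_stepLaw hf_meas (g := fun u => g (s N + u) *
    ∫⁻ t, G (splice N s t) ∂(walk f (s N + u))) ((hg.comp (measurable_const_add _)).mul
      ((m1 s).comp (measurable_const_add _))),
    ← lintegral_add_right_eq_self (fun y => ENNReal.ofReal (f (y - s N)) *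
        (g y * ∫⁻ t, G (splice N s t) ∂(walk f y))) (s N)]
  refine lintegral_congr fun u => ?_
  rw [add_sub_cancel_right, add_comm u]

end

section

variable {f : ℝ → ℝ} [IsProbabilityMeasure (stepLaw f)]

/-- The law of a window which contains the time `0`. -/
theorem HasDisintegration.lintegral_window (hf_meas : Measurable f)
    (hf_var : MemLp (fun u : ℝ => u) 2 (stepLaw f))
    (hf_mean : ∫ u, u ∂(stepLaw f) = 0) {κ : Kernel ℝ (ℕ → ℝ)} [IsMarkovKernel κ]
    (hκ : ∀ x, 0 ≤ x → IsConditionedWalk f x (κ x)) {P : Measure (ℤ → ℝ)}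
    (hP : HasDisintegration f κ P) {G : (ℕ → ℝ) → ℝ≥0∞} (hG : Measurable G) (N : ℕ) :
    ∫⁻ ω, G (window (N + 1) ω) ∂P = (ladderDrift f)⁻¹ *
      ∫⁻ z, renewal f (-z) * ∫⁻ s, (upAt N 0).indicator 1 s * G s ∂(walk f z) := by
  have := isProbabilityMeasure_jointLaw hf_meas hf_var hf_mean
  have mh := measurable_renewal f
  have mrev : Measurable fun p : ℕ → ℝ => fun k : ℕ => -p (N - k) := by fun_prop
  have mG : Measurable fun r : (ℕ → ℝ) × (ℕ → ℝ) => G (splice N (fun k => -r.1 (N - k)) r.2) :=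
    hG.comp ((measurable_splice N).comp ((mrev.comp measurable_fst).prodMk measurable_snd))
  let K : ℝ → (ℕ → ℝ) → ℝ≥0∞ := fun y p => ∫⁻ t, G (splice N (fun k => -p (N - k)) t) ∂(walk f y)
  have mK : Measurable (Function.uncurry K) :=
    measurable_lintegral_walk f (Φ := fun (r : ℝ × (ℕ → ℝ)) t =>
      G (splice N (fun k => -r.2 (N - k)) t))
      (mG.comp ((measurable_snd.comp measurable_fst).prodMk measurable_snd)) measurable_fst
  have hKstop : ∀ y p, K y (stopAt N p) = K y p := by
    intro y p
    have : (fun k => -stopAt N p (N - k)) = fun k => -p (N - k) := by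
      funext k
      simp [stopAt]
    simp only [K, this]
  have mI : Measurable ((Set.Ici (0 : ℝ)).indicator (1 : ℝ → ℝ≥0∞)) :=
    measurable_one.indicator measurableSet_Ici
  have mN : Measurable ((nonnegUpTo N).indicator (1 : (ℕ → ℝ) → ℝ≥0∞)) :=
    measurable_one.indicator (measurableSet_nonnegUpTo N)
  -- Here `s` runs through the past, from `s 0 = -S_{-1}`. The factors are survival, the `h`-weight
  -- at the far end, and the density of the jump from `-s 0` to `y`.
  let Γ : (ℕ → ℝ) → ℝ≥0∞ := fun s => (nonnegUpTo N).indicator 1 s * (renewal f (s N) *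
    ∫⁻ y, (Set.Ici 0).indicator 1 y * (ENNReal.ofReal (f (s 0 + y)) * K y s))
  have mKs : Measurable fun r : (ℕ → ℝ) × ℝ => K r.2 r.1 := mK.comp measurable_swap
  have mΓ0 : Measurable fun r : (ℕ → ℝ) × ℝ =>
      (Set.Ici 0).indicator 1 r.2 * (ENNReal.ofReal (f (r.1 0 + r.2)) * K r.2 r.1) := by
    fun_prop
  have mΓ : Measurable Γ :=
    mN.mul ((mh.comp (measurable_pi_apply N)).mul mΓ0.lintegral_prod_right')
  have hΓstop : ∀ s, Γ (stopAt N s) = Γ s := by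
    intro s
    have h0 : stopAt N s 0 = s 0 := by simp [stopAt]
    have hN : stopAt N s N = s N := by simp [stopAt]
    simp only [Γ, h0, hN, hKstop]
    rw [indicator_one_congr mem_nonnegUpTo_stopAt]
  have h1 : ∫⁻ ω, G (window (N + 1) ω) ∂P = ∫⁻ q, ∫⁻ s, K q.2 s ∂(κ q.1) ∂(jointLaw f) := by
    simp_rw [window_eq_splice]
    exact hP.lintegral_past_future (G := fun p t => G (splice N (fun k => -p (N - k)) t)) mG
  have mκ : Measurable fun q : ℝ × ℝ => ∫⁻ s, K q.2 s ∂(κ q.1) :=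
    Measurable.lintegral_kernel_prod_right (κ := κ.comap Prod.fst measurable_fst)
      (f := fun (q : ℝ × ℝ) s => K q.2 s)
      (mK.comp ((measurable_snd.comp measurable_fst).prodMk measurable_snd))
  -- The weight `h(x)` of `ν` cancels the normalisation of the conditioned walk, leaving `h(s N)`.
  -- For `x < 0` both sides vanish.
  have h2 : ∀ x, renewal f x * ∫⁻ y, (Set.Ici 0).indicator 1 y *
      (ENNReal.ofReal (f (x + y)) * ∫⁻ s, K y s ∂(κ x)) = ∫⁻ s, Γ s ∂(walk f x) := by
    intro x
    rcases lt_or_ge x 0 with hx | hx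
    · rw [renewal_of_neg f hx, zero_mul]
      refine (lintegral_eq_zero_of_ae_eq_zero ?_).symm
      filter_upwards [walk_ae_zero f x] with s hs
      have : s ∉ nonnegUpTo N := fun h =>
        absurd (h 0 (Nat.zero_le _)) (by rw [hs]; exact not_le.2 hx)
      simp only [Γ, Set.indicator_of_notMem this, zero_mul, Pi.zero_apply]
    · have hinv : renewal f x * (renewal f x)⁻¹ = 1 :=
        ENNReal.mul_inv_cancel (zero_lt_one.trans_le (one_le_renewal f hx)).ne'
          (renewal_ne_top hf_var hf_mean x)
      have m3 : ∀ y, Measurable fun s : ℕ → ℝ => (nonnegUpTo N).indicator 1 s *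
          (K y s * renewal f (s N)) := fun y =>
        mN.mul ((mK.comp measurable_prodMk_left).mul (mh.comp (measurable_pi_apply N)))
      have h3 : ∀ y, ∫⁻ s, K y s ∂(κ x) = (renewal f x)⁻¹ *
          ∫⁻ s, (nonnegUpTo N).indicator 1 s * (K y s * renewal f (s N)) ∂(walk f x) := by
        intro y
        have := (hκ x hx).lintegral_stopAt N (G := K y) (mK.comp measurable_prodMk_left)
        simpa only [hKstop] using this
      have m4 : Measurable fun r : ℝ × (ℕ → ℝ) => (Set.Ici 0).indicator 1 r.1 *
          (ENNReal.ofReal (f (x + r.1)) * ((nonnegUpTo N).indicator 1 r.2 *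
            (K r.1 r.2 * renewal f (r.2 N)))) := by
        have : Measurable fun r : ℝ × (ℕ → ℝ) => K r.1 r.2 := mK
        fun_prop
      have m6 : Measurable fun y => (Set.Ici 0).indicator 1 y *
          (ENNReal.ofReal (f (x + y)) * ∫⁻ s, K y s ∂(κ x)) :=
        mI.mul ((by fun_prop : Measurable fun y : ℝ => ENNReal.ofReal (f (x + y))).mul
          (mκ.comp measurable_prodMk_left))
      rw [← lintegral_const_mul _ m6]
      have h4 : ∀ y, renewal f x * ((Set.Ici 0).indicator 1 y *
          (ENNReal.ofReal (f (x + y)) * ∫⁻ s, K y s ∂(κ x))) =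
          ∫⁻ s, (Set.Ici 0).indicator 1 y * (ENNReal.ofReal (f (x + y)) *
            ((nonnegUpTo N).indicator 1 s * (K y s * renewal f (s N)))) ∂(walk f x) := by
        intro y
        rw [lintegral_const_mul _ ((m3 y).const_mul _), lintegral_const_mul _ (m3 y), h3]
        have hcalc : ∀ a b c : ℝ≥0∞, renewal f x * (a * (b * ((renewal f x)⁻¹ * c))) =
            (renewal f x * (renewal f x)⁻¹) * (a * (b * c)) := fun a b c => by ring
        rw [hcalc, hinv, one_mul]
      simp_rw [h4]
      rw [lintegral_lintegral_swap m4.aemeasurable]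
      refine lintegral_congr_ae ?_
      filter_upwards [walk_ae_zero f x] with s hs
      simp only [Γ]
      have m5 : Measurable fun y => (Set.Ici 0).indicator 1 y *
          (ENNReal.ofReal (f (s 0 + y)) * K y s) := mΓ0.comp measurable_prodMk_left
      rw [← lintegral_const_mul _ m5, ← lintegral_const_mul _ (m5.const_mul _), hs]
      refine lintegral_congr fun y => ?_
      ring
  rw [h1, lintegral_jointLaw hf_meas mκ]
  congr 1
  simp_rw [h2]
  -- Reversal makes the far end of the past the starting point `z`, and turns survival into staying
  -- at or below `0`.
  have h3 := lintegral_lintegral_walk_reverse f mΓ N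
  simp_rw [hΓstop] at h3
  rw [h3]
  refine lintegral_congr fun z => ?_
  have mL : Measurable ({s : ℕ → ℝ | ∀ i ≤ N, s i ≤ 0}.indicator (1 : (ℕ → ℝ) → ℝ≥0∞)) :=
    measurable_one.indicator (measurableSet_le_upTo N 0)
  have h4 := lintegral_splice hf_meas hG mL mI N
    (fun s => indicator_one_congr (by
      simp only [Set.mem_ofPred_eq, stopAt]
      refine forall_congr' fun j => forall_congr' fun hj => ?_
      rw [min_eq_left hj])) z
  -- A passage is strict while `ν` allows `y = 0`; the difference is null.
  have h5 : ∫⁻ s, (upAt N 0).indicator 1 s * G s ∂(walk f z) =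
      ∫⁻ s, {s : ℕ → ℝ | ∀ i ≤ N, s i ≤ 0}.indicator 1 s *
        ((Set.Ici 0).indicator 1 (s (N + 1)) * G s) ∂(walk f z) := by
    refine lintegral_congr_ae ?_
    filter_upwards [walk_ae_ne f z 0 N] with s hs
    rw [← mul_assoc]
    congr 1
    by_cases ha : ∀ i ≤ N, s i ≤ 0
    · rw [Set.indicator_of_mem (show s ∈ {s : ℕ → ℝ | ∀ i ≤ N, s i ≤ 0} from ha), Pi.one_apply,
        one_mul]
      refine indicator_one_congr ⟨fun h => h.2.le, fun h => ⟨ha, lt_of_le_of_ne h hs.symm⟩⟩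
    · rw [Set.indicator_of_notMem (show s ∉ {s : ℕ → ℝ | ∀ i ≤ N, s i ≤ 0} from ha),
        Set.indicator_of_notMem (fun h => ha h.1), zero_mul]
  rw [h5, h4]
  have mφ : Measurable fun s : ℕ → ℝ => {s : ℕ → ℝ | ∀ i ≤ N, s i ≤ 0}.indicator 1 s *
      (∫⁻ y, ENNReal.ofReal (f (y - s N)) *
        ((Set.Ici 0).indicator 1 y * ∫⁻ t, G (splice N s t) ∂(walk f y))) := by
    refine mL.mul (Measurable.lintegral_prod_right' (f := fun r : (ℕ → ℝ) × ℝ =>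
      ENNReal.ofReal (f (r.2 - r.1 N)) *
        ((Set.Ici 0).indicator 1 r.2 * ∫⁻ t, G (splice N r.1 t) ∂(walk f r.2))) ?_)
    have : Measurable fun r : (ℕ → ℝ) × ℝ => ∫⁻ t, G (splice N r.1 t) ∂(walk f r.2) :=
      measurable_lintegral_walk f (Φ := fun (r : (ℕ → ℝ) × ℝ) t => G (splice N r.1 t))
        (hG.comp ((measurable_splice N).comp ((measurable_fst.comp measurable_fst).prodMk
          measurable_snd))) measurable_snd
    fun_prop
  rw [← lintegral_const_mul _ mφ]
  refine lintegral_congr_ae ?_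
  filter_upwards [walk_ae_zero f z] with s hs
  have e1 : ∀ t, splice N (fun k => -(fun k => -s (N - k)) (N - k)) t = splice N s t := by
    intro t
    funext n
    by_cases hn : n ≤ N
    · simp only [splice, if_pos hn, neg_neg]
      congr 1
      omega
    · simp only [splice, if_neg hn]
  have e2 : (nonnegUpTo N).indicator (1 : (ℕ → ℝ) → ℝ≥0∞) (fun k => -s (N - k)) =
      {s : ℕ → ℝ | ∀ i ≤ N, s i ≤ 0}.indicator 1 s := by
    refine indicator_one_congr ⟨fun h i hi => ?_, fun h i hi => ?_⟩
    · have h' : 0 ≤ -s (N - (N - i)) := h (N - i) (by omega)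
      rw [Nat.sub_sub_self hi] at h'
      linarith
    · have h' := h (N - i) (by omega)
      show 0 ≤ -s (N - i)
      linarith
  simp only [Γ, K, e1, e2, Nat.sub_self, Nat.sub_zero, hs]
  rw [mul_left_comm]
  congr 2
  refine lintegral_congr fun y => ?_
  rw [mul_left_comm, neg_add_eq_sub]

end

/-! ### Invariance under the shift at a first passage. -/

/-- The paths whose first passage above `x` is at time `k`. -/
def firstAt (x : ℝ) (k : ℕ) : Set (ℕ → ℝ) := {s | (∀ i < k, s i ≤ x) ∧ x < s k}

theorem measurableSet_firstAt (x : ℝ) (k : ℕ) : MeasurableSet (firstAt x k) := by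
  rw [firstAt, Set.ofPred_and]
  refine MeasurableSet.inter ?_ (measurableSet_lt measurable_const (measurable_pi_apply _))
  simp only [Set.ofPred_forall]
  exact MeasurableSet.iInter fun j => MeasurableSet.iInter fun _ =>
    measurableSet_le (measurable_pi_apply j) measurable_const

theorem firstAt_unique {x : ℝ} {k l : ℕ} {s : ℕ → ℝ} (hk : s ∈ firstAt x k)
    (hl : s ∈ firstAt x l) : k = l := by
  rcases lt_trichotomy k l with h | h | h
  · exact absurd hk.2 (not_lt.2 (hl.1 k h))
  · exact h
  · exact absurd hl.2 (not_lt.2 (hk.1 l h))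

section

variable {f : ℝ → ℝ} [IsProbabilityMeasure (stepLaw f)]

theorem killed_of_neg (f : ℝ → ℝ) [IsProbabilityMeasure (stepLaw f)] (g : ℝ → ℝ≥0∞) (n : ℕ)
    {u : ℝ} (hu : u < 0) : killed f g n u = 0 := by
  refine lintegral_eq_zero_of_ae_eq_zero ?_
  filter_upwards [walk_ae_zero f u] with s hs
  have : s ∉ nonnegUpTo n := fun h =>
    absurd (h 0 (Nat.zero_le _)) (by rw [hs]; exact not_le.2 hu)
  rw [Set.indicator_of_notMem this, zero_mul]
  rfl

/-- By the Markov property at time `n`, the path stays below `x` and then starts afresh. Reversing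
the first `n` steps and setting `u = x - s n` makes them a killed walk from `u` whose end `v`
carries the weight `h(-z) = h(v - x)`. -/
theorem lintegral_upAt_eq_killed {G : (ℕ → ℝ) → ℝ≥0∞} (hG : Measurable G) (n M : ℕ) (x : ℝ) :
    ∫⁻ z, renewal f (-z) * ∫⁻ s, (upAt (n + M) x).indicator 1 s * G (fun j => s (n + j) - x)
        ∂(walk f z) =
      ∫⁻ u, killed f (fun v => renewal f (v - x)) n u *
        ∫⁻ s, (upAt M 0).indicator 1 s * G s ∂(walk f (-u)) := by
  have mh := measurable_renewal f
  have mL : Measurable ({s : ℕ → ℝ | ∀ i ≤ n, s i ≤ x}.indicator (1 : (ℕ → ℝ) → ℝ≥0∞)) :=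
    measurable_one.indicator (measurableSet_le_upTo n x)
  have mU : ∀ x, Measurable ((upAt M x).indicator (1 : (ℕ → ℝ) → ℝ≥0∞)) := fun x =>
    measurable_one.indicator (measurableSet_upAt M x)
  have mGx : Measurable fun t : ℕ → ℝ => G (fun j => t j - x) := hG.comp (by fun_prop)
  have mUG : Measurable fun t : ℕ → ℝ => (upAt M x).indicator 1 t * G (fun j => t j - x) :=
    (mU x).mul mGx
  let ψ : ℝ → ℝ≥0∞ := fun w => ∫⁻ s, (upAt M 0).indicator 1 s * G s ∂(walk f w)
  have mψ : Measurable ψ := measurable_lintegral_walk f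
    (Φ := fun (_ : ℝ) s => (upAt M 0).indicator 1 s * G s)
    (((mU 0).mul hG).comp measurable_snd) measurable_id
  have h1 : ∀ v, ∫⁻ t, (upAt M x).indicator 1 t * G (fun j => t j - x) ∂(walk f v) = ψ (v - x) := by
    intro v
    have h := lintegral_walk_add f (G := fun t => (upAt M x).indicator 1 t * G (fun j => t j - x))
      ((mU x).mul mGx) (v - x) x
    rw [sub_add_cancel] at h
    rw [h]
    refine lintegral_congr fun t => ?_
    simp only [add_sub_cancel_right]
    congr 1
    refine indicator_one_congr ?_
    simp only [upAt, Set.mem_ofPred_eq]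
    refine and_congr (forall_congr' fun i => forall_congr' fun _ => ?_) ?_
    · constructor <;> intro h <;> linarith
    · constructor <;> intro h <;> linarith
  have h2 : ∀ z, ∫⁻ s, (upAt (n + M) x).indicator 1 s * G (fun j => s (n + j) - x) ∂(walk f z) =
      ∫⁻ s, {s : ℕ → ℝ | ∀ i ≤ n, s i ≤ x}.indicator 1 s * ψ (s n - x) ∂(walk f z) := by
    intro z
    have h := lintegral_markov f (Φ := fun s t => {s : ℕ → ℝ | ∀ i ≤ n, s i ≤ x}.indicator 1 s *
      ((upAt M x).indicator 1 t * G (fun j => t j - x)))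
      ((mL.comp measurable_fst).mul (((mU x).mul mGx).comp measurable_snd)) n
      (fun s t => by
        congr 1
        refine indicator_one_congr ?_
        simp only [Set.mem_ofPred_eq, stopAt]
        refine forall_congr' fun j => forall_congr' fun hj => ?_
        rw [min_eq_left hj]) z
    refine Eq.trans (lintegral_congr fun s => ?_) (h.trans (lintegral_congr fun s => ?_))
    · rw [← mul_assoc]
      congr 1
      by_cases hs : ∀ i ≤ n, s i ≤ x
      · rw [Set.indicator_of_mem (show s ∈ {s : ℕ → ℝ | ∀ i ≤ n, s i ≤ x} from hs), Pi.one_apply,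
          one_mul]
        refine indicator_one_congr ⟨fun h => ⟨fun i hi => h.1 _ (by omega), h.2⟩,
          fun h => ⟨fun i hi => ?_, h.2⟩⟩
        rcases le_or_gt i n with hin | hin
        · exact hs i hin
        · have := h.1 (i - n) (by omega)
          rw [shift, Nat.add_sub_cancel' hin.le] at this
          exact this
      · rw [Set.indicator_of_notMem (show s ∉ {s : ℕ → ℝ | ∀ i ≤ n, s i ≤ x} from hs), zero_mul,
          Set.indicator_of_notMem (fun h => hs fun i hi => h.1 i (by omega))]
    · rw [lintegral_const_mul _ mUG, h1]
  let Γ : (ℕ → ℝ) → ℝ≥0∞ := fun p => renewal f (p n) *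
    ({s : ℕ → ℝ | ∀ i ≤ n, -x ≤ s i}.indicator 1 p * ψ (-p 0 - x))
  have mA : MeasurableSet {s : ℕ → ℝ | ∀ i ≤ n, -x ≤ s i} := by
    simp only [Set.ofPred_forall]
    exact MeasurableSet.iInter fun j => MeasurableSet.iInter fun _ => measurableSet_le_apply _ j
  have mA' : Measurable ({s : ℕ → ℝ | ∀ i ≤ n, -x ≤ s i}.indicator (1 : (ℕ → ℝ) → ℝ≥0∞)) :=
    measurable_one.indicator mA
  have mΓ : Measurable Γ := by
    have : Measurable fun p : ℕ → ℝ => ψ (-p 0 - x) := mψ.comp (by fun_prop)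
    have : Measurable fun p : ℕ → ℝ => renewal f (p n) := mh.comp (measurable_pi_apply n)
    fun_prop
  have hΓstop : ∀ p, Γ (stopAt n p) = Γ p := by
    intro p
    have h0 : stopAt n p 0 = p 0 := by simp [stopAt]
    have hN : stopAt n p n = p n := by simp [stopAt]
    simp only [Γ, h0, hN]
    congr 2
    refine indicator_one_congr ?_
    simp only [Set.mem_ofPred_eq, stopAt]
    refine forall_congr' fun j => forall_congr' fun hj => ?_
    rw [min_eq_left hj]
  have h3 : ∀ z, renewal f (-z) * ∫⁻ s, (upAt (n + M) x).indicator 1 s *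
      G (fun j => s (n + j) - x) ∂(walk f z) = ∫⁻ s, Γ (fun k => -s (n - k)) ∂(walk f z) := by
    intro z
    have m3 : Measurable fun s : ℕ → ℝ => ψ (s n - x) := mψ.comp (by fun_prop)
    have m4 : Measurable fun s : ℕ → ℝ =>
      {s : ℕ → ℝ | ∀ i ≤ n, s i ≤ x}.indicator 1 s * ψ (s n - x) := mL.mul m3
    rw [h2, ← lintegral_const_mul _ m4]
    refine lintegral_congr_ae ?_
    filter_upwards [walk_ae_zero f z] with s hs
    simp only [Γ, Nat.sub_self, hs, neg_neg, Nat.sub_zero]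
    congr 2
    refine indicator_one_congr ⟨fun h i hi => ?_, fun h i hi => ?_⟩
    · have := h (n - i) (by omega)
      show -x ≤ -s (n - i)
      linarith
    · have h' : -x ≤ -s (n - (n - i)) := h (n - i) (by omega)
      rw [Nat.sub_sub_self hi] at h'
      linarith
  simp_rw [h3]
  rw [← lintegral_lintegral_walk_reverse f mΓ n, ← lintegral_sub_right_eq_self _ x]
  refine lintegral_congr fun u => ?_
  simp_rw [hΓstop]
  have h4 := lintegral_walk_add f mΓ u (-x)
  rw [← sub_eq_add_neg] at h4
  have m3 : Measurable fun s : ℕ → ℝ => renewal f (s n - x) := mh.comp (by fun_prop)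
  have m4 : Measurable fun s : ℕ → ℝ => (nonnegUpTo n).indicator 1 s * renewal f (s n - x) :=
    (measurable_one.indicator (measurableSet_nonnegUpTo n)).mul m3
  rw [h4, killed, ← lintegral_mul_const _ m4]
  refine lintegral_congr_ae ?_
  filter_upwards [walk_ae_zero f u] with p hp
  have e1 : {s : ℕ → ℝ | ∀ i ≤ n, -x ≤ s i}.indicator (1 : (ℕ → ℝ) → ℝ≥0∞) (fun k => p k - x) =
      (nonnegUpTo n).indicator 1 p := by
    refine indicator_one_congr (forall_congr' fun i => forall_congr' fun _ => ?_)
    constructor <;> intro h <;> linarith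
  have e2 : -(u - x) - x = -u := by ring
  simp only [Γ, ← sub_eq_add_neg, hp, e1, e2]
  rw [← mul_assoc, mul_comm (renewal f _)]

variable {κ : Kernel ℝ (ℕ → ℝ)} [IsMarkovKernel κ] {P : Measure (ℤ → ℝ)}

/-- For each `k`, the window starting at `-(n + M - k + 1)` places the passage above `x` at the same
window time `n + M + 1`. Up to null weight, the terms partition that event by the time of the
passage above `0`. -/
theorem HasDisintegration.sum_lintegral_firstAt (hf_meas : Measurable f)
    (hf_var : MemLp (fun u : ℝ => u) 2 (stepLaw f))
    (hf_mean : ∫ u, u ∂(stepLaw f) = 0)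
    (hκ : ∀ x, 0 ≤ x → IsConditionedWalk f x (κ x)) (hP : HasDisintegration f κ P)
    {G : (ℕ → ℝ) → ℝ≥0∞} (hG : Measurable G) (n M : ℕ) {x : ℝ} (hx : 0 ≤ x) :
    ∑ k ∈ Finset.range (n + M + 1), ∫⁻ ω, (firstAt x k).indicator 1 (future ω) *
        G (fun j => ω ((j : ℤ) - (M + 1 : ℕ) + k) - x) ∂P =
      (ladderDrift f)⁻¹ * ∫⁻ z, renewal f (-z) *
        ∫⁻ s, (upAt (n + M) x).indicator 1 s * G (fun j => s (n + j) - x) ∂(walk f z) := by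
  have mh := measurable_renewal f
  have mU : ∀ N x, Measurable ((upAt N x).indicator (1 : (ℕ → ℝ) → ℝ≥0∞)) := fun N x =>
    measurable_one.indicator (measurableSet_upAt N x)
  have mGx : Measurable fun s : ℕ → ℝ => G (fun j => s (n + j) - x) := hG.comp (by fun_prop)
  have mF : ∀ k, Measurable fun s : ℕ → ℝ => (firstAt x k).indicator (1 : (ℕ → ℝ) → ℝ≥0∞)
      (shift (n + M - k + 1) s) := fun k =>
    (measurable_one.indicator (measurableSet_firstAt x k)).comp (measurable_shift _)
  have h1 : ∀ k ∈ Finset.range (n + M + 1), ∫⁻ ω, (firstAt x k).indicator 1 (future ω) *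
        G (fun j => ω ((j : ℤ) - (M + 1 : ℕ) + k) - x) ∂P =
      (ladderDrift f)⁻¹ * ∫⁻ z, renewal f (-z) *
        ∫⁻ s, (upAt (n + M - k) 0).indicator 1 s * ((firstAt x k).indicator 1
          (shift (n + M - k + 1) s) * G (fun j => s (n + j) - x)) ∂(walk f z) := by
    intro k hk
    have hk : k ≤ n + M := Nat.lt_succ_iff.1 (Finset.mem_range.1 hk)
    have m5 : Measurable fun s : ℕ → ℝ => (firstAt x k).indicator 1
        (shift (n + M - k + 1) s) * G (fun j => s (n + j) - x) := (mF k).mul mGx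
    rw [← hP.lintegral_window hf_meas hf_var hf_mean hκ m5]
    refine lintegral_congr fun ω => ?_
    have e1 : shift (n + M - k + 1) (window (n + M - k + 1) ω) = future ω := by
      funext i
      simp only [shift, window, future]
      congr 1
      push_cast
      ring
    have e2 : ∀ j : ℕ, window (n + M - k + 1) ω (n + j) = ω ((j : ℤ) - (M + 1 : ℕ) + k) := by
      intro j
      simp only [window]
      congr 1
      push_cast [Nat.cast_sub hk]
      ring
    simp only [e1, e2]
  rw [Finset.sum_congr rfl h1, ← Finset.mul_sum]
  congr 1
  have m2 : ∀ k, Measurable fun s : ℕ → ℝ => (upAt (n + M - k) 0).indicator 1 s *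
      ((firstAt x k).indicator 1 (shift (n + M - k + 1) s) * G (fun j => s (n + j) - x)) :=
    fun k => (mU _ _).mul ((mF k).mul mGx)
  have m6 : ∀ k, Measurable fun z => renewal f (-z) *
      ∫⁻ s, (upAt (n + M - k) 0).indicator 1 s * ((firstAt x k).indicator 1
        (shift (n + M - k + 1) s) * G (fun j => s (n + j) - x)) ∂(walk f z) := fun k =>
    (mh.comp measurable_neg).mul
      (measurable_lintegral_walk f (Φ := fun (_ : ℝ) s => (upAt (n + M - k) 0).indicator 1 s *
        ((firstAt x k).indicator 1 (shift (n + M - k + 1) s) * G (fun j => s (n + j) - x)))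
        ((m2 k).comp measurable_snd) measurable_id)
  rw [← lintegral_finsetSum _ fun k _ => m6 k]
  refine lintegral_congr fun z => ?_
  -- Starts `z > 0` have weight `0`. For `z ≤ 0` the passage above `0` occurs at a time `m ≥ 1`, so
  -- the only contributing index `n + M + 1 - m` lies in the range.
  rcases lt_or_ge 0 z with hz | hz
  · simp [renewal_of_neg f (neg_neg_of_pos hz)]
  rw [← Finset.mul_sum, ← lintegral_finsetSum _ fun k _ => m2 k]
  congr 1
  refine lintegral_congr_ae ?_
  filter_upwards [walk_ae_zero f z] with s hs
  simp_rw [← mul_assoc]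
  rw [← Finset.sum_mul]
  congr 1
  by_cases hB : s ∈ upAt (n + M) x
  · rw [Set.indicator_of_mem hB, Pi.one_apply]
    obtain ⟨m, hm, hm'⟩ : ∃ m, 0 < s m ∧ ∀ i < m, s i ≤ 0 := by
      classical
      have hex : ∃ m, 0 < s m := ⟨n + M + 1, hx.trans_lt hB.2⟩
      exact ⟨Nat.find hex, Nat.find_spec hex, fun i hi => not_lt.1 (Nat.find_min hex hi)⟩
    have hm0 : m ≠ 0 := by
      rintro rfl
      rw [hs] at hm
      exact absurd hm (not_lt.2 hz)
    have hmK : m ≤ n + M + 1 := by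
      by_contra hlt
      exact absurd (hx.trans_lt hB.2) (not_lt.2 (hm' _ (not_le.1 hlt)))
    rw [Finset.sum_eq_single (n + M + 1 - m)]
    · rw [Set.indicator_of_mem, Set.indicator_of_mem, Pi.one_apply, Pi.one_apply, one_mul]
      · refine ⟨fun i hi => hB.1 _ (by omega), ?_⟩
        have : n + M - (n + M + 1 - m) + 1 + (n + M + 1 - m) = n + M + 1 := by omega
        rw [shift, this]
        exact hB.2
      · refine ⟨fun i hi => hm' i (by omega), ?_⟩
        have : n + M - (n + M + 1 - m) + 1 = m := by omega
        rw [this]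
        exact hm
    · intro k hk hne
      have hk : k ≤ n + M := Nat.lt_succ_iff.1 (Finset.mem_range.1 hk)
      rw [Set.indicator_of_notMem, zero_mul]
      intro h
      refine hne ?_
      rcases lt_trichotomy (n + M - k + 1) m with hlt | heq | hgt
      · exact absurd h.2 (not_lt.2 (hm' _ hlt))
      · omega
      · exact absurd hm (not_lt.2 (h.1 m (by omega)))
    · intro h
      exact absurd (Finset.mem_range.2 (by omega)) h
  · rw [Set.indicator_of_notMem hB]
    refine Finset.sum_eq_zero fun k hk => ?_
    have hk : k ≤ n + M := Nat.lt_succ_iff.1 (Finset.mem_range.1 hk)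
    by_cases h1 : s ∈ upAt (n + M - k) 0
    · rw [Set.indicator_of_notMem (s := firstAt x k), mul_zero]
      intro h2
      refine hB ⟨fun i hi => ?_, ?_⟩
      · rcases le_or_gt i (n + M - k) with hle | hgt
        · exact (h1.1 i hle).trans hx
        · have := h2.1 (i - (n + M - k + 1)) (by omega)
          rw [shift, Nat.add_sub_cancel' hgt] at this
          exact this
      · have := h2.2
        have e : n + M - k + 1 + k = n + M + 1 := by omega
        rw [shift, e] at this
        exact this
    · rw [Set.indicator_of_notMem h1, zero_mul]

/-- Invariance of the window under the shift at the first passage above `x`. -/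
theorem HasDisintegration.tsum_lintegral_firstAt (hf_meas : Measurable f)
    (hf_var : MemLp (fun u : ℝ => u) 2 (stepLaw f))
    (hf_mean : ∫ u, u ∂(stepLaw f) = 0)
    (hκ : ∀ x, 0 ≤ x → IsConditionedWalk f x (κ x)) (hP : HasDisintegration f κ P)
    {G : (ℕ → ℝ) → ℝ≥0∞} (hG : Measurable G) (hG1 : ∀ s, G s ≤ 1) (M : ℕ) {x : ℝ} (hx : 0 ≤ x) :
    ∑' k : ℕ, ∫⁻ ω, (firstAt x k).indicator 1 (future ω) *
        G (fun j => ω ((j : ℤ) - (M + 1 : ℕ) + k) - x) ∂P =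
      ∫⁻ ω, G (window (M + 1) ω) ∂P := by
  have mh := measurable_renewal f
  have mU : Measurable ((upAt M 0).indicator (1 : (ℕ → ℝ) → ℝ≥0∞)) :=
    measurable_one.indicator (measurableSet_upAt M 0)
  let ψ : ℝ → ℝ≥0∞ := fun u => ∫⁻ s, (upAt M 0).indicator 1 s * G s ∂(walk f (-u))
  have mψ : Measurable ψ := measurable_lintegral_walk f
    (Φ := fun (_ : ℝ) s => (upAt M 0).indicator 1 s * G s)
    ((mU.mul hG).comp measurable_snd) measurable_neg
  have m7 : ∀ n : ℕ, Measurable fun s : ℕ → ℝ => renewal f (s n - x) := fun n =>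
    mh.comp (by fun_prop)
  have mkill : ∀ n, Measurable (killed f (fun v => renewal f (v - x)) n) := fun n =>
    measurable_lintegral_walk f (Φ := fun (_ : ℝ) s =>
      (nonnegUpTo n).indicator 1 s * renewal f (s n - x))
      (((measurable_one.indicator (measurableSet_nonnegUpTo n)).mul
        (m7 n)).comp measurable_snd) measurable_id
  have h1 := (ENNReal.tendsto_nat_tsum fun k : ℕ => ∫⁻ ω, (firstAt x k).indicator 1 (future ω) *
        G (fun j => ω ((j : ℤ) - (M + 1 : ℕ) + k) - x) ∂P).comp (tendsto_add_atTop_nat (M + 1))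
  refine tendsto_nhds_unique h1 ?_
  have h2 : ∀ n : ℕ, ∑ k ∈ Finset.range (n + (M + 1)), ∫⁻ ω,
      (firstAt x k).indicator 1 (future ω) *
        G (fun j => ω ((j : ℤ) - (M + 1 : ℕ) + k) - x) ∂P = (ladderDrift f)⁻¹ *
      ∫⁻ u, killed f (fun v => renewal f (v - x)) n u * ψ u := by
    intro n
    rw [← add_assoc, hP.sum_lintegral_firstAt hf_meas hf_var hf_mean hκ hG n M hx,
      lintegral_upAt_eq_killed hG]
  have h3 : ∫⁻ ω, G (window (M + 1) ω) ∂P = (ladderDrift f)⁻¹ * ∫⁻ u, renewal f u * ψ u := by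
    rw [hP.lintegral_window hf_meas hf_var hf_mean hκ hG]
    congr 1
    rw [← lintegral_neg_eq_self]
    simp only [neg_neg, ψ]
  rw [h3]
  refine Tendsto.congr (fun n => (h2 n).symm) ?_
  refine ENNReal.Tendsto.const_mul ?_
    (Or.inr (ENNReal.inv_ne_top.2 (ladderDrift_ne_zero hf_meas hf_var hf_mean)))
  refine lintegral_tendsto_of_tendsto_of_monotone
    (fun n => ((mkill n).mul mψ).aemeasurable) (ae_of_all _ fun u n m hnm => ?_)
    (ae_of_all _ fun u => ?_)
  · exact mul_le_mul_left (killed_renewal_sub_mono hf_var hf_mean hx u hnm) _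
  -- Finiteness of `ψ u`, which comes from `G ≤ 1`, lets the product pass to the limit.
  · have hψ : ψ u ≠ ⊤ := by
      refine ne_top_of_le_ne_top ENNReal.one_ne_top
        ((lintegral_mono fun s => mul_le_one' (indicator_one_le_one _ s) (hG1 s)).trans ?_)
      simp
    refine ENNReal.Tendsto.mul_const ?_ (Or.inr hψ)
    rcases lt_or_ge u 0 with hu | hu
    · rw [renewal_of_neg f hu]
      simp_rw [killed_of_neg f _ _ hu]
      exact tendsto_const_nhds
    · exact tendsto_killed_renewal_sub hf_var hf_mean hx hu

end

/-! ### Windows determine the law; hitting times and measurability. -/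

/-- A finite measure on two-sided sequences is determined by the laws of its windows. -/
theorem ext_of_map_window {P P' : Measure (ℤ → ℝ)} [IsFiniteMeasure P]
    (h : ∀ M, P.map (window (M + 1)) = P'.map (window (M + 1))) : P = P' := by
  have h2 : ∀ I : Finset ℤ, P'.map I.restrict = P.map I.restrict := by
    intro I
    -- A crude bound for `|i|` on `I`, so that the window from `-(M + 1)` contains `I`.
    let M : ℕ := ∑ i ∈ I, i.natAbs
    have hM : ∀ i ∈ I, i.natAbs ≤ M := fun i hi =>
      Finset.single_le_sum (f := fun i : ℤ => i.natAbs) (fun _ _ => Nat.zero_le _) hi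
    let g : (ℕ → ℝ) → (I → ℝ) := fun s i => s ((i : ℤ) + (M + 1 : ℕ)).toNat
    have mg : Measurable g := by fun_prop
    have e : (I.restrict : (ℤ → ℝ) → (I → ℝ)) = g ∘ window (M + 1) := by
      funext ω i
      simp only [Finset.restrict, Function.comp_apply, g, window]
      congr 1
      have := hM i i.2
      omega
    rw [e, ← Measure.map_map mg (measurable_window _), ← Measure.map_map mg (measurable_window _),
      h M]
  exact IsProjectiveLimit.unique (P := fun I : Finset ℤ => P.map I.restrict) (fun _ => rfl) h2

theorem hittingTime_eq_of_isLeast {x : ℝ} {ω : ℤ → ℝ} {k : ℤ}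
    (h : IsLeast {n : ℤ | x < ω n} k) : hittingTime x ω = k := h.csInf_eq

/-- On `ℤ`, `sInf` takes the default value `0` on sets which are empty or unbounded below, whence
the second alternative. -/
theorem hittingTime_eq_iff (x : ℝ) (ω : ℤ → ℝ) (k : ℤ) :
    hittingTime x ω = k ↔ IsLeast {n : ℤ | x < ω n} k ∨
      (k = 0 ∧ ∀ m, ¬ IsLeast {n : ℤ | x < ω n} m) := by
  by_cases hex : ∃ m, IsLeast {n : ℤ | x < ω n} m
  · obtain ⟨m, hm⟩ := hex
    rw [hittingTime_eq_of_isLeast hm]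
    constructor
    · rintro rfl
      exact Or.inl hm
    · rintro (h | h)
      · exact hm.unique h
      · exact absurd hm (h.2 m)
  · have h0 : hittingTime x ω = 0 := by
      rcases Set.eq_empty_or_nonempty {n : ℤ | x < ω n} with h | h
      · rw [hittingTime, h, Int.csInf_empty]
      · by_cases hb : BddBelow {n : ℤ | x < ω n}
        · exact absurd ⟨_, Int.csInf_mem h hb, fun n hn => csInf_le hb hn⟩ hex
        · rw [hittingTime, Int.csInf_of_not_bddBelow hb]
    rw [h0]
    push Not at hex
    constructor
    · rintro rfl
      exact Or.inr ⟨rfl, hex⟩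
    · rintro (h | h)
      · exact absurd h (hex k)
      · exact h.1.symm

theorem measurableSet_isLeast (x : ℝ) (k : ℤ) :
    MeasurableSet {ω : ℤ → ℝ | IsLeast {n : ℤ | x < ω n} k} := by
  have : {ω : ℤ → ℝ | IsLeast {n : ℤ | x < ω n} k} =
      {ω | x < ω k} ∩ ⋂ m : ℤ, ⋂ _ : m < k, {ω | ω m ≤ x} := by
    ext ω
    simp only [IsLeast, mem_lowerBounds, Set.mem_ofPred_eq, Set.mem_inter_iff, Set.mem_iInter]
    refine and_congr_right fun _ => forall_congr' fun m => ?_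
    rw [← not_lt, ← not_lt, imp_not_comm]
  rw [this]
  exact (measurableSet_lt measurable_const (measurable_pi_apply _)).inter
    (MeasurableSet.iInter fun m => MeasurableSet.iInter fun _ =>
      measurableSet_le (measurable_pi_apply _) measurable_const)

theorem measurable_hittingTime (x : ℝ) : Measurable (hittingTime x) := by
  refine measurable_to_countable' fun k => ?_
  have : hittingTime x ⁻¹' {k} = {ω | IsLeast {n : ℤ | x < ω n} k} ∪
      {ω | k = 0 ∧ ∀ m, ¬ IsLeast {n : ℤ | x < ω n} m} := by
    ext ω
    exact hittingTime_eq_iff x ω k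
  rw [this, Set.ofPred_and, Set.ofPred_forall]
  exact (measurableSet_isLeast x k).union ((MeasurableSet.const _).inter
    (MeasurableSet.iInter fun m => (measurableSet_isLeast x m).compl))

theorem measurable_spatialShift (x : ℝ) : Measurable (spatialShift x) := by
  refine measurable_pi_iff.2 fun n => ?_
  have h : Measurable fun p : ℤ × (ℤ → ℝ) => p.2 (n + p.1) - x :=
    measurable_from_prod_countable_right fun k =>
      (by fun_prop : Measurable fun ω : ℤ → ℝ => ω (n + k) - x)
  exact h.comp ((measurable_hittingTime x).prodMk measurable_id)

theorem exists_nat_forall_le {ω : ℤ → ℝ} (h : ∃ k : ℤ, ∀ n < k, ω n ≤ 0) (L : ℤ) :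
    ∃ j : ℕ, ∀ n < L, ω n ≤ j := by
  obtain ⟨k, hk⟩ := h
  obtain ⟨B, hB⟩ := ((Set.finite_Icc k L).image ω).bddAbove
  obtain ⟨j, hj⟩ := exists_nat_ge B
  refine ⟨j, fun n hn => ?_⟩
  rcases lt_or_ge n k with h | h
  · exact (hk n h).trans (Nat.cast_nonneg j)
  · exact (hB ⟨n, ⟨h, hn.le⟩, rfl⟩).trans hj

theorem exists_isLeast {ω : ℤ → ℝ} (h1 : Tendsto ω atBot atBot)
    (h2 : limsup (fun n : ℤ => (ω n : EReal)) atTop = ⊤) (x : ℝ) :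
    ∃ k, IsLeast {n : ℤ | x < ω n} k := by
  have h3 : ∃ n, x < ω n := by
    have : ∃ᶠ n in atTop, (x : EReal) < ω n :=
      frequently_lt_of_lt_limsup (by isBoundedDefault) (by rw [h2]; exact EReal.coe_lt_top x)
    obtain ⟨n, hn⟩ := this.exists
    exact ⟨n, EReal.coe_lt_coe_iff.1 hn⟩
  obtain ⟨N, hN⟩ := eventually_atBot.1 (h1.eventually_le_atBot x)
  have hb : BddBelow {n : ℤ | x < ω n} :=
    ⟨N, fun n hn => le_of_not_ge fun h => absurd (hN n h) (not_le.2 hn)⟩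
  exact ⟨_, Int.csInf_mem h3 hb, fun n hn => csInf_le hb hn⟩

/-- The path is bounded above on every `(-∞, N)`, so its arbitrarily large values occur arbitrarily
late. -/
theorem limsup_eq_top_of_unbounded {ω : ℤ → ℝ} (h1 : ∃ k : ℤ, ∀ n < k, ω n ≤ 0)
    (h2 : ∀ j : ℕ, ∃ n, j < ω n) : limsup (fun n : ℤ => (ω n : EReal)) atTop = ⊤ := by
  by_contra hne
  obtain ⟨b, hb, -⟩ := EReal.lt_iff_exists_real_btwn.1 (lt_top_iff_ne_top.2 hne)
  obtain ⟨N, hN⟩ := eventually_atTop.1 (eventually_lt_of_limsup_lt hb)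
  obtain ⟨j, hj⟩ := exists_nat_forall_le h1 N
  obtain ⟨i, hi⟩ := exists_nat_ge b
  obtain ⟨n, hn⟩ := h2 (max i j)
  rw [Nat.cast_max] at hn
  rcases lt_or_ge n N with h | h
  · exact absurd ((le_max_right _ _).trans_lt hn) (not_lt.2 (hj n h))
  · exact absurd ((le_max_left _ _).trans_lt hn)
      (not_lt.2 ((EReal.coe_lt_coe_iff.1 (hN n h)).le.trans hi))

theorem isLeast_of_firstAt {x : ℝ} {ω : ℤ → ℝ} (hω : ∀ n < 0, ω n ≤ x) {k : ℕ}
    (hk : future ω ∈ firstAt x k) : IsLeast {n : ℤ | x < ω n} k := by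
  refine ⟨hk.2, fun n hn => ?_⟩
  by_contra hlt
  refine absurd (show x < ω n from hn) (not_lt.2 ?_)
  rcases lt_or_ge n 0 with h | h
  · exact hω n h
  · lift n to ℕ using h
    exact hk.1 n (by omega)

theorem firstAt_of_isLeast {x : ℝ} {ω : ℤ → ℝ} {k : ℕ} (h : IsLeast {n : ℤ | x < ω n} k) :
    future ω ∈ firstAt x k := by
  refine ⟨fun i hi => not_lt.1 fun hlt => ?_, h.1⟩
  have : (k : ℤ) ≤ i := h.2 hlt
  omega

/-! ### A spatially stationary law is determined by its future. -/

/-- The futures whose path seen `L` steps before the first passage above `x` lies in `A`. -/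
def passageEvent (L : ℕ) (x : ℝ) (A : Set (ℕ → ℝ)) : Set (ℕ → ℝ) :=
  ⋃ k : ℕ, ⋃ _ : L ≤ k, firstAt x k ∩ (fun q n => q (k + n - L) - x) ⁻¹' A

theorem measurableSet_passageEvent (L : ℕ) (x : ℝ) {A : Set (ℕ → ℝ)} (hA : MeasurableSet A) :
    MeasurableSet (passageEvent L x A) :=
  MeasurableSet.iUnion fun k => MeasurableSet.iUnion fun _ =>
    (measurableSet_firstAt x k).inter
      ((by fun_prop : Measurable fun (q : ℕ → ℝ) n => q (k + n - L) - x) hA)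

/-- If the path has not exceeded `x` before time `L`, then `T_x ≥ L`, and the window starting `L`
steps before `T_x` can be read off the future. -/
theorem mem_passageEvent_iff {L : ℕ} {x : ℝ} {A : Set (ℕ → ℝ)} {ω : ℤ → ℝ}
    (h : ∃ k, IsLeast {n : ℤ | x < ω n} k) (hL : ∀ n < (L : ℤ), ω n ≤ x) :
    future ω ∈ passageEvent L x A ↔ window L (spatialShift x ω) ∈ A := by
  obtain ⟨k, hk⟩ := h
  have hLk : (L : ℤ) ≤ k := not_lt.1 fun h => absurd hk.1 (not_lt.2 (hL k h))
  lift k to ℕ using (Int.natCast_nonneg L).trans hLk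
  have hLk : L ≤ k := by exact_mod_cast hLk
  have e : window L (spatialShift x ω) = fun n => future ω (k + n - L) - x := by
    funext n
    simp only [window, spatialShift, hittingTime_eq_of_isLeast hk, future]
    congr 2
    omega
  rw [e]
  simp only [passageEvent, Set.mem_iUnion, Set.mem_inter_iff, Set.mem_preimage]
  constructor
  · rintro ⟨l, hl, h1, h2⟩
    rwa [firstAt_unique h1 (firstAt_of_isLeast hk)] at h2
  · intro h
    exact ⟨k, hLk, firstAt_of_isLeast hk, h⟩

theorem IsSpatiallyStationary.exists_isLeast {P : Measure (ℤ → ℝ)} (hP : IsSpatiallyStationary P) :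
    ∀ᵐ ω ∂P, ∀ x, ∃ k, IsLeast {n : ℤ | x < ω n} k := by
  filter_upwards [hP.tendsto_atBot, hP.limsup_eq_top] with ω h1 h2 x
  exact SpatialWalk.exists_isLeast h1 h2 x

theorem IsSpatiallyStationary.tendsto_measure_exists_gt {P : Measure (ℤ → ℝ)}
    (hP : IsSpatiallyStationary P) (L : ℕ) :
    Tendsto (fun j : ℕ => P {ω | ∃ n < (L : ℤ), (j : ℝ) < ω n}) atTop (𝓝 0) := by
  have := hP.isProbabilityMeasure
  have m : ∀ j : ℕ, MeasurableSet {ω : ℤ → ℝ | ∃ n < (L : ℤ), (j : ℝ) < ω n} := by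
    intro j
    have : {ω : ℤ → ℝ | ∃ n < (L : ℤ), (j : ℝ) < ω n} =
        ⋃ n : ℤ, ⋃ _ : n < (L : ℤ), {ω | (j : ℝ) < ω n} := by
      ext ω
      simp
    rw [this]
    exact MeasurableSet.iUnion fun n => MeasurableSet.iUnion fun _ =>
      measurableSet_lt measurable_const (measurable_pi_apply _)
  have h := tendsto_measure_iInter_atTop (μ := P) (fun j => (m j).nullMeasurableSet)
    (fun i j hij ω ⟨n, hn, h⟩ => ⟨n, hn, (Nat.cast_le.2 hij).trans_lt h⟩)
    ⟨0, measure_ne_top _ _⟩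
  have h0 : P (⋂ j : ℕ, {ω : ℤ → ℝ | ∃ n < (L : ℤ), (j : ℝ) < ω n}) = 0 := by
    refine measure_eq_zero_iff_ae_notMem.2 ?_
    filter_upwards [hP.tendsto_atBot] with ω hω hmem
    obtain ⟨N, hN⟩ := eventually_atBot.1 (hω.eventually_le_atBot 0)
    obtain ⟨j, hj⟩ := exists_nat_forall_le ⟨N, fun n hn => hN n hn.le⟩ L
    obtain ⟨n, hn, h⟩ := Set.mem_iInter.1 hmem j
    exact absurd h (not_lt.2 (hj n hn))
  rwa [h0] at h

/-- By stationarity the window may be taken before `T_j`. Except when level `j` is exceeded before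
time `L`, it is then a function of the future, whose law is common. The exceptional probabilities
vanish as `j → ∞`. -/
theorem IsSpatiallyStationary.measure_window_le {P P' : Measure (ℤ → ℝ)}
    (hP : IsSpatiallyStationary P) (hP' : IsSpatiallyStationary P')
    (h : P.map future = P'.map future) (L : ℕ) {A : Set (ℕ → ℝ)} (hA : MeasurableSet A) :
    P (window L ⁻¹' A) ≤ P' (window L ⁻¹' A) := by
  have hlim := ((hP'.tendsto_measure_exists_gt L).const_add (P' (window L ⁻¹' A))).add
    (hP.tendsto_measure_exists_gt L)
  rw [add_zero, add_zero] at hlim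
  refine ge_of_tendsto' hlim fun j => ?_
  have hB := measurableSet_passageEvent L (j : ℝ) hA
  have hS : ∀ Q, IsSpatiallyStationary Q →
      Q (window L ⁻¹' A) = Q (spatialShift j ⁻¹' (window L ⁻¹' A)) := by
    intro Q hQ
    rw [← Measure.map_apply (measurable_spatialShift _) (measurable_window L hA),
      hQ.map_spatialShift]
  have hE : P (future ⁻¹' passageEvent L j A) = P' (future ⁻¹' passageEvent L j A) := by
    rw [← Measure.map_apply measurable_future hB, h, Measure.map_apply measurable_future hB]
  have h1 : P (window L ⁻¹' A) ≤ P (future ⁻¹' passageEvent L j A) +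
      P {ω | ∃ n < (L : ℤ), (j : ℝ) < ω n} := by
    rw [hS P hP]
    refine (measure_mono_ae ?_).trans (measure_union_le _ _)
    filter_upwards [hP.exists_isLeast] with ω hω hmem
    by_cases hC : ∃ n < (L : ℤ), (j : ℝ) < ω n
    · exact Or.inr hC
    · push Not at hC
      exact Or.inl ((mem_passageEvent_iff (hω j) hC).2 hmem)
  have h2 : P' (future ⁻¹' passageEvent L j A) ≤ P' (window L ⁻¹' A) +
      P' {ω | ∃ n < (L : ℤ), (j : ℝ) < ω n} := by
    rw [hS P' hP']
    refine (measure_mono_ae ?_).trans (measure_union_le _ _)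
    filter_upwards [hP'.exists_isLeast] with ω hω hmem
    by_cases hC : ∃ n < (L : ℤ), (j : ℝ) < ω n
    · exact Or.inr hC
    · push Not at hC
      exact Or.inl ((mem_passageEvent_iff (hω j) hC).1 hmem)
  rw [hE] at h1
  exact h1.trans (add_le_add_left h2 _)

/-- A spatially stationary law is determined by the law of the future. -/
theorem IsSpatiallyStationary.eq_of_map_future {P P' : Measure (ℤ → ℝ)}
    (hP : IsSpatiallyStationary P) (hP' : IsSpatiallyStationary P')
    (h : P.map future = P'.map future) : P = P' := by
  have := hP.isProbabilityMeasure
  refine ext_of_map_window fun M => Measure.ext fun A hA => ?_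
  rw [Measure.map_apply (measurable_window _) hA, Measure.map_apply (measurable_window _) hA]
  exact le_antisymm (hP.measure_window_le hP' h _ hA) (hP'.measure_window_le hP h.symm _ hA)

/-! ### Spatial stationarity of the constructed law. -/

section

variable {f : ℝ → ℝ} [IsProbabilityMeasure (stepLaw f)]
variable {κ : Kernel ℝ (ℕ → ℝ)} [IsMarkovKernel κ] {P : Measure (ℤ → ℝ)}

/-- `lintegral_window` gives mass zero to windows outside `upAt M 0`, for every `M`. -/
theorem HasDisintegration.ae_nonpos_and_pos (hf_meas : Measurable f)
    (hf_var : MemLp (fun u : ℝ => u) 2 (stepLaw f))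
    (hf_mean : ∫ u, u ∂(stepLaw f) = 0)
    (hκ : ∀ x, 0 ≤ x → IsConditionedWalk f x (κ x)) (hP : HasDisintegration f κ P) :
    ∀ᵐ ω ∂P, (∀ n < 0, ω n ≤ 0) ∧ 0 < ω 0 := by
  have h : ∀ M, ∀ᵐ ω ∂P, window (M + 1) ω ∈ upAt M 0 := by
    intro M
    have mc := (measurableSet_upAt M 0).compl
    have h := hP.lintegral_window hf_meas hf_var hf_mean hκ
      (G := (upAt M 0)ᶜ.indicator 1) (measurable_one.indicator mc) M
    have h0 : ∀ s, (upAt M 0).indicator (1 : (ℕ → ℝ) → ℝ≥0∞) s * (upAt M 0)ᶜ.indicator 1 s = 0 := by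
      intro s
      by_cases hs : s ∈ upAt M 0
      · rw [Set.indicator_of_notMem (s := (upAt M 0)ᶜ) (fun h => h hs), mul_zero]
      · rw [Set.indicator_of_notMem hs, zero_mul]
    simp only [h0, lintegral_zero, mul_zero] at h
    have m : Measurable fun ω => (upAt M 0)ᶜ.indicator (1 : (ℕ → ℝ) → ℝ≥0∞) (window (M + 1) ω) :=
      (measurable_one.indicator mc).comp (measurable_window _)
    rw [lintegral_eq_zero_iff m] at h
    filter_upwards [h] with ω hω
    by_contra hn
    rw [Set.indicator_of_mem (show window (M + 1) ω ∈ (upAt M 0)ᶜ from hn)] at hω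
    exact one_ne_zero hω
  filter_upwards [ae_all_iff.2 h] with ω hω
  refine ⟨fun n hn => ?_, ?_⟩
  · have h1 := (hω (-n - 1).toNat).1 0 (Nat.zero_le _)
    have e : ((0 : ℕ) : ℤ) - ((-n - 1).toNat + 1 : ℕ) = n := by omega
    rwa [window, e] at h1
  · have h1 := (hω 0).2
    simpa [window] using h1

/-- For `G = 1` the invariance identity says that the first passage probabilities sum to `1`; no
separate recurrence argument is needed. -/
theorem HasDisintegration.ae_exists_firstAt [IsProbabilityMeasure P] (hf_meas : Measurable f)
    (hf_var : MemLp (fun u : ℝ => u) 2 (stepLaw f))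
    (hf_mean : ∫ u, u ∂(stepLaw f) = 0)
    (hκ : ∀ x, 0 ≤ x → IsConditionedWalk f x (κ x)) (hP : HasDisintegration f κ P)
    {x : ℝ} (hx : 0 ≤ x) : ∀ᵐ ω ∂P, ∃ k, future ω ∈ firstAt x k := by
  have h := hP.tsum_lintegral_firstAt hf_meas hf_var hf_mean hκ (G := 1) measurable_one
    (fun _ => le_rfl) 0 hx
  have m : ∀ k, MeasurableSet (future ⁻¹' firstAt x k) := fun k =>
    measurable_future (measurableSet_firstAt x k)
  have e : ∀ k, ∫⁻ ω, (firstAt x k).indicator 1 (future ω) ∂P = P (future ⁻¹' firstAt x k) :=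
    fun k => lintegral_indicator_one (m k)
  simp only [Pi.one_apply, mul_one, lintegral_one, measure_univ, e] at h
  rw [← measure_iUnion (f := fun k => future ⁻¹' firstAt x k)
    (fun i j hij => Set.disjoint_left.2 fun ω hi hj => hij (firstAt_unique hi hj)) m] at h
  have h' := (prob_compl_eq_zero_iff (MeasurableSet.iUnion m)).2 h
  filter_upwards [measure_eq_zero_iff_ae_notMem.1 h'] with ω hω
  simpa using hω

theorem HasDisintegration.ae_exists_isLeast [IsProbabilityMeasure P] (hf_meas : Measurable f)
    (hf_var : MemLp (fun u : ℝ => u) 2 (stepLaw f))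
    (hf_mean : ∫ u, u ∂(stepLaw f) = 0)
    (hκ : ∀ x, 0 ≤ x → IsConditionedWalk f x (κ x)) (hP : HasDisintegration f κ P)
    {x : ℝ} (hx : 0 ≤ x) :
    ∀ᵐ ω ∂P, ∃ k : ℕ, future ω ∈ firstAt x k ∧ IsLeast {n : ℤ | x < ω n} k := by
  filter_upwards [hP.ae_exists_firstAt hf_meas hf_var hf_mean hκ hx,
    hP.ae_nonpos_and_pos hf_meas hf_var hf_mean hκ] with ω ⟨k, hk⟩ h
  exact ⟨k, hk, isLeast_of_firstAt (fun n hn => (h.1 n hn).trans hx) hk⟩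

theorem HasDisintegration.map_spatialShift_of_nonneg [IsProbabilityMeasure P]
    (hf_meas : Measurable f) (hf_var : MemLp (fun u : ℝ => u) 2 (stepLaw f))
    (hf_mean : ∫ u, u ∂(stepLaw f) = 0)
    (hκ : ∀ x, 0 ≤ x → IsConditionedWalk f x (κ x)) (hP : HasDisintegration f κ P)
    {x : ℝ} (hx : 0 ≤ x) : P.map (spatialShift x) = P := by
  have mS := measurable_spatialShift x
  have := Measure.isProbabilityMeasure_map (μ := P) mS.aemeasurable
  refine ext_of_map_window fun M => Measure.ext fun A hA => ?_
  have mW := measurable_window (M + 1)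
  have mG : Measurable (A.indicator (1 : (ℕ → ℝ) → ℝ≥0∞)) := measurable_one.indicator hA
  have h := hP.tsum_lintegral_firstAt hf_meas hf_var hf_mean hκ mG
    (fun s => indicator_one_le_one A s) M hx
  rw [Measure.map_map mW mS, Measure.map_apply (mW.comp mS) hA, Measure.map_apply mW hA,
    ← lintegral_indicator_one (mW hA), ← lintegral_indicator_one ((mW.comp mS) hA)]
  refine Eq.trans ?_ h
  have m : ∀ k : ℕ, Measurable fun ω : ℤ → ℝ =>
      (firstAt x k).indicator (1 : (ℕ → ℝ) → ℝ≥0∞) (future ω) *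
        A.indicator 1 (fun j : ℕ => ω ((j : ℤ) - (M + 1 : ℕ) + k) - x) := fun k =>
    ((measurable_one.indicator (measurableSet_firstAt x k)).comp measurable_future).mul
      (mG.comp (by fun_prop))
  rw [← lintegral_tsum fun k => (m k).aemeasurable]
  refine lintegral_congr_ae ?_
  filter_upwards [hP.ae_exists_isLeast hf_meas hf_var hf_mean hκ hx] with ω ⟨k, hk, hl⟩
  rw [tsum_eq_single k fun l hl => by
    rw [Set.indicator_of_notMem fun h => hl (firstAt_unique h hk), zero_mul]]
  rw [Set.indicator_of_mem hk, Pi.one_apply, one_mul]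
  refine indicator_one_congr ?_
  have e : window (M + 1) (spatialShift x ω) =
      fun j : ℕ => ω ((j : ℤ) - (M + 1 : ℕ) + k) - x := by
    funext j
    simp only [window, spatialShift, hittingTime_eq_of_isLeast hl]
  rw [← e]
  rfl

/-- The past is nonpositive, so after `Θ_a` it is eventually at most `-a`. As `Θ_a` preserves `P`,
this holds under `P` for every `a`; transience of the conditioned walk is not invoked. -/
theorem HasDisintegration.ae_tendsto_atBot [IsProbabilityMeasure P]
    (hf_meas : Measurable f) (hf_var : MemLp (fun u : ℝ => u) 2 (stepLaw f))
    (hf_mean : ∫ u, u ∂(stepLaw f) = 0)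
    (hκ : ∀ x, 0 ≤ x → IsConditionedWalk f x (κ x)) (hP : HasDisintegration f κ P) :
    ∀ᵐ ω ∂P, Tendsto ω atBot atBot := by
  have h : ∀ a : ℕ, ∀ᵐ ω ∂P, ∃ k : ℤ, ∀ n < k, ω n ≤ -(a : ℝ) := by
    intro a
    have mS := measurable_spatialShift (a : ℝ)
    have h1 := hP.map_spatialShift_of_nonneg hf_meas hf_var hf_mean hκ (Nat.cast_nonneg a)
    have h2 : ∀ᵐ ω ∂P, ∃ k : ℤ, ∀ n < k, spatialShift a ω n ≤ -a := by
      filter_upwards [hP.ae_nonpos_and_pos hf_meas hf_var hf_mean hκ] with ω hω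
      refine ⟨-hittingTime a ω, fun n hn => ?_⟩
      have := hω.1 (n + hittingTime a ω) (by omega)
      simp only [spatialShift]
      linarith
    have h3 : ∀ᵐ ω ∂(P.map (spatialShift a)), ∃ k : ℤ, ∀ n < k, ω n ≤ -(a : ℝ) := by
      refine (ae_map_iff mS.aemeasurable ?_).2 h2
      have : {ω : ℤ → ℝ | ∃ k : ℤ, ∀ n < k, ω n ≤ -(a : ℝ)} =
          ⋃ k : ℤ, ⋂ n : ℤ, ⋂ _ : n < k, {ω | ω n ≤ -(a : ℝ)} := by
        ext ω
        simp
      rw [this]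
      exact MeasurableSet.iUnion fun k => MeasurableSet.iInter fun n => MeasurableSet.iInter
        fun _ => measurableSet_le (measurable_pi_apply _) measurable_const
    rwa [h1] at h3
  filter_upwards [ae_all_iff.2 h] with ω hω
  refine tendsto_atBot.2 fun b => ?_
  obtain ⟨a, ha⟩ := exists_nat_ge (-b)
  obtain ⟨k, hk⟩ := hω a
  filter_upwards [eventually_lt_atBot k] with n hn
  linarith [hk n hn]

theorem HasDisintegration.map_future [IsProbabilityMeasure (jointLaw f)] (hf_meas : Measurable f)
    (hP : HasDisintegration f κ P) : P.map future = (overshootLaw f).bind (walk f) := by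
  refine Measure.ext fun A hA => ?_
  have m : Measurable fun y => walk f y A := Kernel.measurable_coe _ hA
  rw [Measure.map_apply measurable_future hA,
    Measure.bind_apply hA (walk f).measurable.aemeasurable,
    ← lintegral_overshootLaw hf_meas m, ← lintegral_indicator_one (measurable_future hA)]
  have h := hP.lintegral_past_future (G := fun _ t => A.indicator 1 t)
    ((measurable_one.indicator hA).comp measurable_snd)
  refine Eq.trans ?_ (h.trans (lintegral_congr fun q => ?_))
  · rfl
  · rw [lintegral_const, measure_univ, mul_one, lintegral_indicator_one hA]

theorem HasDisintegration.isSpatiallyStationaryWalk [IsProbabilityMeasure P]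
    (hf_meas : Measurable f) (hf_var : MemLp (fun u : ℝ => u) 2 (stepLaw f))
    (hf_mean : ∫ u, u ∂(stepLaw f) = 0)
    (hκ : ∀ x, 0 ≤ x → IsConditionedWalk f x (κ x)) (hP : HasDisintegration f κ P) :
    IsSpatiallyStationaryWalk f P := by
  have := isProbabilityMeasure_jointLaw hf_meas hf_var hf_mean
  have hsign := hP.ae_nonpos_and_pos hf_meas hf_var hf_mean hκ
  have hbot := hP.ae_tendsto_atBot hf_meas hf_var hf_mean hκ
  have hnonneg := fun {x : ℝ} (hx : 0 ≤ x) =>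
    hP.map_spatialShift_of_nonneg hf_meas hf_var hf_mean hκ hx
  have hsup : ∀ᵐ ω ∂P, limsup (fun n : ℤ => (ω n : EReal)) atTop = ⊤ := by
    filter_upwards [hsign, ae_all_iff.2 fun j : ℕ =>
      hP.ae_exists_isLeast hf_meas hf_var hf_mean hκ (Nat.cast_nonneg j)] with ω h1 h2
    exact limsup_eq_top_of_unbounded ⟨0, h1.1⟩ fun j => by
      obtain ⟨k, -, hk⟩ := h2 j
      exact ⟨k, hk.1⟩
  refine ⟨⟨inferInstance, hbot, hsup, fun x => ?_⟩, hP.map_future hf_meas⟩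
  rcases le_or_gt 0 x with hx | hx
  · exact hnonneg hx
  have hx' : 0 ≤ -x := by linarith
  -- A negative level is undone by the opposite one: almost surely `Θ_x` inverts `Θ_{-x}`.
  conv_lhs => rw [← hnonneg hx']
  rw [Measure.map_map (measurable_spatialShift _) (measurable_spatialShift _)]
  refine (Measure.map_congr ?_).trans Measure.map_id
  filter_upwards [hsign] with ω hω
  funext n
  -- Exceeding `x` after the shift means exceeding `0` before it, and by the signs in `hω` this
  -- first happens at the original time `0`.
  have h : IsLeast {n : ℤ | x < spatialShift (-x) ω n} (-hittingTime (-x) ω) := by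
    simp only [spatialShift, sub_neg_eq_add, lt_add_iff_pos_left]
    refine ⟨?_, fun m hm => ?_⟩
    · simpa using hω.2
    · by_contra hlt
      exact absurd hm (not_lt.2 (hω.1 _ (by omega)))
  show spatialShift (-x) ω (n + hittingTime x (spatialShift (-x) ω)) - x = ω n
  rw [hittingTime_eq_of_isLeast h]
  simp [spatialShift]

end

end SpatialWalk

theorem proposition1 (f : ℝ → ℝ) (hf_meas : Measurable f) (hf_nonneg : ∀ u, 0 ≤ f u)
    [IsProbabilityMeasure (stepLaw f)]
    (hf_var : MemLp (fun u : ℝ => u) 2 (stepLaw f))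
    (hf_mean : ∫ u, u ∂(stepLaw f) = 0) :
    IsProbabilityMeasure (jointLaw f) ∧
    (∃! P : Measure (ℤ → ℝ), IsSpatiallyStationaryWalk f P) ∧
    ∃ κ : Kernel ℝ (ℕ → ℝ), IsMarkovKernel κ ∧
      (∀ x : ℝ, 0 ≤ x → IsConditionedWalk f x (κ x)) ∧
      ∀ P : Measure (ℤ → ℝ),
        IsSpatiallyStationaryWalk f P ↔ HasDisintegration f κ P := by
  have hprob := isProbabilityMeasure_jointLaw hf_meas hf_var hf_mean
  obtain ⟨κ, hmarkov, hκ0, hκ⟩ := exists_conditionedWalk hf_var hf_mean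
  obtain ⟨Q, hQ1, hQ⟩ := exists_hasDisintegration (f := f) κ hκ0
  have hQs := hQ.isSpatiallyStationaryWalk hf_meas hf_var hf_mean hκ
  -- Both properties single out the same measure `Q`, which gives uniqueness and the equivalence
  -- together.
  have huniq : ∀ P, IsSpatiallyStationaryWalk f P → P = Q := fun P hP =>
    hP.isSpatiallyStationary.eq_of_map_future hQs.isSpatiallyStationary
      (hP.map_future.trans hQs.map_future.symm)
  refine ⟨hprob, ⟨Q, hQs, huniq⟩, κ, hmarkov, hκ, fun P => ⟨fun hP => ?_, fun hP => ?_⟩⟩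
  · rw [huniq P hP]
    exact hQ
  · rw [hP.eq_of hQ]
    exact hQs
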